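/- Let $n\ge 1$ be an integer. For $s\in(0,1)$ and a (Lebesgue) measurable set $E\subset\mathbb{R}^n$ put $\tilde\chi_E=\chi_{\mathbb{R}^n\setminus E}-\chi_E$ and, for $X=(x,x_{n+1})\in\mathbb{R}^{n+1}$ with $x_{n+1}>0$, $$U_E(X)=\frac{\Gamma\big(\frac{n+s}{2}\big)}{\pi^{n/2}\,\Gamma\big(\frac s2\big)}\int_{\mathbb{R}^n}\frac{x_{n+1}^{s}}{\big(|x-y|^2+x_{n+1}^2\big)^{\frac{n+s}{2}}}\,\tilde\chi_E(y)\,dy .$$ For $x\in\mathbb{R}^n$ and $R>0$ define the rescaled extension energy $$\Phi_{E,x}(R)=\frac1{R^{n-s}}\int_{\tilde B_R^+((x,0))}y_{n+1}^{1-s}\,|\nabla U_E(Y)|^2\,dY\in[0,\infty],\qquad \tilde B_R^+((x,0))=\{Y\in\mathbb{R}^{n+1}:|Y-(x,0)|<R,\ y_{n+1}>0\}.$$ The set $E$ has locally finite perimeter if $\chi_E\in \mathrm{BV}_{\mathrm{loc}}(\mathbb{R}^n)$; then the distributional gradient $\nabla\chi_E$ is an $\mathbb{R}^n$-valued Radon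 measure with total variation measure $|\nabla\chi_E|$, and the reduced boundary $\partial^*E$ is the set of all $x\in\partial E$ such that $|\nabla\chi_E|(B_r(x))>0$ for all $r>0$ and the limit $\lim_{r\to0^+}\nabla\chi_E(B_r(x))/|\nabla\chi_E|(B_r(x))$ exists and is a unit vector. Let $\mathbb{R}^n_+=\{x\in\mathbb{R}^n: x_n>0\}$. Then there is a constant $C>0$ depending only on $n$ such that the following holds for every $s\in(0,1)$. One has $$\Phi_{\mathbb{R}^n_+,0}(1)=\frac{2\pi^{\frac n2-1}\,\Gamma\big(\frac{s+1}2\big)\,\Gamma\big(\frac{1-s}2\big)}{\Gamma\big(\frac s2\big)\,\Gamma\big(\frac{n-s}2+1\big)}>0,$$ and for every measurable set $E\subset\mathbb{R}^n$ with locally finite perimeter and every $x\in\partial^*E$, $$\lim_{R\to0^+}\Phi_{E,x}(R)=\Phi_{\mathbb{R}^n_+,0}(1)\qquad\text{and, in particular,}\qquad \lim_{R\to0^+}\Phi_{E,x}(R)\ge\frac{C\,s}{1-s}.$$ -/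

import Mathlib

open MeasureTheory Filter Topology Set
open scoped ENNReal

noncomputable section

namespace FracPerimeter

/-- `ℝⁿ` with its Euclidean norm. -/
abbrev Rn (n : ℕ) := EuclideanSpace ℝ (Fin n)

/-! ### Functions of bounded variation and sets of locally finite perimeter -/

/-- The divergence of a vector field on `ℝⁿ`. -/
def divergence {n : ℕ} (φ : Rn n → Rn n) (x : Rn n) : ℝ :=
  ∑ i : Fin n, fderiv ℝ φ x (EuclideanSpace.single i 1) i

/-- `φ ∈ C¹₀(Ω; ℝⁿ)`: a `C¹` field with compact support contained in `Ω`. -/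
def IsTestField {n : ℕ} (Ω : Set (Rn n)) (φ : Rn n → Rn n) : Prop :=
  ContDiff ℝ 1 φ ∧ HasCompactSupport φ ∧ tsupport φ ⊆ Ω

/-- The total variation of `u` in `Ω`, as a supremum over test fields bounded by `1`. -/
def totalVariation {n : ℕ} (u : Rn n → ℝ) (Ω : Set (Rn n)) : ℝ≥0∞ :=
  ⨆ (φ : Rn n → Rn n) (_ : IsTestField Ω φ) (_ : ∀ x, ‖φ x‖ ≤ 1),
    ENNReal.ofReal (∫ x in Ω, u x * divergence φ x)

/-- `u ∈ BV(Ω)`. -/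
def IsBV {n : ℕ} (u : Rn n → ℝ) (Ω : Set (Rn n)) : Prop :=
  IntegrableOn u Ω ∧ totalVariation u Ω < ∞

/-- `u ∈ BV_loc(Ω)`: `u ∈ BV(Ω')` for every open `Ω' ⊂⊂ Ω`. -/
def IsBVLoc {n : ℕ} (u : Rn n → ℝ) (Ω : Set (Rn n)) : Prop :=
  ∀ Ω' : Set (Rn n), IsOpen Ω' → IsCompact (closure Ω') → closure Ω' ⊆ Ω → IsBV u Ω'

/-- The characteristic function of `E`. -/
def chi {n : ℕ} (E : Set (Rn n)) : Rn n → ℝ := E.indicator fun _ => 1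

/-- `E` has locally finite perimeter (in `ℝⁿ`). -/
def HasLocallyFinitePerimeter {n : ℕ} (E : Set (Rn n)) : Prop :=
  IsBVLoc (chi E) univ

/-- The distributional gradient of `u` is the vector-valued Radon measure `σ μ`, written in polar
form: `μ` is a Radon measure (the total variation measure `|∇u|`), `σ` is a measurable field with
`|σ| = 1` `μ`-almost everywhere, and `∫ u div φ dx = - ∫ φ · σ dμ` for every `C¹` field `φ` with
compact support. For `u ∈ BV_loc(ℝⁿ)` such a pair exists, `μ` is unique, and `σ` is unique
up to `μ`-null sets. -/
def IsGradientMeasure {n : ℕ} (u : Rn n → ℝ) (μ : Measure (Rn n)) (σ : Rn n → Rn n) : Prop :=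
  IsLocallyFiniteMeasure μ ∧ Measurable σ ∧ (∀ᵐ x ∂μ, ‖σ x‖ = 1) ∧
    ∀ φ : Rn n → Rn n, IsTestField univ φ →
      ∫ x, u x * divergence φ x = - ∫ x, inner ℝ (φ x) (σ x) ∂μ

/-- The reduced boundary of `E`: the points `x ∈ ∂E` with `|∇χ_E|(B_r(x)) > 0` for all `r > 0` at
which `∇χ_E(B_r(x)) / |∇χ_E|(B_r(x))` has, as `r → 0⁺`, a limit that is a unit vector. -/
def reducedBoundary {n : ℕ} (E : Set (Rn n)) : Set (Rn n) :=
  {x | x ∈ frontier E ∧ ∃ (μ : Measure (Rn n)) (σ : Rn n → Rn n), IsGradientMeasure (chi E) μ σ ∧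
    (∀ r : ℝ, 0 < r → 0 < μ (Metric.ball x r)) ∧
    ∃ ν : Rn n, ‖ν‖ = 1 ∧
      Tendsto (fun r : ℝ => (μ.real (Metric.ball x r))⁻¹ • ∫ y in Metric.ball x r, σ y ∂μ)
        (𝓝[>] 0) (𝓝 ν)}

/-! ### The extension problem -/

/-- The first `n` coordinates `x` of `X = (x, x_{n+1}) ∈ ℝⁿ⁺¹`. -/
def horiz {n : ℕ} (X : Rn (n + 1)) : Rn n := WithLp.toLp 2 fun i => X i.castSucc

/-- The last coordinate `x_{n+1}` of `X = (x, x_{n+1}) ∈ ℝⁿ⁺¹`. -/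
def vert {n : ℕ} (X : Rn (n + 1)) : ℝ := X (Fin.last n)

/-- The point `(x, t) ∈ ℝⁿ⁺¹`. -/
def mkPoint {n : ℕ} (x : Rn n) (t : ℝ) : Rn (n + 1) :=
  WithLp.toLp 2 (Fin.snoc (α := fun _ => ℝ) (fun i => x i) t)

/-- The half-ball `B̃_R⁺(X) = B̃_R(X) ∩ {y_{n+1} > 0}` in `ℝⁿ⁺¹`. -/
def halfBall {n : ℕ} (X : Rn (n + 1)) (R : ℝ) : Set (Rn (n + 1)) :=
  Metric.ball X R ∩ {Y | 0 < vert Y}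

/-- The Poisson kernel `P_{s/2}(X, y)`. -/
def poissonKernel {n : ℕ} (s : ℝ) (X : Rn (n + 1)) (y : Rn n) : ℝ :=
  Real.Gamma ((n + s) / 2) / (Real.pi ^ ((n : ℝ) / 2) * Real.Gamma (s / 2)) *
    (vert X ^ s / (‖horiz X - y‖ ^ 2 + vert X ^ 2) ^ ((n + s) / 2))

/-- The extension `U_E` of `χ_{ℝⁿ ∖ E} - χ_E`; only its values on `{x_{n+1} > 0}` matter. -/
def extension {n : ℕ} (s : ℝ) (E : Set (Rn n)) (X : Rn (n + 1)) : ℝ :=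
  ∫ y : Rn n, poissonKernel s X y * (chi Eᶜ y - chi E y)

/-- The rescaled extension energy `Φ_{E,x}(R)`, with values in `[0, ∞]`. -/
def Phi {n : ℕ} (s : ℝ) (E : Set (Rn n)) (x : Rn n) (R : ℝ) : ℝ≥0∞ :=
  (∫⁻ Y in halfBall (mkPoint x 0) R,
    ENNReal.ofReal (vert Y ^ (1 - s) * ‖gradient (extension s E) Y‖ ^ 2)) /
      ENNReal.ofReal (R ^ ((n : ℝ) - s))

/-- The half-space `ℝⁿ₊ = {x_n > 0}` (for `n ≥ 1`). -/
def upperHalf (n : ℕ) : Set (Rn n) := {x | ∃ i : Fin n, (i : ℕ) + 1 = n ∧ 0 < x i}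

/-- The value `2 π^{n/2 - 1} Γ((s+1)/2) Γ((1-s)/2) / (Γ(s/2) Γ((n-s)/2 + 1))`. -/
def halfSpaceValue (n : ℕ) (s : ℝ) : ℝ :=
  2 * Real.pi ^ ((n : ℝ) / 2 - 1) * Real.Gamma ((s + 1) / 2) * Real.Gamma ((1 - s) / 2) /
    (Real.Gamma (s / 2) * Real.Gamma (((n : ℝ) - s) / 2 + 1))

end FracPerimeter

end

open FracPerimeter

noncomputable section

namespace FracPerimeter

/-! ### Splitting off the last coordinate -/

/-! By scaling and rotation, `Phi s E x R` is the `energy` of the sign function of the blow-up `{z |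
x + R • L z ∈ E}` (`Phi_eq_energy`). The limit therefore follows once the blow-ups converge to a
half-space in a sense for which the energy is continuous; the energy of the half-space is then
computed exactly.

Continuity (`tendsto_energy_signedChi`). The square root of the energy is a seminorm, so it suffices
that the energy of a difference `d` of sign functions tends to zero. The Poisson kernel has constant
mass, hence the gradient of a Poisson integral sees only the increments `d (x + w) - d x`.
Cauchy–Schwarz then bounds the energy by the `L²` norms of these increments on the unit ball,
integrated against `‖w‖ ^ (-(n + s + a))` with `0 < a < s` (`exists_energy_poissonIntegral_le`). For
each `w` the increments vanish in the limit by local convergence in measure, and the perimeter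
bounds dominate them by a multiple of `min ‖w‖ 1`, which is integrable against the kernel when `s +
a < 1`.

Blow-up (`tendsto_volume_ballDiff_rescaled`). The argument is quantitative and uses no compactness.
Translating `E` by `w` loses at most the integral of the negative part of `w · σ`
(`volume_translate_diff_le`). If `ν · w ≥ 0`, this is at most `‖w‖ ∫ ‖σ - ν‖ dμ`, which is `o(R ^
n)` at scale `R`. Averaging over all `w` joining a point of `E` near `x` to a point outside `E`
above the tangent plane shows that the product of the two volumes is small (`volume_upper_mul_le`).
The first volume is at least `δ (ρ R) ^ n`, by a De Giorgi iteration (`exists_density_le`), so the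
second is negligible. The same statement for the complement, with normal `-ν`, handles the region
below the plane.

Half-space (`Phi_upperHalf`). The extension depends only on the ratio of the normal coordinate to
the height, so its energy density is explicit and homogeneous; integrating it against a Gaussian in
two ways gives its integral over the unit half-ball. The factor `s / (1 - s)` comes from `Γ(x + 1) =
x Γ(x)`, what remains being continuous and positive on `[0, 1]`. -/

@[simp] lemma horiz_mkPoint {n : ℕ} (x : Rn n) (t : ℝ) : horiz (mkPoint x t) = x := by
  ext i; simp [horiz, mkPoint]

@[simp] lemma vert_mkPoint {n : ℕ} (x : Rn n) (t : ℝ) : vert (mkPoint x t) = t := by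
  simp [vert, mkPoint]

@[simp] lemma mkPoint_horiz_vert {n : ℕ} (X : Rn (n + 1)) : mkPoint (horiz X) (vert X) = X := by
  ext i
  refine Fin.lastCases ?_ (fun j => ?_) i <;> simp [horiz, mkPoint, vert]

lemma norm_sq_eq_horiz_vert {n : ℕ} (X : Rn (n + 1)) : ‖X‖ ^ 2 = ‖horiz X‖ ^ 2 + vert X ^ 2 := by
  simp [EuclideanSpace.norm_sq_eq, Fin.sum_univ_castSucc, horiz, vert]

/-- The projection onto the first `n` coordinates, as a continuous linear map. -/
def horizL (n : ℕ) : Rn (n + 1) →L[ℝ] Rn n :=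
  LinearMap.toContinuousLinearMap
    { toFun := horiz
      map_add' := fun X Y => by ext i; simp [horiz]
      map_smul' := fun c X => by ext i; simp [horiz] }

/-- The last coordinate, as a continuous linear map. -/
def vertL (n : ℕ) : Rn (n + 1) →L[ℝ] ℝ :=
  LinearMap.toContinuousLinearMap
    { toFun := vert
      map_add' := fun X Y => by simp [vert]
      map_smul' := fun c X => by simp [vert] }

@[simp] lemma horizL_apply {n : ℕ} (X : Rn (n + 1)) : horizL n X = horiz X := rfl

@[simp] lemma vertL_apply {n : ℕ} (X : Rn (n + 1)) : vertL n X = vert X := rfl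

lemma horiz_add {n : ℕ} (X Y : Rn (n + 1)) : horiz (X + Y) = horiz X + horiz Y :=
  (horizL n).map_add X Y

lemma horiz_sub {n : ℕ} (X Y : Rn (n + 1)) : horiz (X - Y) = horiz X - horiz Y :=
  (horizL n).map_sub X Y

lemma horiz_smul {n : ℕ} (c : ℝ) (X : Rn (n + 1)) : horiz (c • X) = c • horiz X :=
  (horizL n).map_smul c X

lemma vert_add {n : ℕ} (X Y : Rn (n + 1)) : vert (X + Y) = vert X + vert Y :=
  (vertL n).map_add X Y

lemma vert_sub {n : ℕ} (X Y : Rn (n + 1)) : vert (X - Y) = vert X - vert Y :=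
  (vertL n).map_sub X Y

lemma vert_smul {n : ℕ} (c : ℝ) (X : Rn (n + 1)) : vert (c • X) = c * vert X :=
  (vertL n).map_smul c X

lemma continuous_horiz {n : ℕ} : Continuous (horiz : Rn (n + 1) → Rn n) := (horizL n).continuous

lemma continuous_vert {n : ℕ} : Continuous (vert : Rn (n + 1) → ℝ) := (vertL n).continuous

lemma abs_vert_le {n : ℕ} (X : Rn (n + 1)) : |vert X| ≤ ‖X‖ := by
  apply abs_le_of_sq_le_sq _ (norm_nonneg X)
  rw [norm_sq_eq_horiz_vert]; nlinarith [sq_nonneg ‖horiz X‖]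

lemma norm_horiz_le {n : ℕ} (X : Rn (n + 1)) : ‖horiz X‖ ≤ ‖X‖ := by
  apply le_of_sq_le_sq _ (norm_nonneg X)
  rw [norm_sq_eq_horiz_vert X]; nlinarith [sq_nonneg (vert X)]

lemma mkPoint_zero_zero {n : ℕ} : mkPoint (0 : Rn n) 0 = 0 := by
  have := mkPoint_horiz_vert (0 : Rn (n + 1))
  have h1 : horiz (0 : Rn (n + 1)) = 0 := (horizL n).map_zero
  have h2 : vert (0 : Rn (n + 1)) = 0 := (vertL n).map_zero
  rwa [h1, h2] at this

lemma norm_sq_sub_mkPoint {n : ℕ} (X : Rn (n + 1)) (y : Rn n) :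
    ‖X - mkPoint y 0‖ ^ 2 = ‖horiz X - y‖ ^ 2 + vert X ^ 2 := by
  simp [norm_sq_eq_horiz_vert (X - mkPoint y 0), horiz_sub, vert_sub]

lemma measurePreserving_horiz_vert (n : ℕ) :
    MeasurePreserving (fun X : Rn (n + 1) => (horiz X, vert X)) volume volume := by
  have h1 := PiLp.volume_preserving_ofLp (Fin (n + 1))
  have h2 := volume_preserving_piFinSuccAbove (fun _ : Fin (n + 1) => ℝ) (Fin.last n)
  have h3 : MeasurePreserving (Prod.swap : ℝ × (Fin n → ℝ) → _) volume volume :=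
    Measure.measurePreserving_swap
  have h4 : MeasurePreserving (Prod.map (WithLp.toLp 2) id : (Fin n → ℝ) × ℝ → Rn n × ℝ)
      volume volume :=
    (PiLp.volume_preserving_toLp (Fin n)).prod (MeasurePreserving.id _)
  have h5 : (fun X : Rn (n + 1) => (horiz X, vert X)) = Prod.map (WithLp.toLp 2) id ∘ Prod.swap ∘
      MeasurableEquiv.piFinSuccAbove (fun _ : Fin (n + 1) => ℝ) (Fin.last n) ∘ WithLp.ofLp := by
    funext X
    simp [horiz, vert, MeasurableEquiv.piFinSuccAbove]
    rfl
  rw [h5]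
  exact h4.comp (h3.comp (h2.comp h1))

lemma lintegral_horiz_vert {n : ℕ} {f : Rn n → ℝ → ℝ≥0∞} (hf : Measurable (Function.uncurry f)) :
    ∫⁻ X : Rn (n + 1), f (horiz X) (vert X) = ∫⁻ t, ∫⁻ x, f x t := by
  have h := (measurePreserving_horiz_vert n).lintegral_comp hf
  rw [Measure.volume_eq_prod, lintegral_prod_symm _ hf.aemeasurable] at h
  exact h

/-! ### Power and Gaussian integrals -/

lemma lintegral_rpow_mul_exp_neg_mul {a r : ℝ} (ha : 0 < a) (hr : 0 < r) :
    ∫⁻ t in Ioi (0 : ℝ), ENNReal.ofReal (t ^ (a - 1) * Real.exp (-(r * t)))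
      = ENNReal.ofReal ((1 / r) ^ a * Real.Gamma a) := by
  rw [← Real.integral_rpow_mul_exp_neg_mul_Ioi ha hr, ofReal_integral_eq_lintegral_ofReal]
  -- The Bochner integral of a non-integrable function is zero, whereas the known value is positive;
  -- so integrability follows from the value.
  · by_contra h
    have := integral_undef h
    rw [Real.integral_rpow_mul_exp_neg_mul_Ioi ha hr] at this
    have h2 : 0 < (1 / r) ^ a * Real.Gamma a := by
      have := Real.Gamma_pos_of_pos ha
      positivity
    linarith
  · filter_upwards [ae_restrict_mem measurableSet_Ioi] with t ht
    have : (0 : ℝ) < t := ht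
    positivity

lemma lintegral_exp_neg_mul_norm_sq (m : ℕ) {b : ℝ} (hb : 0 < b) :
    ∫⁻ z : Rn m, ENNReal.ofReal (Real.exp (-b * ‖z‖ ^ 2))
      = ENNReal.ofReal ((Real.pi / b) ^ ((m : ℝ) / 2)) := by
  have h := GaussianFourier.integral_rexp_neg_mul_sq_norm (V := Rn m) hb
  rw [finrank_euclideanSpace_fin] at h
  rw [← h, ofReal_integral_eq_lintegral_ofReal]
  · by_contra h2
    rw [integral_undef h2] at h
    have : 0 < (Real.pi / b) ^ ((m : ℝ) / 2) := by positivity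
    linarith
  · exact ae_of_all _ fun z => (Real.exp_pos _).le

/-- Writing `Γ(b) (1 + |z|²)^(-b)` as the integral of `t^(b-1) exp(-(1 + |z|²) t)` over `t > 0` and
exchanging the integrals leaves a Gaussian in `z` and a Gamma integral in `t`. The abstract space
covers both `Rn m` and the line `ℝ`. -/
lemma lintegral_one_add_norm_sq_of_gaussian {V : Type*} [NormedAddCommGroup V] [MeasurableSpace V]
    [OpensMeasurableSpace V] {μ : Measure V} [SFinite μ] (m : ℕ)
    (hgauss : ∀ b : ℝ, 0 < b → ∫⁻ z, ENNReal.ofReal (Real.exp (-b * ‖z‖ ^ 2)) ∂μ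
      = ENNReal.ofReal ((Real.pi / b) ^ ((m : ℝ) / 2))) {b : ℝ} (hb : (m : ℝ) / 2 < b) :
    ∫⁻ z, ENNReal.ofReal ((1 + ‖z‖ ^ 2) ^ (-b)) ∂μ
      = ENNReal.ofReal (Real.pi ^ ((m : ℝ) / 2) * Real.Gamma (b - m / 2) / Real.Gamma b) := by
  have hm : (0 : ℝ) ≤ m := Nat.cast_nonneg m
  have hb0 : 0 < b := by linarith
  have hG : 0 < Real.Gamma b := Real.Gamma_pos_of_pos hb0
  have hmeas : Measurable (Function.uncurry fun (z : V) (t : ℝ) =>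
      ENNReal.ofReal (t ^ (b - 1) * Real.exp (-((1 + ‖z‖ ^ 2) * t)))) := by
    simp only [Function.uncurry_def]; fun_prop
  have key : ∫⁻ z : V, ENNReal.ofReal ((1 + ‖z‖ ^ 2) ^ (-b)) * ENNReal.ofReal (Real.Gamma b) ∂μ
      = ENNReal.ofReal (Real.pi ^ ((m : ℝ) / 2) * Real.Gamma (b - m / 2)) := by
    calc _ = ∫⁻ z : V, (∫⁻ t in Ioi (0 : ℝ),
          ENNReal.ofReal (t ^ (b - 1) * Real.exp (-((1 + ‖z‖ ^ 2) * t)))) ∂μ := by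
          refine lintegral_congr fun z => ?_
          have hz : 0 < 1 + ‖z‖ ^ 2 := by positivity
          rw [lintegral_rpow_mul_exp_neg_mul hb0 hz, ← ENNReal.ofReal_mul (by positivity),
            one_div, Real.inv_rpow hz.le, Real.rpow_neg hz.le]
      _ = ∫⁻ t in Ioi (0 : ℝ), ∫⁻ z : V,
          ENNReal.ofReal (t ^ (b - 1) * Real.exp (-((1 + ‖z‖ ^ 2) * t))) ∂μ :=
          lintegral_lintegral_swap hmeas.aemeasurable
      _ = ∫⁻ t in Ioi (0 : ℝ), ENNReal.ofReal (Real.pi ^ ((m : ℝ) / 2)) *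
            ENNReal.ofReal (t ^ (b - m / 2 - 1) * Real.exp (-(1 * t))) := by
          refine setLIntegral_congr_fun measurableSet_Ioi fun t ht => ?_
          have ht : (0 : ℝ) < t := ht
          have h1 : ∀ z : V, ENNReal.ofReal (t ^ (b - 1) * Real.exp (-((1 + ‖z‖ ^ 2) * t)))
              = ENNReal.ofReal (t ^ (b - 1) * Real.exp (-t)) *
                ENNReal.ofReal (Real.exp (-t * ‖z‖ ^ 2)) := fun z => by
            rw [← ENNReal.ofReal_mul (by positivity), mul_assoc, ← Real.exp_add]
            congr 3; ring
          simp_rw [h1]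
          rw [lintegral_const_mul _ (by fun_prop), hgauss t ht,
            ← ENNReal.ofReal_mul (by positivity), ← ENNReal.ofReal_mul (by positivity),
            Real.div_rpow Real.pi_pos.le ht.le,
            show b - m / 2 - 1 = (b - 1) - m / 2 by ring, Real.rpow_sub ht (b - 1),
            one_mul]
          congr 1; ring
      _ = _ := by
          rw [lintegral_const_mul _ (by fun_prop),
            lintegral_rpow_mul_exp_neg_mul (by linarith) one_pos,
            ← ENNReal.ofReal_mul (by positivity)]
          simp
  rw [lintegral_mul_const _ (by fun_prop)] at key
  rw [ENNReal.ofReal_div_of_pos hG, ← key, ENNReal.mul_div_cancel_right (by simpa using hG)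
    ENNReal.ofReal_ne_top]

/-- The value of `∫ (1 + |z|²)^(-b) dz` over `ℝᵐ`. -/
lemma lintegral_one_add_norm_sq (m : ℕ) {b : ℝ} (hb : (m : ℝ) / 2 < b) :
    ∫⁻ z : Rn m, ENNReal.ofReal ((1 + ‖z‖ ^ 2) ^ (-b))
      = ENNReal.ofReal (Real.pi ^ ((m : ℝ) / 2) * Real.Gamma (b - m / 2) / Real.Gamma b) :=
  lintegral_one_add_norm_sq_of_gaussian m (fun _ h => lintegral_exp_neg_mul_norm_sq m h) hb

lemma lintegral_one_add_sq {b : ℝ} (hb : 1 / 2 < b) :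
    ∫⁻ z : ℝ, ENNReal.ofReal ((1 + z ^ 2) ^ (-b))
      = ENNReal.ofReal (Real.pi ^ (1 / 2 : ℝ) * Real.Gamma (b - 1 / 2) / Real.Gamma b) := by
  have h := lintegral_one_add_norm_sq_of_gaussian (μ := (volume : Measure ℝ)) 1 (b := b)
    (fun c hc => ?_) (by simpa using hb)
  · simpa using h
  · have h := integral_gaussian c
    have h2 := integrable_exp_neg_mul_sq hc
    simp only [Real.norm_eq_abs, sq_abs]
    rw [← ofReal_integral_eq_lintegral_ofReal h2 (ae_of_all _ fun z => (Real.exp_pos _).le), h,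
      Real.sqrt_eq_rpow]
    simp

/-- Substitution `z = A w` in a Lebesgue integral over a finite-dimensional space. -/
lemma lintegral_comp_smul {V : Type*} [NormedAddCommGroup V] [NormedSpace ℝ V]
    [FiniteDimensional ℝ V] [MeasurableSpace V] [BorelSpace V] (μ : Measure V) [μ.IsAddHaarMeasure]
    {A : ℝ} (hA : 0 < A) {f : V → ℝ≥0∞} (hf : Measurable f) :
    ∫⁻ z, f z ∂μ = ENNReal.ofReal (A ^ Module.finrank ℝ V) * ∫⁻ z, f (A • z) ∂μ := by
  have h := Measure.map_addHaar_smul μ hA.ne'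
  have h2 : ∫⁻ z, f (A • z) ∂μ = ENNReal.ofReal |(A ^ Module.finrank ℝ V)⁻¹| * ∫⁻ z, f z ∂μ := by
    rw [← lintegral_map hf (by fun_prop : Measurable fun z : V => A • z), h,
      lintegral_smul_measure, smul_eq_mul]
  rw [h2, ← mul_assoc, ← ENNReal.ofReal_mul (by positivity), abs_of_pos (by positivity),
    mul_inv_cancel₀ (by positivity)]
  simp

lemma rpow_norm_smul_sq {m : ℕ} {A b : ℝ} (hA : 0 < A) (z : Rn m) :
    (‖A • z‖ ^ 2 + A ^ 2) ^ (-b) = A ^ (-2 * b) * (1 + ‖z‖ ^ 2) ^ (-b) := by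
  rw [norm_smul, Real.norm_of_nonneg hA.le,
    show (A * ‖z‖) ^ 2 + A ^ 2 = A ^ (2 : ℝ) * (1 + ‖z‖ ^ 2) by rw [Real.rpow_two]; ring,
    Real.mul_rpow (by positivity) (by positivity), ← Real.rpow_mul hA.le]
  congr 2; ring

lemma lintegral_norm_sq_add_sq (m : ℕ) {A b : ℝ} (hA : 0 < A) (hb : (m : ℝ) / 2 < b) :
    ∫⁻ z : Rn m, ENNReal.ofReal ((‖z‖ ^ 2 + A ^ 2) ^ (-b))
      = ENNReal.ofReal (A ^ (m - 2 * b) *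
        (Real.pi ^ ((m : ℝ) / 2) * Real.Gamma (b - m / 2) / Real.Gamma b)) := by
  rw [lintegral_comp_smul volume hA (by fun_prop), finrank_euclideanSpace_fin]
  simp_rw [rpow_norm_smul_sq hA, ENNReal.ofReal_mul (Real.rpow_nonneg hA.le (-2 * b))]
  rw [lintegral_const_mul _ (by fun_prop), lintegral_one_add_norm_sq m hb, ← mul_assoc,
    ← ENNReal.ofReal_mul (by positivity), ← ENNReal.ofReal_mul (by positivity)]
  congr 2
  rw [← Real.rpow_natCast, ← Real.rpow_add hA]
  congr 1; ring

lemma integrable_norm_sq_add_sq (m : ℕ) {A b : ℝ} (hA : 0 < A) (hb : (m : ℝ) / 2 < b) :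
    Integrable fun z : Rn m => (‖z‖ ^ 2 + A ^ 2) ^ (-b) := by
  refine ⟨(by fun_prop : Measurable _).aestronglyMeasurable, ?_⟩
  rw [hasFiniteIntegral_iff_ofReal (ae_of_all _ fun z => by positivity),
    lintegral_norm_sq_add_sq m hA hb]
  exact ENNReal.ofReal_lt_top

lemma integral_norm_sq_add_sq (m : ℕ) {A b : ℝ} (hA : 0 < A) (hb : (m : ℝ) / 2 < b) :
    ∫ z : Rn m, (‖z‖ ^ 2 + A ^ 2) ^ (-b) = A ^ (m - 2 * b) *
        (Real.pi ^ ((m : ℝ) / 2) * Real.Gamma (b - m / 2) / Real.Gamma b) := by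
  have hm : (0 : ℝ) ≤ m := Nat.cast_nonneg m
  have h1 := Real.Gamma_pos_of_pos (s := b) (by linarith)
  have h2 := Real.Gamma_pos_of_pos (s := b - m / 2) (by linarith)
  rw [integral_eq_lintegral_of_nonneg_ae (ae_of_all _ fun z => by positivity)
      (integrable_norm_sq_add_sq m hA hb).aestronglyMeasurable,
    lintegral_norm_sq_add_sq m hA hb, ENNReal.toReal_ofReal (by positivity)]

/-! ### The extension of a half-space -/

lemma inner_eq_horiz_vert {n : ℕ} (X Y : Rn (n + 1)) :
    inner ℝ X Y = inner ℝ (horiz X) (horiz Y) + vert X * vert Y := by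
  simp [PiLp.inner_apply, Fin.sum_univ_castSucc, horiz, vert, mul_comm]

lemma integral_horiz_vert {n : ℕ} {f : Rn n → ℝ → ℝ} (hm : Measurable (Function.uncurry f))
    (hf : Integrable fun X : Rn (n + 1) => f (horiz X) (vert X)) :
    ∫ X : Rn (n + 1), f (horiz X) (vert X) = ∫ t, ∫ x, f x t := by
  have hp := measurePreserving_horiz_vert n
  have h1 : Integrable (Function.uncurry f) (volume : Measure (Rn n × ℝ)) :=
    (hp.integrable_comp hm.aestronglyMeasurable).1 hf
  have h2 := integral_map (μ := volume) hp.measurable.aemeasurable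
    (f := Function.uncurry f) hm.aestronglyMeasurable
  rw [hp.map_eq, Measure.volume_eq_prod, integral_prod_symm _ h1] at h2
  exact h2.symm

lemma upperHalf_succ (m : ℕ) : upperHalf (m + 1) = {x | 0 < vert x} := by
  ext x
  simp only [upperHalf, mem_ofPred_eq, vert]
  constructor
  · rintro ⟨i, hi, h⟩
    obtain rfl : i = Fin.last m := Fin.ext (by simpa using hi)
    exact h
  · exact fun h => ⟨Fin.last m, by simp, h⟩

/-- The function `χ_{ℝⁿ ∖ E} - χ_E`. -/
def signedChi {n : ℕ} (E : Set (Rn n)) (y : Rn n) : ℝ := chi Eᶜ y - chi E y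

lemma signedChi_of_mem {n : ℕ} {E : Set (Rn n)} {y : Rn n} (h : y ∈ E) : signedChi E y = -1 := by
  simp [signedChi, chi, h]

lemma signedChi_of_notMem {n : ℕ} {E : Set (Rn n)} {y : Rn n} (h : y ∉ E) :
    signedChi E y = 1 := by
  simp [signedChi, chi, h]

lemma measurable_signedChi {n : ℕ} {E : Set (Rn n)} (hE : MeasurableSet E) :
    Measurable (signedChi E) :=
  (measurable_const.indicator hE.compl).sub (measurable_const.indicator hE)

/-- The normalizing constant of the Poisson kernel. -/
def poissonConst (n : ℕ) (s : ℝ) : ℝ :=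
  Real.Gamma ((n + s) / 2) / (Real.pi ^ ((n : ℝ) / 2) * Real.Gamma (s / 2))

lemma poissonConst_pos (n : ℕ) {s : ℝ} (hs : 0 < s) : 0 < poissonConst n s := by
  have h1 := Real.Gamma_pos_of_pos (s := (n + s) / 2) (by positivity)
  have h2 := Real.Gamma_pos_of_pos (s := s / 2) (by positivity)
  unfold poissonConst; positivity

lemma poissonKernel_eq {n : ℕ} (s : ℝ) (X : Rn (n + 1)) (y : Rn n) :
    poissonKernel s X y = poissonConst n s * vert X ^ s *
      (‖horiz X - y‖ ^ 2 + vert X ^ 2) ^ (-((n + s) / 2)) := by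
  rw [poissonKernel, poissonConst, Real.rpow_neg (by positivity)]; ring

lemma integrable_kernel_rpow {n : ℕ} {s : ℝ} (hs : 0 < s) {X : Rn (n + 1)} (hX : 0 < vert X) :
    Integrable fun y : Rn n => (‖horiz X - y‖ ^ 2 + vert X ^ 2) ^ (-((n + s) / 2)) :=
  (integrable_norm_sq_add_sq n hX (b := (n + s) / 2) (by linarith)).comp_sub_left (horiz X)

lemma integrable_poissonKernel {n : ℕ} {s : ℝ} (hs : 0 < s) {X : Rn (n + 1)} (hX : 0 < vert X) :
    Integrable (poissonKernel s X) := by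
  have h := (integrable_kernel_rpow hs hX).const_mul (poissonConst n s * vert X ^ s)
  exact h.congr (ae_of_all _ fun y => (poissonKernel_eq s X y).symm)

/-- After the change of variable this is the mass of `q` on `[a, ∞)` minus its mass on `(-∞, a)`; by
evenness the tails cancel and only the interval between `-a` and `a` survives. -/
lemma integral_sign_mul_even {q : ℝ → ℝ} (hq : Integrable q) (he : ∀ r, q (-r) = q r) (a : ℝ) :
    ∫ r, (if 0 < r then -1 else 1) * q (a - r) = -2 * ∫ r in 0..a, q r := by
  have h1 : ∫ r, (if 0 < r then -1 else 1) * q (a - r)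
      = ∫ r, (if 0 < a - r then -1 else 1) * q r := by
    rw [← integral_sub_left_eq_self (fun r => (if 0 < a - r then -1 else 1) * q r) volume a]
    simp
  have h2 : ∀ r, (if 0 < a - r then -1 else 1) * q r
      = (Ici a).indicator q r - (Iio a).indicator q r := by
    intro r
    by_cases h : r < a
    · simp [h]
    · simp [not_lt.1 h]
  simp_rw [h1, h2]
  rw [integral_sub (hq.indicator measurableSet_Ici) (hq.indicator measurableSet_Iio),
    integral_indicator measurableSet_Ici, integral_indicator measurableSet_Iio,
    integral_Ici_eq_integral_Ioi, ← integral_Iic_eq_integral_Iio]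
  have h3 : ∫ r in Ioi a, q r = ∫ r in Iic (-a), q r := by
    rw [← integral_comp_neg_Ioi]; simp [he]
  rw [h3, intervalIntegral.integral_Iic_sub_Iic hq.integrableOn hq.integrableOn,
    ← intervalIntegral.integral_add_adjacent_intervals (b := 0) hq.intervalIntegrable
      hq.intervalIntegrable]
  have h4 : ∫ r in (0 : ℝ)..(-a), q r = ∫ r in a..0, q r := by
    have := intervalIntegral.integral_comp_neg (a := a) (b := 0) q
    simp only [he, neg_zero] at this
    exact this.symm
  rw [h4, intervalIntegral.integral_symm 0 a]
  ring

/-- The normalizing constant of the one-dimensional Poisson kernel. -/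
def lineConst (s : ℝ) : ℝ := Real.Gamma ((1 + s) / 2) / (Real.pi ^ (1 / 2 : ℝ) * Real.Gamma (s / 2))

/-- Integrating the Poisson kernel over the `m` tangential variables leaves the one-dimensional
kernel; this is the resulting identity of constants. -/
lemma poissonConst_mul_marginal (m : ℕ) {s : ℝ} (hs : 0 < s) :
    poissonConst (m + 1) s * (Real.pi ^ ((m : ℝ) / 2) *
      Real.Gamma ((((m + 1 : ℕ) : ℝ) + s) / 2 - m / 2) / Real.Gamma ((((m + 1 : ℕ) : ℝ) + s) / 2))
      = lineConst s := by
  have h1 := Real.Gamma_pos_of_pos (s := (((m + 1 : ℕ) : ℝ) + s) / 2) (by positivity)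
  have h2 := Real.Gamma_pos_of_pos (s := s / 2) (by positivity)
  have h3 : (((m + 1 : ℕ) : ℝ) + s) / 2 - m / 2 = (1 + s) / 2 := by push_cast; ring
  have h4 : Real.pi ^ (((m + 1 : ℕ) : ℝ) / 2) = Real.pi ^ ((m : ℝ) / 2) * Real.pi ^ (1 / 2 : ℝ) := by
    rw [← Real.rpow_add Real.pi_pos]; congr 1; push_cast; ring
  rw [poissonConst, lineConst, h3, h4]
  have := Real.rpow_pos_of_pos Real.pi_pos ((m : ℝ) / 2)
  have := Real.rpow_pos_of_pos Real.pi_pos (1 / 2 : ℝ)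
  field_simp

lemma intervalIntegral_sq_add_sq {s t a : ℝ} (ht : 0 < t) :
    t ^ s * ∫ r in 0..a, (r ^ 2 + t ^ 2) ^ (-((1 + s) / 2))
      = ∫ z in 0..(a / t), (1 + z ^ 2) ^ (-((1 + s) / 2)) := by
  have h1 : ∀ r : ℝ, (r ^ 2 + t ^ 2) ^ (-((1 + s) / 2))
      = t ^ (-(1 + s)) * (1 + (r / t) ^ 2) ^ (-((1 + s) / 2)) := by
    intro r
    rw [show r ^ 2 + t ^ 2 = t ^ (2 : ℝ) * (1 + (r / t) ^ 2) by
      rw [Real.rpow_two]; field_simp; ring, Real.mul_rpow (by positivity) (by positivity),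
      ← Real.rpow_mul ht.le]
    congr 2; ring
  simp_rw [h1]
  rw [intervalIntegral.integral_const_mul,
    intervalIntegral.integral_comp_div (fun z : ℝ => (1 + z ^ 2) ^ (-((1 + s) / 2))) ht.ne',
    zero_div, smul_eq_mul, ← mul_assoc, ← mul_assoc, ← Real.rpow_add ht, ← Real.rpow_add_one ht.ne']
  simp

/-- The sign of the half-space depends on the last variable alone, so Fubini removes the tangential
variables and leaves a one-dimensional convolution of a sign with an even kernel. Scaling by the
height makes it a function of a single ratio. -/
lemma extension_upperHalf {m : ℕ} {s : ℝ} (hs : 0 < s) {X : Rn (m + 2)} (hX : 0 < vert X) :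
    extension s (upperHalf (m + 1)) X = -2 * lineConst s *
      ∫ z in 0..(vert (horiz X) / vert X), (1 + z ^ 2) ^ (-((1 + s) / 2)) := by
  set t := vert X with ht
  set b : ℝ := (((m + 1 : ℕ) : ℝ) + s) / 2 with hb
  have hbm : (m : ℝ) / 2 < b := by rw [hb]; push_cast; linarith
  set f : Rn m → ℝ → ℝ := fun y r => poissonConst (m + 1) s * t ^ s *
    (‖horiz (horiz X) - y‖ ^ 2 + (vert (horiz X) - r) ^ 2 + t ^ 2) ^ (-b) *
      (if 0 < r then -1 else 1) with hf
  have h1 : ∀ y : Rn (m + 1), poissonKernel s X y * (chi (upperHalf (m + 1))ᶜ y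
      - chi (upperHalf (m + 1)) y) = f (horiz y) (vert y) := by
    intro y
    rw [poissonKernel_eq, norm_sq_eq_horiz_vert (horiz X - y), horiz_sub, vert_sub]
    congr 1
    by_cases h : 0 < vert y
    · rw [if_pos h]
      exact signedChi_of_mem (by rw [upperHalf_succ]; exact h)
    · rw [if_neg h]
      exact signedChi_of_notMem (by rw [upperHalf_succ]; exact h)
  have hfm : Measurable (Function.uncurry f) := by
    have : Measurable fun r : ℝ => if 0 < r then (-1 : ℝ) else 1 :=
      Measurable.ite measurableSet_Ioi measurable_const measurable_const
    simp only [hf, Function.uncurry_def]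
    exact Measurable.mul (by fun_prop) (this.comp measurable_snd)
  have hfi : Integrable fun y : Rn (m + 1) => f (horiz y) (vert y) := by
    have hS : MeasurableSet (upperHalf (m + 1)) := by
      rw [upperHalf_succ]; exact measurableSet_lt measurable_const continuous_vert.measurable
    refine ((integrable_poissonKernel hs hX).mul_bdd (c := 1)
      (measurable_signedChi hS).aestronglyMeasurable (ae_of_all _ fun y => ?_)).congr
      (ae_of_all _ fun y => h1 y)
    by_cases h : y ∈ upperHalf (m + 1)
    · simp [signedChi_of_mem h]
    · simp [signedChi_of_notMem h]
  rw [extension]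
  simp_rw [h1]
  rw [integral_horiz_vert hfm hfi]
  have h2 : ∀ r, ∫ y, f y r = lineConst s * t ^ s * ((if 0 < r then -1 else 1) *
      ((vert (horiz X) - r) ^ 2 + t ^ 2) ^ (-((1 + s) / 2))) := by
    intro r
    simp only [hf]
    -- For fixed `r` the tangential integral is that of `(‖y‖² + A²)^(-b)`, with this square root as
    -- `A`.
    have hA : 0 < √((vert (horiz X) - r) ^ 2 + t ^ 2) := by positivity
    rw [integral_mul_const, integral_const_mul,
      integral_sub_left_eq_self (fun y : Rn m =>
        (‖y‖ ^ 2 + (vert (horiz X) - r) ^ 2 + t ^ 2) ^ (-b)) volume (horiz (horiz X))]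
    have h3 := integral_norm_sq_add_sq m hA hbm
    rw [Real.sq_sqrt (by positivity)] at h3
    simp only [add_assoc]
    rw [h3, ← poissonConst_mul_marginal m hs, ← hb, Real.sqrt_eq_rpow,
      ← Real.rpow_mul (by positivity)]
    have h4 : 1 / 2 * ((m : ℝ) - 2 * b) = -((1 + s) / 2) := by rw [hb]; push_cast; ring
    rw [h4]; ring
  simp_rw [h2]
  rw [integral_const_mul]
  have hq : Integrable fun r : ℝ => (r ^ 2 + t ^ 2) ^ (-((1 + s) / 2)) := by
    have h5 : ∀ r : ℝ, (r ^ 2 + t ^ 2) ^ (-((1 + s) / 2))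
        = t ^ (-(1 + s)) * (1 + ‖t⁻¹ * r‖ ^ 2) ^ (-(1 + s) / 2) := by
      intro r
      rw [show r ^ 2 + t ^ 2 = t ^ (2 : ℝ) * (1 + ‖t⁻¹ * r‖ ^ 2) by
        rw [Real.rpow_two, Real.norm_eq_abs, sq_abs]; field_simp; ring,
        Real.mul_rpow (by positivity) (by positivity), ← Real.rpow_mul hX.le, neg_div]
      congr 2; ring
    simp_rw [h5]
    exact ((integrable_rpow_neg_one_add_norm_sq (E := ℝ) (r := 1 + s) (by simp; linarith)
      ).comp_mul_left' (inv_ne_zero hX.ne')).const_mul _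
  rw [integral_sign_mul_even (q := fun r : ℝ => (r ^ 2 + t ^ 2) ^ (-((1 + s) / 2))) hq (by simp),
    ← intervalIntegral_sq_add_sq hX]
  ring

/-- With `w = x / t` the chain rule gives `|∇w|² = (1 + w²) / t²`, while the profile contributes `4
c² (1 + w²)^(-(1 + s))`; one power of `1 + w²` cancels. -/
lemma norm_gradient_extension_upperHalf {m : ℕ} {s : ℝ} (hs : 0 < s) {X : Rn (m + 2)}
    (hX : 0 < vert X) :
    ‖gradient (extension s (upperHalf (m + 1))) X‖ ^ 2
      = 4 * lineConst s ^ 2 * ((1 + (vert (horiz X) / vert X) ^ 2) ^ (-s) / vert X ^ 2) := by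
  set t := vert X with ht
  set x := vert (horiz X) with hx
  set β : ℝ := (1 + s) / 2 with hβ
  set k : ℝ := -2 * lineConst s * (1 + (x / t) ^ 2) ^ (-β) with hk
  have hΘ : HasDerivAt (fun w : ℝ => -2 * lineConst s * ∫ z in 0..w, (1 + z ^ 2) ^ (-β)) k (x / t) := by
    have hc : Continuous fun z : ℝ => (1 + z ^ 2) ^ (-β) :=
      Continuous.rpow_const (by fun_prop) fun z => Or.inl (by positivity)
    exact (hc.integral_hasStrictDerivAt 0 (x / t)).hasDerivAt.const_mul _
  have hw : HasFDerivAt (fun Y : Rn (m + 2) => vert (horiz Y) / vert Y)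
      (t⁻¹ • (vertL m ∘L horizL (m + 1)) - (x / t ^ 2) • vertL (m + 1)) X := by
    have h1 : HasFDerivAt (fun Y : Rn (m + 2) => vert (horiz Y)) (vertL m ∘L horizL (m + 1)) X :=
      (vertL m ∘L horizL (m + 1)).hasFDerivAt
    have h2 : HasFDerivAt (fun Y : Rn (m + 2) => vert Y) (vertL (m + 1)) X :=
      (vertL (m + 1)).hasFDerivAt
    have h3 : HasFDerivAt (fun Y : Rn (m + 2) => (vert Y)⁻¹) (-(t ^ 2)⁻¹ • vertL (m + 1)) X :=
      (hasDerivAt_inv hX.ne').comp_hasFDerivAt X h2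
    have h4 := h1.mul h3
    refine h4.congr_fderiv ?_
    ext Y
    simp [← hx, ← ht]
    ring
  have hU : HasGradientAt (extension s (upperHalf (m + 1)))
      (k • mkPoint (mkPoint 0 t⁻¹) (-(x / t ^ 2))) X := by
    rw [hasGradientAt_iff_hasFDerivAt]
    have h1 := hΘ.comp_hasFDerivAt X hw
    have h2 : extension s (upperHalf (m + 1)) =ᶠ[𝓝 X] (fun w : ℝ => -2 * lineConst s *
        ∫ z in 0..w, (1 + z ^ 2) ^ (-β)) ∘ fun Y : Rn (m + 2) => vert (horiz Y) / vert Y := by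
      filter_upwards [continuous_vert.continuousAt.eventually (lt_mem_nhds hX)] with Y hY
      exact extension_upperHalf hs hY
    refine (h1.congr_of_eventuallyEq h2).congr_fderiv ?_
    ext Y
    simp [inner_eq_horiz_vert]
    left; ring
  rw [hU.gradient, norm_smul, mul_pow, Real.norm_eq_abs, sq_abs,
    norm_sq_eq_horiz_vert (mkPoint _ _), horiz_mkPoint, vert_mkPoint, norm_sq_eq_horiz_vert,
    horiz_mkPoint, vert_mkPoint, hk]
  have h5 : (1 + (x / t) ^ 2) ^ (-s) = ((1 + (x / t) ^ 2) ^ (-β)) ^ 2 * (1 + (x / t) ^ 2) := by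
    rw [← Real.rpow_mul_natCast (by positivity), ← Real.rpow_add_one (by positivity)]
    congr 1; rw [hβ]; push_cast; ring
  rw [h5]
  simp only [norm_zero]
  field_simp
  ring

/-! ### The energy of a half-space -/

/-- The homogeneous density `t^(s-1) (t² + xₙ²)^(-s)` on `{t > 0}`, to which the energy density of a
half-space is proportional. -/
def halfSpaceDensity {m : ℕ} (s : ℝ) (Y : Rn (m + 2)) : ℝ≥0∞ :=
  {Y | 0 < vert Y}.indicator
    (fun Y => ENNReal.ofReal (vert Y ^ (s - 1) * (vert Y ^ 2 + vert (horiz Y) ^ 2) ^ (-s))) Y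

lemma measurableSet_vert_pos (n : ℕ) : MeasurableSet {Y : Rn (n + 1) | 0 < vert Y} :=
  measurableSet_lt measurable_const continuous_vert.measurable

@[fun_prop]
lemma measurable_vert {n : ℕ} : Measurable (vert : Rn (n + 1) → ℝ) := continuous_vert.measurable

@[fun_prop]
lemma measurable_horiz {n : ℕ} : Measurable (horiz : Rn (n + 1) → Rn n) :=
  continuous_horiz.measurable

lemma measurable_halfSpaceDensity {m : ℕ} (s : ℝ) :
    Measurable (halfSpaceDensity s : Rn (m + 2) → ℝ≥0∞) :=
  Measurable.indicator (by fun_prop) (measurableSet_vert_pos _)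

lemma halfSpaceDensity_smul {m : ℕ} (s : ℝ) {R : ℝ} (hR : 0 < R) (Y : Rn (m + 2)) :
    halfSpaceDensity s (R • Y) = ENNReal.ofReal (R ^ (-(1 + s))) * halfSpaceDensity s Y := by
  by_cases hY : 0 < vert Y
  · rw [halfSpaceDensity, halfSpaceDensity, indicator_of_mem, indicator_of_mem,
      ← ENNReal.ofReal_mul (by positivity)]
    · congr 1
      rw [horiz_smul, vert_smul, vert_smul, Real.mul_rpow hR.le hY.le,
        show (R * vert Y) ^ 2 + (R * vert (horiz Y)) ^ 2
          = R ^ (2 : ℝ) * (vert Y ^ 2 + vert (horiz Y) ^ 2) by rw [Real.rpow_two]; ring,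
        Real.mul_rpow (by positivity) (by positivity), ← Real.rpow_mul hR.le,
        show -(1 + s) = (s - 1) + 2 * (-s) by ring, Real.rpow_add hR]
      ring
    · exact hY
    · simpa [vert_smul] using mul_pos hR hY
  · rw [halfSpaceDensity, halfSpaceDensity, indicator_of_notMem, indicator_of_notMem, mul_zero]
    · exact hY
    · simpa [vert_smul] using mul_nonpos_of_nonneg_of_nonpos hR.le (not_lt.1 hY)

/-- The exponent is the dimension `m + 2` plus the degree of homogeneity `-(1 + s)`. -/
lemma lintegral_ball_halfSpaceDensity {m : ℕ} (s : ℝ) {R : ℝ} (hR : 0 < R) :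
    ∫⁻ Y in Metric.ball (0 : Rn (m + 2)) R, halfSpaceDensity s Y
      = ENNReal.ofReal (R ^ ((m : ℝ) + 1 - s)) *
        ∫⁻ Y in Metric.ball (0 : Rn (m + 2)) 1, halfSpaceDensity s Y := by
  rw [← lintegral_indicator Metric.isOpen_ball.measurableSet,
    ← lintegral_indicator Metric.isOpen_ball.measurableSet,
    lintegral_comp_smul volume hR
      ((measurable_halfSpaceDensity s).indicator Metric.isOpen_ball.measurableSet),
    finrank_euclideanSpace_fin]
  have h : ∀ Y : Rn (m + 2), (Metric.ball 0 R).indicator (halfSpaceDensity s) (R • Y)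
      = ENNReal.ofReal (R ^ (-(1 + s))) * (Metric.ball 0 1).indicator (halfSpaceDensity s) Y := by
    intro Y
    have h1 : R • Y ∈ Metric.ball (0 : Rn (m + 2)) R ↔ Y ∈ Metric.ball (0 : Rn (m + 2)) 1 := by
      rw [mem_ball_zero_iff, mem_ball_zero_iff, norm_smul, Real.norm_of_nonneg hR.le]
      exact mul_lt_iff_lt_one_right hR
    by_cases hY : Y ∈ Metric.ball (0 : Rn (m + 2)) 1
    · rw [indicator_of_mem (h1.2 hY), indicator_of_mem hY, halfSpaceDensity_smul s hR]
    · rw [indicator_of_notMem (mt h1.1 hY), indicator_of_notMem hY, mul_zero]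
  simp_rw [h]
  rw [lintegral_const_mul _
    ((measurable_halfSpaceDensity s).indicator Metric.isOpen_ball.measurableSet), ← mul_assoc,
    ← ENNReal.ofReal_mul (by positivity), ← Real.rpow_natCast, ← Real.rpow_add hR]
  congr 3
  push_cast; ring

/-- A substitute for polar coordinates: `exp(-|Y|²)` is the integral of `exp(-l)` over `l > |Y|²`,
so Tonelli yields integrals over balls of radius `√l`, and homogeneity turns the remaining
`l`-integral into a Gamma value. -/
lemma lintegral_halfSpaceDensity_mul_exp {m : ℕ} {s : ℝ} (hs1 : s < 1) :
    ∫⁻ Y : Rn (m + 2), halfSpaceDensity s Y * ENNReal.ofReal (Real.exp (-‖Y‖ ^ 2))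
      = ENNReal.ofReal (Real.Gamma (((m : ℝ) + 1 - s) / 2 + 1)) *
        ∫⁻ Y in Metric.ball (0 : Rn (m + 2)) 1, halfSpaceDensity s Y := by
  have hm : (0 : ℝ) ≤ m := Nat.cast_nonneg m
  have hset : MeasurableSet {p : Rn (m + 2) × ℝ | ‖p.1‖ ^ 2 < p.2} :=
    measurableSet_lt (by fun_prop) (by fun_prop)
  have hmeas : Measurable (Function.uncurry fun (Y : Rn (m + 2)) (l : ℝ) => halfSpaceDensity s Y *
      {p : Rn (m + 2) × ℝ | ‖p.1‖ ^ 2 < p.2}.indicator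
        (fun p => ENNReal.ofReal (Real.exp (-p.2))) (Y, l)) :=
    ((measurable_halfSpaceDensity s).comp measurable_fst).mul
      (Measurable.indicator (by fun_prop) hset)
  calc _ = ∫⁻ Y : Rn (m + 2), ∫⁻ l in Ioi (0 : ℝ), halfSpaceDensity s Y *
      {p : Rn (m + 2) × ℝ | ‖p.1‖ ^ 2 < p.2}.indicator
        (fun p => ENNReal.ofReal (Real.exp (-p.2))) (Y, l) := by
        refine lintegral_congr fun Y => ?_
        have h1 : ∀ l : ℝ, {p : Rn (m + 2) × ℝ | ‖p.1‖ ^ 2 < p.2}.indicator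
            (fun p => ENNReal.ofReal (Real.exp (-p.2))) (Y, l)
            = (Ioi (‖Y‖ ^ 2)).indicator (fun l => ENNReal.ofReal (Real.exp (-l))) l := fun l => by
          simp [indicator_apply]
        simp_rw [h1]
        rw [lintegral_const_mul _ (Measurable.indicator (by fun_prop) measurableSet_Ioi),
          lintegral_indicator measurableSet_Ioi, Measure.restrict_restrict measurableSet_Ioi,
          inter_eq_left.2 (Ioi_subset_Ioi (sq_nonneg _)),
          ← ofReal_integral_eq_lintegral_ofReal (integrableOn_exp_neg_Ioi _)
            (ae_of_all _ fun l => (Real.exp_pos _).le), integral_exp_neg_Ioi]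
    _ = ∫⁻ l in Ioi (0 : ℝ), ∫⁻ Y : Rn (m + 2), halfSpaceDensity s Y *
      {p : Rn (m + 2) × ℝ | ‖p.1‖ ^ 2 < p.2}.indicator
        (fun p => ENNReal.ofReal (Real.exp (-p.2))) (Y, l) :=
        lintegral_lintegral_swap hmeas.aemeasurable
    _ = ∫⁻ l in Ioi (0 : ℝ),
        ENNReal.ofReal (l ^ (((m : ℝ) + 1 - s) / 2 + 1 - 1) * Real.exp (-(1 * l))) *
        ∫⁻ Y in Metric.ball (0 : Rn (m + 2)) 1, halfSpaceDensity s Y := by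
        refine setLIntegral_congr_fun measurableSet_Ioi fun l hl => ?_
        have hl : 0 < l := hl
        have h1 : ∀ Y : Rn (m + 2), halfSpaceDensity s Y *
            {p : Rn (m + 2) × ℝ | ‖p.1‖ ^ 2 < p.2}.indicator
              (fun p => ENNReal.ofReal (Real.exp (-p.2))) (Y, l)
            = (Metric.ball 0 (√l)).indicator (halfSpaceDensity s) Y *
              ENNReal.ofReal (Real.exp (-l)) := fun Y => by
          have : ‖Y‖ < √l ↔ ‖Y‖ ^ 2 < l := Real.lt_sqrt (norm_nonneg Y)
          by_cases h : ‖Y‖ ^ 2 < l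
          · simp [h, this]
          · simp [h, this]
        simp_rw [h1]
        rw [lintegral_mul_const _
          ((measurable_halfSpaceDensity s).indicator Metric.isOpen_ball.measurableSet),
          lintegral_indicator Metric.isOpen_ball.measurableSet,
          lintegral_ball_halfSpaceDensity s (Real.sqrt_pos.2 hl), Real.sqrt_eq_rpow,
          ← Real.rpow_mul hl.le, ENNReal.ofReal_mul (by positivity), one_mul, add_sub_cancel_right,
          show (1 : ℝ) / 2 * (m + 1 - s) = (m + 1 - s) / 2 by ring]
        ring
    _ = _ := by
        rw [lintegral_mul_const _ (by fun_prop),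
          lintegral_rpow_mul_exp_neg_mul (by linarith) one_pos]
        simp

lemma lintegral_rpow_neg_mul_exp_neg_sq {s k : ℝ} (hs : s < 1) (hk : 0 < k) :
    ∫⁻ t in Ioi (0 : ℝ), ENNReal.ofReal (t ^ (-s) * Real.exp (-k * t ^ 2))
      = ENNReal.ofReal (k ^ (-(1 - s) / 2) * (1 / 2 * Real.Gamma ((1 - s) / 2))) := by
  have h := integral_rpow_mul_exp_neg_mul_rpow (p := 2) (q := -s) (b := k) two_pos
    (by linarith) hk
  have hi := integrableOn_rpow_mul_exp_neg_mul_rpow (p := 2) (s := -s) (b := k)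
    (by linarith) two_pos hk
  simp only [Real.rpow_two] at h hi
  rw [← ofReal_integral_eq_lintegral_ofReal hi, h]
  · congr 1
    rw [show -s + 1 = 1 - s by ring]; ring
  · filter_upwards [ae_restrict_mem measurableSet_Ioi] with t ht
    have : (0 : ℝ) < t := ht
    positivity

/-- The Gaussian weight factorizes. The tangential variables give `π^(m/2)`, and the substitution `r
= t z` in the normal variable leaves a Gamma integral in `t` for each `z`, followed by the integral
of `(1 + z²)^(-(1 + s)/2)`. -/
lemma lintegral_halfSpaceDensity_mul_exp_eq {m : ℕ} {s : ℝ} (hs : 0 < s) (hs1 : s < 1) :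
    ∫⁻ Y : Rn (m + 2), halfSpaceDensity s Y * ENNReal.ofReal (Real.exp (-‖Y‖ ^ 2))
      = ENNReal.ofReal (Real.pi ^ ((m : ℝ) / 2) * (1 / 2 * Real.Gamma ((1 - s) / 2)) *
        (Real.pi ^ (1 / 2 : ℝ) * Real.Gamma (s / 2) / Real.Gamma ((1 + s) / 2))) := by
  have hG := Real.Gamma_pos_of_pos (s := (1 - s) / 2) (by linarith)
  have hG2 := Real.Gamma_pos_of_pos (s := s / 2) (by linarith)
  have hG3 := Real.Gamma_pos_of_pos (s := (1 + s) / 2) (by linarith)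
  have hslice : ∀ t : ℝ, 0 < t → ∫⁻ x : Rn (m + 1),
      ENNReal.ofReal (t ^ (s - 1) * (t ^ 2 + vert x ^ 2) ^ (-s) * Real.exp (-(‖x‖ ^ 2 + t ^ 2)))
      = ENNReal.ofReal (Real.pi ^ ((m : ℝ) / 2)) * ∫⁻ z : ℝ, ENNReal.ofReal
        (t ^ (-s) * (1 + z ^ 2) ^ (-s) * Real.exp (-(1 + z ^ 2) * t ^ 2)) := by
    intro t ht
    have h1 := lintegral_horiz_vert (n := m) (f := fun y r => ENNReal.ofReal (t ^ (s - 1) *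
      (t ^ 2 + r ^ 2) ^ (-s) * Real.exp (-(‖y‖ ^ 2 + r ^ 2 + t ^ 2))))
      (by simp only [Function.uncurry_def]; fun_prop)
    simp only [← norm_sq_eq_horiz_vert] at h1
    rw [h1]
    have h2 : ∀ r : ℝ, ∫⁻ y : Rn m, ENNReal.ofReal (t ^ (s - 1) *
        (t ^ 2 + r ^ 2) ^ (-s) * Real.exp (-(‖y‖ ^ 2 + r ^ 2 + t ^ 2)))
        = ENNReal.ofReal (Real.pi ^ ((m : ℝ) / 2)) * ENNReal.ofReal (t ^ (s - 1) *
          (t ^ 2 + r ^ 2) ^ (-s) * Real.exp (-(r ^ 2 + t ^ 2))) := by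
      intro r
      have h3 : ∀ y : Rn m, ENNReal.ofReal (t ^ (s - 1) *
          (t ^ 2 + r ^ 2) ^ (-s) * Real.exp (-(‖y‖ ^ 2 + r ^ 2 + t ^ 2)))
          = ENNReal.ofReal (Real.exp (-1 * ‖y‖ ^ 2)) * ENNReal.ofReal (t ^ (s - 1) *
          (t ^ 2 + r ^ 2) ^ (-s) * Real.exp (-(r ^ 2 + t ^ 2))) := fun y => by
        rw [← ENNReal.ofReal_mul (Real.exp_pos _).le,
          show -(‖y‖ ^ 2 + r ^ 2 + t ^ 2) = -1 * ‖y‖ ^ 2 + -(r ^ 2 + t ^ 2) by ring, Real.exp_add]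
        congr 1; ring
      simp_rw [h3]
      rw [lintegral_mul_const _ (by fun_prop), lintegral_exp_neg_mul_norm_sq m one_pos, div_one]
    simp_rw [h2]
    rw [lintegral_const_mul _ (by fun_prop), lintegral_comp_smul volume ht (by fun_prop),
      ← lintegral_const_mul _ (by fun_prop)]
    congr 1
    refine lintegral_congr fun z => ?_
    rw [Module.finrank_self, pow_one, smul_eq_mul, ← ENNReal.ofReal_mul ht.le]
    congr 1
    rw [show t ^ 2 + (t * z) ^ 2 = t ^ (2 : ℝ) * (1 + z ^ 2) by rw [Real.rpow_two]; ring,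
      Real.mul_rpow (by positivity) (by positivity), ← Real.rpow_mul ht.le,
      show -((t * z) ^ 2 + t ^ 2) = -(1 + z ^ 2) * t ^ 2 by ring,
      show -s = 1 + (s - 1) + 2 * (-s) by ring, Real.rpow_add ht, Real.rpow_add ht, Real.rpow_one,
      show 1 + (s - 1) + 2 * (-s) = -s by ring]
    ring
  have h0 : ∀ Y : Rn (m + 2), halfSpaceDensity s Y * ENNReal.ofReal (Real.exp (-‖Y‖ ^ 2))
      = (Ioi (0 : ℝ)).indicator (fun t => ENNReal.ofReal (t ^ (s - 1) *
        (t ^ 2 + vert (horiz Y) ^ 2) ^ (-s) * Real.exp (-(‖horiz Y‖ ^ 2 + t ^ 2)))) (vert Y) := by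
    intro Y
    rw [halfSpaceDensity]
    by_cases h : 0 < vert Y
    · rw [indicator_of_mem (by exact h), indicator_of_mem (by exact h),
        ← ENNReal.ofReal_mul (by positivity), norm_sq_eq_horiz_vert]
    · rw [indicator_of_notMem (by exact h), indicator_of_notMem (by exact h), zero_mul]
  simp_rw [h0]
  have hmeas : Measurable (Function.uncurry fun (x : Rn (m + 1)) (t : ℝ) =>
      (Ioi (0 : ℝ)).indicator (fun t => ENNReal.ofReal (t ^ (s - 1) *
        (t ^ 2 + vert x ^ 2) ^ (-s) * Real.exp (-(‖x‖ ^ 2 + t ^ 2)))) t) := by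
    have : Measurable fun p : Rn (m + 1) × ℝ => ENNReal.ofReal (p.2 ^ (s - 1) *
        (p.2 ^ 2 + vert p.1 ^ 2) ^ (-s) * Real.exp (-(‖p.1‖ ^ 2 + p.2 ^ 2))) := by fun_prop
    exact this.indicator (measurable_snd measurableSet_Ioi)
  rw [lintegral_horiz_vert hmeas]
  have h1 : ∀ t : ℝ, ∫⁻ x : Rn (m + 1), (Ioi (0 : ℝ)).indicator (fun t => ENNReal.ofReal
      (t ^ (s - 1) * (t ^ 2 + vert x ^ 2) ^ (-s) * Real.exp (-(‖x‖ ^ 2 + t ^ 2)))) t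
      = (Ioi (0 : ℝ)).indicator (fun t => ENNReal.ofReal (Real.pi ^ ((m : ℝ) / 2)) *
        ∫⁻ z : ℝ, ENNReal.ofReal
        (t ^ (-s) * (1 + z ^ 2) ^ (-s) * Real.exp (-(1 + z ^ 2) * t ^ 2))) t := by
    intro t
    by_cases h : 0 < t
    · simp only [indicator_of_mem (show t ∈ Ioi (0 : ℝ) from h)]
      exact hslice t h
    · simp only [indicator_of_notMem (show t ∉ Ioi (0 : ℝ) from h), lintegral_zero]
  simp_rw [h1]
  rw [lintegral_indicator measurableSet_Ioi, lintegral_const_mul']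
  swap
  · exact ENNReal.ofReal_ne_top
  rw [lintegral_lintegral_swap (by simp only [Function.uncurry_def]; fun_prop)]
  have h2 : ∀ z : ℝ, ∫⁻ t in Ioi (0 : ℝ), ENNReal.ofReal
      (t ^ (-s) * (1 + z ^ 2) ^ (-s) * Real.exp (-(1 + z ^ 2) * t ^ 2))
      = ENNReal.ofReal (1 / 2 * Real.Gamma ((1 - s) / 2)) *
        ENNReal.ofReal ((1 + z ^ 2) ^ (-((1 + s) / 2))) := by
    intro z
    have hz : 0 < 1 + z ^ 2 := by positivity
    have h3 : ∀ t : ℝ, ENNReal.ofReal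
        (t ^ (-s) * (1 + z ^ 2) ^ (-s) * Real.exp (-(1 + z ^ 2) * t ^ 2))
        = ENNReal.ofReal ((1 + z ^ 2) ^ (-s)) *
          ENNReal.ofReal (t ^ (-s) * Real.exp (-(1 + z ^ 2) * t ^ 2)) := fun t => by
      rw [← ENNReal.ofReal_mul (by positivity)]
      congr 1; ring
    simp_rw [h3]
    rw [lintegral_const_mul _ (by fun_prop), lintegral_rpow_neg_mul_exp_neg_sq hs1 hz,
      ← ENNReal.ofReal_mul (by positivity), ← ENNReal.ofReal_mul (by positivity),
      show -((1 + s) / 2) = -s + -(1 - s) / 2 by ring, Real.rpow_add hz]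
    congr 1; ring
  simp_rw [h2]
  rw [lintegral_const_mul _ (by fun_prop), lintegral_one_add_sq (by linarith), ← mul_assoc,
    ← ENNReal.ofReal_mul (by positivity), ← ENNReal.ofReal_mul (by positivity),
    show (1 + s) / 2 - 1 / 2 = s / 2 by ring]

lemma halfSpaceValue_pos (n : ℕ) (hn : 1 ≤ n) {s : ℝ} (hs : 0 < s) (hs1 : s < 1) :
    0 < halfSpaceValue n s := by
  have hn' : (1 : ℝ) ≤ n := by exact_mod_cast hn
  have h1 := Real.Gamma_pos_of_pos (s := (s + 1) / 2) (by linarith)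
  have h2 := Real.Gamma_pos_of_pos (s := (1 - s) / 2) (by linarith)
  have h3 := Real.Gamma_pos_of_pos (s := s / 2) (by linarith)
  have h4 := Real.Gamma_pos_of_pos (s := ((n : ℝ) - s) / 2 + 1) (by linarith)
  unfold halfSpaceValue
  positivity

/-- Equating the two Gaussian-weighted evaluations of `halfSpaceDensity` isolates its integral over
the unit ball; the gradient formula supplies the factor `4 * lineConst s ^ 2`. -/
lemma Phi_upperHalf (n : ℕ) (hn : 1 ≤ n) {s : ℝ} (hs : 0 < s) (hs1 : s < 1) :
    Phi s (upperHalf n) 0 1 = ENNReal.ofReal (halfSpaceValue n s) := by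
  obtain ⟨m, rfl⟩ : ∃ m, n = m + 1 := ⟨n - 1, by omega⟩
  have hm : (0 : ℝ) ≤ m := Nat.cast_nonneg m
  have h1 := Real.Gamma_pos_of_pos (s := (1 + s) / 2) (by linarith)
  have h2 := Real.Gamma_pos_of_pos (s := (1 - s) / 2) (by linarith)
  have h3 := Real.Gamma_pos_of_pos (s := s / 2) (by linarith)
  have h4 := Real.Gamma_pos_of_pos (s := ((m : ℝ) + 1 - s) / 2 + 1) (by linarith)
  have hI := (lintegral_halfSpaceDensity_mul_exp (m := m) hs1).symm.trans
    (lintegral_halfSpaceDensity_mul_exp_eq hs hs1)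
  have hI' : ∫⁻ Y in Metric.ball (0 : Rn (m + 2)) 1, halfSpaceDensity s Y
      = ENNReal.ofReal (Real.pi ^ ((m : ℝ) / 2) * (1 / 2 * Real.Gamma ((1 - s) / 2)) *
        (Real.pi ^ (1 / 2 : ℝ) * Real.Gamma (s / 2) / Real.Gamma ((1 + s) / 2)) /
          Real.Gamma (((m : ℝ) + 1 - s) / 2 + 1)) := by
    rw [ENNReal.ofReal_div_of_pos h4, ← hI, mul_comm,
      ENNReal.mul_div_cancel_right (by simpa using h4) ENNReal.ofReal_ne_top]
  rw [Phi, Real.one_rpow, ENNReal.ofReal_one, div_one, mkPoint_zero_zero, halfBall, inter_comm,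
    ← Measure.restrict_restrict (measurableSet_vert_pos _),
    ← lintegral_indicator (measurableSet_vert_pos _)]
  have h5 : ∀ Y : Rn (m + 2), {Y | 0 < vert Y}.indicator (fun Y => ENNReal.ofReal
      (vert Y ^ (1 - s) * ‖gradient (extension s (upperHalf (m + 1))) Y‖ ^ 2)) Y
      = ENNReal.ofReal (4 * lineConst s ^ 2) * halfSpaceDensity s Y := by
    intro Y
    rw [halfSpaceDensity]
    by_cases h : 0 < vert Y
    · rw [indicator_of_mem (by exact h), indicator_of_mem (by exact h),
        ← ENNReal.ofReal_mul (by positivity), norm_gradient_extension_upperHalf hs h]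
      congr 1
      rw [show 1 + (vert (horiz Y) / vert Y) ^ 2
          = vert Y ^ (-2 : ℝ) * (vert Y ^ 2 + vert (horiz Y) ^ 2) by
          rw [Real.rpow_neg h.le, Real.rpow_two]; field_simp,
        Real.mul_rpow (by positivity) (by positivity), ← Real.rpow_mul h.le,
        show s - 1 = (1 - s) + (-2) * (-s) - 2 by ring, Real.rpow_sub h (1 - s + -2 * -s),
        Real.rpow_add h (1 - s), Real.rpow_two]
      ring
    · rw [indicator_of_notMem (by exact h), indicator_of_notMem (by exact h), mul_zero]
  rw [lintegral_congr h5, lintegral_const_mul _ (measurable_halfSpaceDensity s), hI',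
    ← ENNReal.ofReal_mul (by positivity)]
  congr 1
  have hp : Real.pi ^ (((m + 1 : ℕ) : ℝ) / 2 - 1)
      = Real.pi ^ ((m : ℝ) / 2) / Real.pi ^ (1 / 2 : ℝ) := by
    rw [← Real.rpow_sub Real.pi_pos]; congr 1; push_cast; ring
  have hp1 := Real.rpow_pos_of_pos Real.pi_pos (1 / 2 : ℝ)
  have h6 : (((m + 1 : ℕ) : ℝ) - s) / 2 + 1 = ((m : ℝ) + 1 - s) / 2 + 1 := by push_cast; ring
  rw [halfSpaceValue, lineConst, hp, h6, add_comm s 1]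
  field_simp
  ring

/-- The half-space value is bounded below by a multiple of `s / (1 - s)`. -/
lemma exists_le_halfSpaceValue (n : ℕ) (hn : 1 ≤ n) :
    ∃ C : ℝ, 0 < C ∧ ∀ s : ℝ, 0 < s → s < 1 → C * s / (1 - s) ≤ halfSpaceValue n s := by
  have hn' : (1 : ℝ) ≤ n := by exact_mod_cast hn
  -- This is `halfSpaceValue n s * (1 - s) / s` with the factors `s / 2` and `(1 - s) / 2` absorbed
  -- by the functional equation of Gamma. No Gamma argument reaches zero on `[0, 1]`, so the minimum
  -- of `f` there is positive and serves as the constant.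
  set f : ℝ → ℝ := fun s => 2 * Real.pi ^ ((n : ℝ) / 2 - 1) * Real.Gamma ((s + 1) / 2) *
    Real.Gamma ((1 - s) / 2 + 1) / (Real.Gamma (s / 2 + 1) * Real.Gamma (((n : ℝ) - s) / 2 + 1))
    with hf
  have hpos : ∀ s ∈ Icc (0 : ℝ) 1, 0 < f s := by
    intro s hs
    have h1 := Real.Gamma_pos_of_pos (s := (s + 1) / 2) (by linarith [hs.1])
    have h2 := Real.Gamma_pos_of_pos (s := (1 - s) / 2 + 1) (by linarith [hs.2])
    have h3 := Real.Gamma_pos_of_pos (s := s / 2 + 1) (by linarith [hs.1])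
    have h4 := Real.Gamma_pos_of_pos (s := ((n : ℝ) - s) / 2 + 1) (by linarith [hs.2])
    simp only [hf]; positivity
  have hΓ : ∀ (g : ℝ → ℝ), Continuous g → (∀ s ∈ Icc (0 : ℝ) 1, 0 < g s) →
      ContinuousOn (fun s => Real.Gamma (g s)) (Icc 0 1) := by
    intro g hg hg0 s hs
    have : ContinuousAt Real.Gamma (g s) :=
      (Real.differentiableAt_Gamma fun k hk => by
        have := hg0 s hs
        have h0 : (0 : ℝ) ≤ k := Nat.cast_nonneg k
        linarith).continuousAt
    exact (ContinuousAt.comp (g := Real.Gamma) this hg.continuousAt).continuousWithinAt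
  have hcont : ContinuousOn f (Icc 0 1) := by
    refine ContinuousOn.div ((continuousOn_const.mul (hΓ _ (by fun_prop) ?_)).mul
      (hΓ _ (by fun_prop) ?_)) ((hΓ _ (by fun_prop) ?_).mul (hΓ _ (by fun_prop) ?_)) ?_
    · intro s hs; linarith [hs.1]
    · intro s hs; linarith [hs.2]
    · intro s hs; linarith [hs.1]
    · intro s hs; linarith [hs.2]
    · intro s hs
      have h3 := Real.Gamma_pos_of_pos (s := s / 2 + 1) (by linarith [hs.1])
      have h4 := Real.Gamma_pos_of_pos (s := ((n : ℝ) - s) / 2 + 1) (by linarith [hs.2])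
      positivity
  obtain ⟨s₀, hs₀, hmin⟩ := isCompact_Icc.exists_isMinOn ⟨0, by simp⟩ hcont
  refine ⟨f s₀, hpos s₀ hs₀, fun s hs hs1 => ?_⟩
  have h1 : f s₀ ≤ f s := hmin ⟨hs.le, hs1.le⟩
  have h2 : halfSpaceValue n s = f s * s / (1 - s) := by
    have h3 := Real.Gamma_pos_of_pos (s := s / 2) (by linarith)
    have h4 := Real.Gamma_pos_of_pos (s := ((n : ℝ) - s) / 2 + 1) (by linarith)
    have h5 : 1 - s ≠ 0 := by linarith
    simp only [hf, halfSpaceValue]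
    rw [Real.Gamma_add_one (by linarith : s / 2 ≠ 0), Real.Gamma_add_one
      (div_ne_zero h5 two_ne_zero)]
    field_simp
  rw [h2]
  have : 0 < 1 - s := by linarith
  gcongr

/-! ### Differentiating the Poisson integral -/

/-- The derivative of the Poisson kernel in its first variable. -/
def kernelDeriv {n : ℕ} (s : ℝ) (X : Rn (n + 1)) (y : Rn n) : Rn (n + 1) →L[ℝ] ℝ :=
  (poissonConst n s * vert X ^ s) • ((-((n + s) / 2) *
      (‖X - mkPoint y 0‖ ^ 2) ^ (-((n + s) / 2) - 1)) • (2 • innerSL ℝ (X - mkPoint y 0))) +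
    ((‖X - mkPoint y 0‖ ^ 2) ^ (-((n + s) / 2))) •
      (poissonConst n s • ((s * vert X ^ (s - 1)) • vertL n))

lemma norm_sub_mkPoint_pos {n : ℕ} {X : Rn (n + 1)} (hX : 0 < vert X) (y : Rn n) :
    0 < ‖X - mkPoint y 0‖ := by
  have := norm_sq_sub_mkPoint X y
  by_contra h
  have h0 : ‖X - mkPoint y 0‖ = 0 := le_antisymm (not_lt.1 h) (norm_nonneg _)
  rw [h0] at this
  nlinarith [sq_nonneg ‖horiz X - y‖, mul_pos hX hX]

lemma vert_le_norm_sub_mkPoint {n : ℕ} (X : Rn (n + 1)) (y : Rn n) :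
    vert X ≤ ‖X - mkPoint y 0‖ := by
  have := abs_vert_le (X - mkPoint y 0)
  rw [vert_sub, vert_mkPoint, sub_zero] at this
  exact (le_abs_self _).trans this

lemma hasFDerivAt_poissonKernel {n : ℕ} (s : ℝ) {X : Rn (n + 1)} (hX : 0 < vert X) (y : Rn n) :
    HasFDerivAt (fun X => poissonKernel s X y) (kernelDeriv s X y) X := by
  have h1 : HasFDerivAt (fun X : Rn (n + 1) => ‖X - mkPoint y 0‖ ^ 2)
      (2 • innerSL ℝ (X - mkPoint y 0)) X := by
    have := ((hasFDerivAt_id X).sub_const (mkPoint y 0)).norm_sq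
    simpa using this
  have h2 := h1.rpow_const (p := -((n + s) / 2))
    (Or.inl (pow_pos (norm_sub_mkPoint_pos hX y) 2).ne')
  have h3 : HasFDerivAt (fun X : Rn (n + 1) => vert X) (vertL n) X := (vertL n).hasFDerivAt
  have h4 := (h3.rpow_const (p := s) (Or.inl hX.ne')).const_mul (poissonConst n s)
  have h5 := h4.mul h2
  have h6 : (fun X => poissonKernel s X y) = (fun X : Rn (n + 1) => poissonConst n s * vert X ^ s *
      (‖X - mkPoint y 0‖ ^ 2) ^ (-((n + s) / 2))) := by
    funext X
    rw [poissonKernel_eq, norm_sq_sub_mkPoint]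
  rw [h6]
  exact h5

lemma norm_vertL_le (n : ℕ) : ‖vertL n‖ ≤ 1 :=
  ContinuousLinearMap.opNorm_le_bound _ zero_le_one fun X => by
    simpa using abs_vert_le X

/-- The constant in the gradient bound for the Poisson kernel. -/
def kernelDerivConst (n : ℕ) (s : ℝ) : ℝ := poissonConst n s * (n + 2 * s)

lemma kernelDerivConst_nonneg (n : ℕ) {s : ℝ} (hs : 0 < s) : 0 ≤ kernelDerivConst n s :=
  mul_nonneg (poissonConst_pos n hs).le (by positivity)

/-- Differentiation costs at most a factor `1 / vert X`: the derivative of the height power does so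
exactly, and that of the distance power costs `1 / q`, where `q ≥ vert X` is the distance to `(y,
0)`. -/
lemma norm_kernelDeriv_le {n : ℕ} {s : ℝ} (hs : 0 < s) {X : Rn (n + 1)} (hX : 0 < vert X)
    (y : Rn n) :
    ‖kernelDeriv s X y‖ ≤ kernelDerivConst n s * vert X ^ (s - 1) *
      (‖X - mkPoint y 0‖ ^ 2) ^ (-((n + s) / 2)) := by
  have hc := poissonConst_pos n hs
  set q := ‖X - mkPoint y 0‖ with hq
  have hq0 : 0 < q := norm_sub_mkPoint_pos hX y
  have htq : vert X ≤ q := vert_le_norm_sub_mkPoint X y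
  have hn : (0 : ℝ) ≤ n := Nat.cast_nonneg n
  set b : ℝ := (n + s) / 2 with hb
  have hb0 : 0 < b := by positivity
  have e1 : ‖(poissonConst n s * vert X ^ s) • ((-b * (q ^ 2) ^ (-b - 1)) •
      (2 • innerSL ℝ (X - mkPoint y 0)))‖
      = poissonConst n s * vert X ^ s * (b * (q ^ 2) ^ (-b - 1) * (2 * q)) := by
    rw [norm_smul, norm_smul, ← Nat.cast_smul_eq_nsmul ℝ, norm_smul, innerSL_apply_norm, ← hq,
      Real.norm_of_nonneg (by positivity), norm_mul, norm_neg, Real.norm_of_nonneg hb0.le,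
      Real.norm_of_nonneg (by positivity)]
    simp
  have e2 : ‖((q ^ 2) ^ (-b)) • (poissonConst n s • ((s * vert X ^ (s - 1)) • vertL n))‖
      ≤ (q ^ 2) ^ (-b) * (poissonConst n s * (s * vert X ^ (s - 1) * 1)) := by
    rw [norm_smul, norm_smul, norm_smul, Real.norm_of_nonneg (by positivity),
      Real.norm_of_nonneg hc.le, Real.norm_of_nonneg (by positivity)]
    gcongr
    exact norm_vertL_le n
  have e3 : vert X ^ s * (q ^ 2) ^ (-b - 1) * q ≤ vert X ^ (s - 1) * (q ^ 2) ^ (-b) := by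
    rw [show vert X ^ s = vert X ^ (s - 1) * vert X by
      rw [← Real.rpow_add_one hX.ne']; congr 1; ring,
      show (q ^ 2) ^ (-b) = (q ^ 2) ^ (-b - 1) * q ^ 2 by
        rw [← Real.rpow_add_one (by positivity)]; congr 1; ring]
    have : vert X * q ≤ q ^ 2 := by nlinarith
    calc _ = vert X ^ (s - 1) * (q ^ 2) ^ (-b - 1) * (vert X * q) := by ring
      _ ≤ vert X ^ (s - 1) * (q ^ 2) ^ (-b - 1) * q ^ 2 := by gcongr
      _ = _ := by ring
  calc ‖kernelDeriv s X y‖ ≤ _ := norm_add_le _ _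
    _ ≤ poissonConst n s * vert X ^ s * (b * (q ^ 2) ^ (-b - 1) * (2 * q)) +
        (q ^ 2) ^ (-b) * (poissonConst n s * (s * vert X ^ (s - 1) * 1)) := add_le_add e1.le e2
    _ = poissonConst n s * (2 * b) * (vert X ^ s * (q ^ 2) ^ (-b - 1) * q) +
        poissonConst n s * s * (vert X ^ (s - 1) * (q ^ 2) ^ (-b)) := by ring
    _ ≤ poissonConst n s * (2 * b) * (vert X ^ (s - 1) * (q ^ 2) ^ (-b)) +
        poissonConst n s * s * (vert X ^ (s - 1) * (q ^ 2) ^ (-b)) := by gcongr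
    _ = _ := by rw [kernelDerivConst, hb]; ring

lemma continuous_mkPoint_zero {n : ℕ} : Continuous fun y : Rn n => mkPoint y 0 := by
  have h : ∀ y z : Rn n, dist (mkPoint y 0) (mkPoint z 0) = dist y z := by
    intro y z
    rw [dist_eq_norm, dist_eq_norm, ← sq_eq_sq₀ (norm_nonneg _) (norm_nonneg _),
      norm_sq_sub_mkPoint]
    simp
  exact (Isometry.of_dist_eq h).continuous

lemma continuous_kernelDeriv {n : ℕ} (s : ℝ) {X : Rn (n + 1)} (hX : 0 < vert X) :
    Continuous (kernelDeriv s X) := by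
  have h1 : Continuous fun y : Rn n => X - mkPoint y 0 :=
    continuous_const.sub continuous_mkPoint_zero
  have h2 : ∀ p : ℝ, Continuous fun y : Rn n => (‖X - mkPoint y 0‖ ^ 2) ^ p := fun p =>
    Continuous.rpow_const (h1.norm.pow 2) fun y =>
      Or.inl (pow_pos (norm_sub_mkPoint_pos hX y) 2).ne'
  have h3 : Continuous fun y : Rn n => innerSL ℝ (X - mkPoint y 0) := (innerSL ℝ).continuous.comp h1
  have h4 := h2 (-((n + s) / 2) - 1)
  have h5 := h2 (-((n + s) / 2))
  unfold kernelDeriv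
  exact (((h4.const_mul _).smul (h3.const_smul (2 : ℕ))).const_smul
    (poissonConst n s * vert X ^ s)).add (h5.smul continuous_const)

lemma integrable_kernelDeriv_bound {n : ℕ} {s : ℝ} (hs : 0 < s) {X : Rn (n + 1)}
    (hX : 0 < vert X) :
    Integrable fun y : Rn n => (‖X - mkPoint y 0‖ ^ 2) ^ (-((n + s) / 2)) := by
  simp_rw [norm_sq_sub_mkPoint]
  exact integrable_kernel_rpow hs hX

lemma integrable_kernelDeriv {n : ℕ} {s : ℝ} (hs : 0 < s) {X : Rn (n + 1)} (hX : 0 < vert X) :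
    Integrable (kernelDeriv s X) :=
  ((integrable_kernelDeriv_bound hs hX).const_mul (kernelDerivConst n s * vert X ^ (s - 1))).mono'
    (continuous_kernelDeriv s hX).aestronglyMeasurable
    (ae_of_all _ fun y => norm_kernelDeriv_le hs hX y)

/-- The Poisson integral of `d`. -/
def poissonIntegral {n : ℕ} (s : ℝ) (d : Rn n → ℝ) (X : Rn (n + 1)) : ℝ :=
  ∫ y, poissonKernel s X y * d y

lemma integrable_poissonKernel_mul {n : ℕ} {s : ℝ} (hs : 0 < s) {X : Rn (n + 1)} (hX : 0 < vert X)
    {d : Rn n → ℝ} (hd : Measurable d) {B : ℝ} (hB : ∀ y, |d y| ≤ B) :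
    Integrable fun y => poissonKernel s X y * d y :=
  (integrable_poissonKernel hs hX).mul_bdd hd.aestronglyMeasurable (ae_of_all _ hB)

lemma hasFDerivAt_poissonIntegral {n : ℕ} {s : ℝ} (hs : 0 < s) (hs1 : s < 1) {X : Rn (n + 1)}
    (hX : 0 < vert X) {d : Rn n → ℝ} (hd : Measurable d) {B : ℝ} (hB : ∀ y, |d y| ≤ B) :
    HasFDerivAt (poissonIntegral s d) (∫ y, d y • kernelDeriv s X y) X := by
  have hB0 : 0 ≤ B := (abs_nonneg _).trans (hB 0)
  have hK := kernelDerivConst_nonneg n hs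
  have hnear : ∀ Z ∈ Metric.ball X (vert X / 2), vert X / 2 < vert Z := by
    intro Z hZ
    have h1 := abs_vert_le (Z - X)
    rw [vert_sub, ← dist_eq_norm] at h1
    have h2 := (abs_le.1 (h1.trans (Metric.mem_ball.1 hZ).le)).1
    have h3 := (abs_lt.1 (h1.trans_lt (Metric.mem_ball.1 hZ))).1
    linarith
  -- In the ball of radius `vert X / 2` the height stays above `vert X / 2` and the distance to `(y,
  -- 0)` drops by at most half. The latter gives the factor `4 ^ ((n + s) / 2)`.
  refine hasFDerivAt_integral_of_dominated_of_fderiv_le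
    (F := fun Z y => poissonKernel s Z y * d y) (F' := fun Z y => d y • kernelDeriv s Z y)
    (bound := fun y => B * (kernelDerivConst n s * (vert X / 2) ^ (s - 1) *
      (4 ^ ((n + s) / 2) * (‖X - mkPoint y 0‖ ^ 2) ^ (-((n + s) / 2)))))
    (Metric.ball_mem_nhds X (half_pos hX)) ?_ (integrable_poissonKernel_mul hs hX hd hB) ?_ ?_ ?_ ?_
  · filter_upwards [Metric.ball_mem_nhds X (half_pos hX)] with Z hZ
    exact (integrable_poissonKernel_mul hs ((half_pos hX).trans (hnear Z hZ)) hd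
      hB).aestronglyMeasurable
  · exact hd.aestronglyMeasurable.smul (continuous_kernelDeriv s hX).aestronglyMeasurable
  · refine ae_of_all _ fun y Z hZ => ?_
    have hZ0 := (half_pos hX).trans (hnear Z hZ)
    have h1 := norm_kernelDeriv_le hs hZ0 y
    have h2 : vert Z ^ (s - 1) ≤ (vert X / 2) ^ (s - 1) :=
      Real.rpow_le_rpow_of_nonpos (half_pos hX) (hnear Z hZ).le (by linarith)
    have h3 : ‖X - mkPoint y 0‖ / 2 ≤ ‖Z - mkPoint y 0‖ := by
      have h4 : ‖X - mkPoint y 0‖ ≤ ‖Z - mkPoint y 0‖ + dist Z X := by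
        have := norm_sub_le_norm_sub_add_norm_sub X Z (mkPoint y 0)
        rw [dist_comm, dist_eq_norm]
        linarith
      have := Metric.mem_ball.1 hZ
      have := vert_le_norm_sub_mkPoint X y
      linarith
    have hq := norm_sub_mkPoint_pos hX y
    have h5 : (‖Z - mkPoint y 0‖ ^ 2) ^ (-((n + s) / 2))
        ≤ 4 ^ ((n + s) / 2) * (‖X - mkPoint y 0‖ ^ 2) ^ (-((n + s) / 2)) := by
      calc _ ≤ ((‖X - mkPoint y 0‖ / 2) ^ 2) ^ (-((n + s) / 2)) :=
            Real.rpow_le_rpow_of_nonpos (by positivity) (by gcongr) (by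
              have : (0 : ℝ) ≤ n := Nat.cast_nonneg n
              linarith)
        _ = _ := by
            rw [div_pow, Real.div_rpow (by positivity) (by positivity), Real.rpow_neg
              (by positivity : (0 : ℝ) ≤ 2 ^ 2)]
            norm_num
            ring
    rw [norm_smul]
    refine mul_le_mul (hB y) (h1.trans ?_) (norm_nonneg _) hB0
    gcongr
  · exact ((((integrable_kernelDeriv_bound hs hX).const_mul _).const_mul _).const_mul _)
  · refine ae_of_all _ fun y Z hZ => ?_
    exact (hasFDerivAt_poissonKernel s ((half_pos hX).trans (hnear Z hZ)) y).mul_const (d y)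

/-- The powers of the height cancel after scaling. Only the independence of `X` matters later, not
the value of the mass. -/
lemma integral_poissonKernel_const {n : ℕ} {s : ℝ} (hs : 0 < s) : ∃ K : ℝ, ∀ X : Rn (n + 1),
    0 < vert X → ∫ y, poissonKernel s X y = K := by
  refine ⟨poissonConst n s * (Real.pi ^ ((n : ℝ) / 2) * Real.Gamma ((n + s) / 2 - n / 2) /
    Real.Gamma ((n + s) / 2)), fun X hX => ?_⟩
  simp_rw [poissonKernel_eq]
  rw [integral_const_mul, integral_sub_left_eq_self (fun y : Rn n =>
    (‖y‖ ^ 2 + vert X ^ 2) ^ (-((n + s) / 2))) volume (horiz X),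
    integral_norm_sq_add_sq n hX (by linarith), ← mul_assoc, mul_assoc (poissonConst n s),
    ← Real.rpow_add hX, show s + (n - 2 * ((n + s) / 2)) = 0 by ring, Real.rpow_zero, mul_one]

/-- Constant mass has zero derivative. This is the cancellation that allows a constant to be
subtracted from `d` inside the gradient. -/
lemma integral_kernelDeriv {n : ℕ} {s : ℝ} (hs : 0 < s) (hs1 : s < 1) {X : Rn (n + 1)}
    (hX : 0 < vert X) : ∫ y, kernelDeriv s X y = 0 := by
  obtain ⟨K, hK⟩ := integral_poissonKernel_const (n := n) hs
  have h1 := hasFDerivAt_poissonIntegral hs hs1 hX (d := fun _ => 1) measurable_const (B := 1)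
    (by simp)
  have h2 : poissonIntegral s (fun _ : Rn n => 1) =ᶠ[𝓝 X] fun _ => K := by
    filter_upwards [continuous_vert.continuousAt.eventually (lt_mem_nhds hX)] with Y hY
    simp only [poissonIntegral, mul_one]
    exact hK Y hY
  have h3 := h1.unique ((hasFDerivAt_const K X).congr_of_eventuallyEq h2)
  simpa using h3

/-! ### The energy bound -/

lemma lintegral_mul_sq_le {α : Type*} [MeasurableSpace α] {μ : Measure α} {f g : α → ℝ≥0∞}
    (hf : AEMeasurable f μ) (hg : AEMeasurable g μ) :
    (∫⁻ x, f x * g x ∂μ) ^ 2 ≤ (∫⁻ x, f x ^ 2 ∂μ) * ∫⁻ x, g x ^ 2 ∂μ := by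
  have h := ENNReal.lintegral_mul_le_Lp_mul_Lq μ Real.HolderConjugate.two_two hf hg
  simp only [Pi.mul_apply, ENNReal.rpow_two] at h
  calc _ ≤ ((∫⁻ x, f x ^ 2 ∂μ) ^ (1 / 2 : ℝ) * (∫⁻ x, g x ^ 2 ∂μ) ^ (1 / 2 : ℝ)) ^ 2 := by gcongr
    _ = _ := by
      rw [mul_pow, ← ENNReal.rpow_two, ← ENNReal.rpow_two, ← ENNReal.rpow_mul, ← ENNReal.rpow_mul]
      norm_num

/-- The value `d (horiz X)` can be subtracted under the integral because the kernel derivative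
integrates to zero; the pointwise kernel bound then applies. -/
lemma enorm_fderiv_poissonIntegral_le {n : ℕ} {s : ℝ} (hs : 0 < s) (hs1 : s < 1) {X : Rn (n + 1)}
    (hX : 0 < vert X) {d : Rn n → ℝ} (hd : Measurable d) {B : ℝ} (hB : ∀ y, |d y| ≤ B) :
    ‖fderiv ℝ (poissonIntegral s d) X‖ₑ
      ≤ ENNReal.ofReal (kernelDerivConst n s * vert X ^ (s - 1)) *
        ∫⁻ w : Rn n, ENNReal.ofReal ((‖w‖ ^ 2 + vert X ^ 2) ^ (-((n + s) / 2))) *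
          ‖d (horiz X + w) - d (horiz X)‖ₑ := by
  have hK := kernelDerivConst_nonneg n hs
  have hi := integrable_kernelDeriv (n := n) hs hX
  have h1 : fderiv ℝ (poissonIntegral s d) X
      = ∫ y, (d y - d (horiz X)) • kernelDeriv s X y := by
    rw [(hasFDerivAt_poissonIntegral hs hs1 hX hd hB).fderiv]
    have h2 : ∀ y, (d y - d (horiz X)) • kernelDeriv s X y
        = d y • kernelDeriv s X y - d (horiz X) • kernelDeriv s X y := fun y => by
      ext v; simp [sub_mul]
    have h3 : Integrable fun y => d y • kernelDeriv s X y :=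
      hi.bdd_smul B hd.aestronglyMeasurable (ae_of_all _ hB)
    have h4 : Integrable fun y => d (horiz X) • kernelDeriv s X y := hi.smul (d (horiz X))
    rw [integral_congr_ae (ae_of_all _ h2), integral_sub h3 h4, integral_smul,
      integral_kernelDeriv hs hs1 hX, smul_zero, sub_zero]
  rw [h1]
  calc _ ≤ ∫⁻ y, ‖(d y - d (horiz X)) • kernelDeriv s X y‖ₑ := enorm_integral_le_lintegral_enorm _
    _ ≤ ∫⁻ y, ENNReal.ofReal (kernelDerivConst n s * vert X ^ (s - 1)) *
        (ENNReal.ofReal ((‖y - horiz X‖ ^ 2 + vert X ^ 2) ^ (-((n + s) / 2))) *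
          ‖d y - d (horiz X)‖ₑ) := by
        refine lintegral_mono fun y => ?_
        rw [enorm_smul, mul_comm, ← mul_assoc, ← ENNReal.ofReal_mul (by positivity)]
        gcongr
        rw [← ofReal_norm]
        apply ENNReal.ofReal_le_ofReal
        have := norm_kernelDeriv_le hs hX y
        rwa [norm_sq_sub_mkPoint, norm_sub_rev (horiz X)] at this
    _ = _ := by
        rw [lintegral_const_mul' _ _ ENNReal.ofReal_ne_top]
        congr 1
        rw [← lintegral_add_left_eq_self _ (horiz X)]
        simp

/-- Cauchy–Schwarz after splitting the exponent `(n + s) / 2` into `(n + s - a) / 4` and `(n + s +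
a) / 4`. The square of the first factor is integrable since `a < s` and gives `t^(a-s)`; in the
second, dropping `t²` leaves a pure power of `‖w‖`. The heights combine to `t^(a-1)`. -/
lemma sq_enorm_fderiv_poissonIntegral_le {n : ℕ} {s a : ℝ} (hs : 0 < s) (hs1 : s < 1) (ha : 0 < a)
    (has : a < s) : ∃ C : ℝ, 0 ≤ C ∧ ∀ (d : Rn n → ℝ) (B : ℝ), Measurable d → (∀ y, |d y| ≤ B) →
      ∀ X : Rn (n + 1), 0 < vert X →
      ENNReal.ofReal (vert X ^ (1 - s)) * ‖fderiv ℝ (poissonIntegral s d) X‖ₑ ^ 2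
        ≤ ENNReal.ofReal (C * vert X ^ (a - 1)) * ∫⁻ w : Rn n,
          ENNReal.ofReal (‖w‖ ^ (-(n + s + a))) * ‖d (horiz X + w) - d (horiz X)‖ₑ ^ 2 := by
  set K := kernelDerivConst n s with hK
  have hK0 : 0 ≤ K := kernelDerivConst_nonneg n hs
  have hn : (0 : ℝ) ≤ n := Nat.cast_nonneg n
  set J : ℝ := Real.pi ^ ((n : ℝ) / 2) * Real.Gamma ((n + s - a) / 2 - n / 2) /
    Real.Gamma ((n + s - a) / 2) with hJ
  have hJ0 : 0 ≤ J := by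
    have h1 := Real.Gamma_pos_of_pos (s := (n + s - a) / 2 - n / 2) (by linarith)
    have h2 := Real.Gamma_pos_of_pos (s := (n + s - a) / 2) (by linarith)
    positivity
  refine ⟨K ^ 2 * J, by positivity, fun d B hd hB X hX => ?_⟩
  set t := vert X with ht
  set x := horiz X with hx
  have h1 := enorm_fderiv_poissonIntegral_le hs hs1 hX hd hB
  have h2 : ∫⁻ w : Rn n, ENNReal.ofReal ((‖w‖ ^ 2 + t ^ 2) ^ (-((n + s) / 2))) *
        ‖d (x + w) - d x‖ₑ
      = ∫⁻ w : Rn n, ENNReal.ofReal ((‖w‖ ^ 2 + t ^ 2) ^ (-((n + s - a) / 4))) *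
        (ENNReal.ofReal ((‖w‖ ^ 2 + t ^ 2) ^ (-((n + s + a) / 4))) * ‖d (x + w) - d x‖ₑ) := by
    refine lintegral_congr fun w => ?_
    rw [← mul_assoc, ← ENNReal.ofReal_mul (by positivity), ← Real.rpow_add (by positivity)]
    congr 4; ring
  have h3 : (∫⁻ w : Rn n, ENNReal.ofReal ((‖w‖ ^ 2 + t ^ 2) ^ (-((n + s) / 2))) *
        ‖d (x + w) - d x‖ₑ) ^ 2 ≤ ENNReal.ofReal (t ^ (a - s) * J) *
      ∫⁻ w : Rn n, ENNReal.ofReal (‖w‖ ^ (-(n + s + a))) * ‖d (x + w) - d x‖ₑ ^ 2 := by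
    rw [h2]
    refine (lintegral_mul_sq_le (by fun_prop) (by fun_prop)).trans (mul_le_mul' ?_ ?_)
    · have h4 : ∀ w : Rn n, ENNReal.ofReal ((‖w‖ ^ 2 + t ^ 2) ^ (-((n + s - a) / 4))) ^ 2
          = ENNReal.ofReal ((‖w‖ ^ 2 + t ^ 2) ^ (-((n + s - a) / 2))) := fun w => by
        rw [← ENNReal.ofReal_pow (by positivity), ← Real.rpow_mul_natCast (by positivity)]
        congr 2; push_cast; ring
      simp_rw [h4]
      rw [lintegral_norm_sq_add_sq n hX (by linarith)]
      apply le_of_eq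
      congr 3; ring
    · refine lintegral_mono fun w => ?_
      rw [mul_pow, ← ENNReal.ofReal_pow (by positivity), ← Real.rpow_mul_natCast (by positivity)]
      -- At `w = 0` the increment vanishes, so the value of the singular weight there is immaterial.
      by_cases hw : w = 0
      · simp [hw]
      · have hw0 : 0 < ‖w‖ := norm_pos_iff.2 hw
        gcongr
        calc (‖w‖ ^ 2 + t ^ 2) ^ (-((n + s + a) / 4) * (2 : ℕ))
            ≤ (‖w‖ ^ 2) ^ (-((n + s + a) / 4) * (2 : ℕ)) :=
              Real.rpow_le_rpow_of_nonpos (by positivity) (by nlinarith) (by push_cast; linarith)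
          _ = ‖w‖ ^ (-(n + s + a)) := by
              rw [← Real.rpow_natCast_mul (norm_nonneg w)]
              congr 1; push_cast; ring
  calc _ ≤ ENNReal.ofReal (t ^ (1 - s)) * (ENNReal.ofReal (K * t ^ (s - 1)) *
        ∫⁻ w : Rn n, ENNReal.ofReal ((‖w‖ ^ 2 + t ^ 2) ^ (-((n + s) / 2))) *
          ‖d (x + w) - d x‖ₑ) ^ 2 := by gcongr
    _ ≤ ENNReal.ofReal (t ^ (1 - s)) * (ENNReal.ofReal (K * t ^ (s - 1)) ^ 2 *
        (ENNReal.ofReal (t ^ (a - s) * J) *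
      ∫⁻ w : Rn n, ENNReal.ofReal (‖w‖ ^ (-(n + s + a))) * ‖d (x + w) - d x‖ₑ ^ 2)) := by
        rw [mul_pow]; gcongr
    _ = _ := by
        rw [← mul_assoc, ← mul_assoc, ← ENNReal.ofReal_pow (by positivity),
          ← ENNReal.ofReal_mul (by positivity), ← ENNReal.ofReal_mul (by positivity)]
        congr 2
        rw [show a - 1 = (1 - s) + (s - 1) + (s - 1) + (a - s) by ring, Real.rpow_add hX,
          Real.rpow_add hX, Real.rpow_add hX]
        ring

/-- The weighted energy of a Poisson integral is controlled by a fractional seminorm. -/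
lemma exists_energy_poissonIntegral_le (n : ℕ) {s a : ℝ} (hs : 0 < s) (hs1 : s < 1) (ha : 0 < a)
    (has : a < s) : ∃ C : ℝ≥0∞, C ≠ ∞ ∧ ∀ (d : Rn n → ℝ) (B : ℝ), Measurable d → (∀ y, |d y| ≤ B) →
      ∫⁻ X in halfBall (0 : Rn (n + 1)) 1,
        ENNReal.ofReal (vert X ^ (1 - s)) * ‖fderiv ℝ (poissonIntegral s d) X‖ₑ ^ 2
        ≤ C * ∫⁻ w : Rn n, ENNReal.ofReal (‖w‖ ^ (-(n + s + a))) *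
          ∫⁻ x in Metric.ball (0 : Rn n) 1, ‖d (x + w) - d x‖ₑ ^ 2 := by
  obtain ⟨C, hC, hbound⟩ := sq_enorm_fderiv_poissonIntegral_le (n := n) hs hs1 ha has
  -- Positivity of `a` makes the vertical integral converge at height zero; its value is the
  -- constant.
  have hfin : ∫⁻ t in Ioo (0 : ℝ) 1, ENNReal.ofReal (C * t ^ (a - 1)) ≠ ∞ := by
    have h1 : IntegrableOn (fun t : ℝ => C * t ^ (a - 1)) (Ioo 0 1) :=
      ((intervalIntegral.integrableOn_Ioo_rpow_iff one_pos).2 (by linarith)).const_mul C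
    exact (h1.lintegral_lt_top).ne
  refine ⟨_, hfin, fun d B hd hB => ?_⟩
  have hm : Measurable (Function.uncurry fun (x w : Rn n) =>
      ENNReal.ofReal (‖w‖ ^ (-(n + s + a))) * ‖d (x + w) - d x‖ₑ ^ 2) := by
    simp only [Function.uncurry_def]; fun_prop
  have hm1 : Measurable fun x : Rn n => ∫⁻ w,
      ENNReal.ofReal (‖w‖ ^ (-(n + s + a))) * ‖d (x + w) - d x‖ₑ ^ 2 := hm.lintegral_prod_right'
  have hm2 : Measurable (Function.uncurry fun (x : Rn n) (t : ℝ) =>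
      (Metric.ball (0 : Rn n) 1 ×ˢ Ioo (0 : ℝ) 1).indicator (fun p : Rn n × ℝ =>
        ENNReal.ofReal (C * p.2 ^ (a - 1)) * ∫⁻ w,
          ENNReal.ofReal (‖w‖ ^ (-(n + s + a))) * ‖d (p.1 + w) - d p.1‖ₑ ^ 2) (x, t)) :=
    Measurable.indicator (Measurable.mul (by fun_prop) (hm1.comp measurable_fst))
      (Metric.isOpen_ball.measurableSet.prod measurableSet_Ioo)
  have hhb : MeasurableSet (halfBall (0 : Rn (n + 1)) 1) :=
    Metric.isOpen_ball.measurableSet.inter (measurableSet_vert_pos n)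
  -- The half-ball lies in the cylinder over the unit ball with heights in `(0, 1)`, where the bound
  -- separates the variables.
  calc _ ≤ ∫⁻ X : Rn (n + 1), (Metric.ball (0 : Rn n) 1 ×ˢ Ioo (0 : ℝ) 1).indicator
        (fun p : Rn n × ℝ => ENNReal.ofReal (C * p.2 ^ (a - 1)) * ∫⁻ w,
          ENNReal.ofReal (‖w‖ ^ (-(n + s + a))) * ‖d (p.1 + w) - d p.1‖ₑ ^ 2)
          (horiz X, vert X) := by
        rw [← lintegral_indicator hhb]
        refine lintegral_mono fun X => ?_
        by_cases hX : X ∈ halfBall (0 : Rn (n + 1)) 1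
        swap
        · rw [indicator_of_notMem hX]; exact zero_le
        have h1 : ‖X‖ < 1 := mem_ball_zero_iff.1 hX.1
        have h2 : 0 < vert X := hX.2
        rw [indicator_of_mem hX, indicator_of_mem]
        · exact hbound d B hd hB X h2
        · exact ⟨mem_ball_zero_iff.2 ((norm_horiz_le X).trans_lt h1), h2,
            ((le_abs_self _).trans (abs_vert_le X)).trans_lt h1⟩
    _ = ∫⁻ t, ∫⁻ x, (Ioo (0 : ℝ) 1).indicator (fun t => ENNReal.ofReal (C * t ^ (a - 1))) t *
        (Metric.ball (0 : Rn n) 1).indicator (fun x => ∫⁻ w,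
          ENNReal.ofReal (‖w‖ ^ (-(n + s + a))) * ‖d (x + w) - d x‖ₑ ^ 2) x := by
        rw [lintegral_horiz_vert hm2]
        refine lintegral_congr fun t => lintegral_congr fun x => ?_
        by_cases h1 : x ∈ Metric.ball (0 : Rn n) 1 <;> by_cases h2 : t ∈ Ioo (0 : ℝ) 1
        · rw [indicator_of_mem h1, indicator_of_mem h2, indicator_of_mem (mk_mem_prod h1 h2)]
        · rw [indicator_of_notMem h2, indicator_of_notMem (fun h => h2 h.2), zero_mul]
        · rw [indicator_of_notMem h1, indicator_of_notMem (fun h => h1 h.1), mul_zero]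
        · rw [indicator_of_notMem h1, indicator_of_notMem (fun h => h1 h.1), mul_zero]
    _ = _ := by
        have h3 := hm1.indicator (Metric.isOpen_ball (x := (0 : Rn n)) (ε := 1)).measurableSet
        simp_rw [lintegral_const_mul _ h3]
        rw [lintegral_mul_const _ (Measurable.indicator (by fun_prop) measurableSet_Ioo),
          lintegral_indicator measurableSet_Ioo, lintegral_indicator Metric.isOpen_ball.measurableSet,
          lintegral_lintegral_swap hm.aemeasurable]
        congr 1
        refine lintegral_congr fun w => ?_
        rw [lintegral_const_mul _ (by fun_prop)]

/-! ### Invariance under similarities -/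

/-- The extension of a linear isometry of `ℝⁿ` to `ℝⁿ⁺¹` that fixes the last coordinate. -/
def extendIsometry {n : ℕ} (L : Rn n ≃ₗᵢ[ℝ] Rn n) : Rn (n + 1) ≃ₗᵢ[ℝ] Rn (n + 1) where
  toFun X := mkPoint (L (horiz X)) (vert X)
  invFun X := mkPoint (L.symm (horiz X)) (vert X)
  map_add' X Y := by
    rw [← mkPoint_horiz_vert (mkPoint (L (horiz X)) (vert X) + mkPoint (L (horiz Y)) (vert Y)),
      horiz_add, vert_add, horiz_add, vert_add, map_add]
    simp
  map_smul' c X := by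
    rw [← mkPoint_horiz_vert ((RingHom.id ℝ) c • mkPoint (L (horiz X)) (vert X)),
      horiz_smul, vert_smul, horiz_smul, vert_smul, map_smul]
    simp
  left_inv X := by simp
  right_inv X := by simp
  norm_map' X := by
    rw [← sq_eq_sq₀ (norm_nonneg _) (norm_nonneg _)]
    change ‖mkPoint (L (horiz X)) (vert X)‖ ^ 2 = ‖X‖ ^ 2
    rw [norm_sq_eq_horiz_vert, norm_sq_eq_horiz_vert X]
    simp

@[simp] lemma horiz_extendIsometry {n : ℕ} (L : Rn n ≃ₗᵢ[ℝ] Rn n) (X : Rn (n + 1)) :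
    horiz (extendIsometry L X) = L (horiz X) := horiz_mkPoint _ _

@[simp] lemma vert_extendIsometry {n : ℕ} (L : Rn n ≃ₗᵢ[ℝ] Rn n) (X : Rn (n + 1)) :
    vert (extendIsometry L X) = vert X := vert_mkPoint _ _

lemma integral_similarity {n : ℕ} (L : Rn n ≃ₗᵢ[ℝ] Rn n) (x : Rn n) {R : ℝ} (hR : 0 < R)
    (f : Rn n → ℝ) : ∫ y, f y = R ^ n * ∫ z, f (x + R • L z) := by
  have h1 : ∫ z, f (x + R • L z) = ∫ u, f (x + R • u) :=
    L.measurePreserving.integral_comp L.toHomeomorph.measurableEmbedding fun u => f (x + R • u)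
  rw [h1, Measure.integral_comp_smul volume (fun u => f (x + u)) R, finrank_euclideanSpace_fin,
    integral_add_left_eq_self, abs_of_pos (by positivity), smul_eq_mul, ← mul_assoc,
    mul_inv_cancel₀ (by positivity), one_mul]

lemma lintegral_similarity {n : ℕ} (L : Rn n ≃ₗᵢ[ℝ] Rn n) (x : Rn n) {R : ℝ} (hR : 0 < R)
    {f : Rn n → ℝ≥0∞} (hf : Measurable f) :
    ∫⁻ y, f y = ENNReal.ofReal (R ^ n) * ∫⁻ z, f (x + R • L z) := by
  have h1 : ∫⁻ z, f (x + R • L z) = ∫⁻ u, f (x + R • u) :=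
    L.measurePreserving.lintegral_comp (f := fun u => f (x + R • u)) (by fun_prop)
  rw [h1, ← lintegral_add_left_eq_self f x, lintegral_comp_smul volume hR (by fun_prop),
    finrank_euclideanSpace_fin]

/-- The kernel is homogeneous of degree `-n` and depends on the horizontal variables only through a
distance. -/
lemma poissonKernel_similarity {n : ℕ} (L : Rn n ≃ₗᵢ[ℝ] Rn n) (x : Rn n) {R : ℝ} (hR : 0 < R)
    (s : ℝ) {X : Rn (n + 1)} (hX : 0 < vert X) (z : Rn n) :
    R ^ n * poissonKernel s (mkPoint x 0 + R • extendIsometry L X) (x + R • L z)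
      = poissonKernel s X z := by
  rw [poissonKernel_eq, poissonKernel_eq, horiz_add, vert_add, horiz_smul, vert_smul]
  simp only [horiz_mkPoint, vert_mkPoint, horiz_extendIsometry, vert_extendIsometry, zero_add,
    add_sub_add_left_eq_sub]
  rw [← smul_sub, ← map_sub, norm_smul, LinearIsometryEquiv.norm_map, Real.norm_of_nonneg hR.le,
    show (R * ‖horiz X - z‖) ^ 2 + (R * vert X) ^ 2
      = R ^ (2 : ℝ) * (‖horiz X - z‖ ^ 2 + vert X ^ 2) by rw [Real.rpow_two]; ring,
    Real.mul_rpow hR.le hX.le, Real.mul_rpow (by positivity) (by positivity), ← Real.rpow_mul hR.le]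
  have h : R ^ n * (R ^ s * R ^ (2 * -((n + s) / 2))) = 1 := by
    rw [← Real.rpow_natCast, ← Real.rpow_add hR, ← Real.rpow_add hR,
      show (n : ℝ) + (s + 2 * -((n + s) / 2)) = 0 by ring, Real.rpow_zero]
  linear_combination (poissonConst n s * vert X ^ s *
    (‖horiz X - z‖ ^ 2 + vert X ^ 2) ^ (-((n + s) / 2))) * h

lemma poissonIntegral_similarity {n : ℕ} (L : Rn n ≃ₗᵢ[ℝ] Rn n) (x : Rn n) {R : ℝ} (hR : 0 < R)
    (s : ℝ) (d : Rn n → ℝ) {X : Rn (n + 1)} (hX : 0 < vert X) :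
    poissonIntegral s d (mkPoint x 0 + R • extendIsometry L X)
      = poissonIntegral s (fun z => d (x + R • L z)) X := by
  rw [poissonIntegral, integral_similarity L x hR, ← integral_const_mul, poissonIntegral]
  refine integral_congr_ae (ae_of_all _ fun z => ?_)
  simp only
  rw [← mul_assoc, poissonKernel_similarity L x hR s hX]

lemma norm_fderiv_poissonIntegral_similarity {n : ℕ} (L : Rn n ≃ₗᵢ[ℝ] Rn n) (x : Rn n) {R : ℝ}
    (hR : 0 < R) {s : ℝ} (hs : 0 < s) (hs1 : s < 1) {d : Rn n → ℝ} (hd : Measurable d) {B : ℝ}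
    (hB : ∀ y, |d y| ≤ B) {X : Rn (n + 1)} (hX : 0 < vert X) :
    ‖fderiv ℝ (poissonIntegral s fun z => d (x + R • L z)) X‖
      = R * ‖fderiv ℝ (poissonIntegral s d) (mkPoint x 0 + R • extendIsometry L X)‖ := by
  have hv : 0 < vert (mkPoint x 0 + R • extendIsometry L X) := by
    simpa [vert_add, vert_smul] using mul_pos hR hX
  have h1 := (hasFDerivAt_poissonIntegral hs hs1 hv hd hB).differentiableAt.hasFDerivAt
  have h2 : HasFDerivAt (fun Y : Rn (n + 1) => mkPoint x 0 + R • extendIsometry L Y)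
      (R • ((extendIsometry L).toContinuousLinearEquiv : Rn (n + 1) →L[ℝ] Rn (n + 1))) X :=
    (((extendIsometry L).toContinuousLinearEquiv : Rn (n + 1) →L[ℝ] Rn (n + 1)).hasFDerivAt.const_smul
      R).const_add (mkPoint x 0)
  have h3 : (poissonIntegral s fun z => d (x + R • L z)) =ᶠ[𝓝 X]
      poissonIntegral s d ∘ fun Y : Rn (n + 1) => mkPoint x 0 + R • extendIsometry L Y := by
    filter_upwards [continuous_vert.continuousAt.eventually (lt_mem_nhds hX)] with Y hY
    exact (poissonIntegral_similarity L x hR s d hY).symm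
  rw [((h1.comp X h2).congr_of_eventuallyEq h3).fderiv, ContinuousLinearMap.comp_smul, norm_smul,
    Real.norm_of_nonneg hR.le]
  congr 1
  exact ContinuousLinearMap.opNorm_comp_linearIsometryEquiv _ _

/-- The weighted energy in the unit half-ball of the Poisson integral of `d`. -/
def energy {n : ℕ} (s : ℝ) (d : Rn n → ℝ) : ℝ≥0∞ :=
  ∫⁻ X in halfBall (0 : Rn (n + 1)) 1,
    ENNReal.ofReal (vert X ^ (1 - s)) * ‖fderiv ℝ (poissonIntegral s d) X‖ₑ ^ 2

lemma measurableSet_halfBall {n : ℕ} (X : Rn (n + 1)) (R : ℝ) : MeasurableSet (halfBall X R) :=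
  Metric.isOpen_ball.measurableSet.inter (measurableSet_vert_pos n)

lemma norm_gradient {n : ℕ} (f : Rn n → ℝ) (x : Rn n) : ‖gradient f x‖ = ‖fderiv ℝ f x‖ :=
  LinearIsometryEquiv.norm_map _ _

lemma abs_signedChi_le {n : ℕ} (E : Set (Rn n)) (y : Rn n) : |signedChi E y| ≤ 1 := by
  by_cases h : y ∈ E
  · simp [signedChi_of_mem h]
  · simp [signedChi_of_notMem h]

/-- The volume factor `R^(n+1)`, the weight `R^(1-s)` and the normalization `R^(n-s)` combine to
`R²`, which the rescaling of the gradient absorbs. The isometry `L` is free, so that a normal vector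
can later be rotated to the last coordinate axis. -/
lemma Phi_eq_energy {n : ℕ} (L : Rn n ≃ₗᵢ[ℝ] Rn n) (x : Rn n) {R : ℝ} (hR : 0 < R) {s : ℝ}
    (hs : 0 < s) (hs1 : s < 1) {E : Set (Rn n)} (hE : MeasurableSet E) :
    Phi s E x R = energy s (signedChi {z | x + R • L z ∈ E}) := by
  have hd := measurable_signedChi hE
  have hB := abs_signedChi_le E
  have hm : Measurable fun Y : Rn (n + 1) =>
      ENNReal.ofReal (vert Y ^ (1 - s) * ‖gradient (extension s E) Y‖ ^ 2) := by
    simp_rw [norm_gradient]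
    have := measurable_fderiv ℝ (extension s E)
    fun_prop
  have hmem : ∀ X : Rn (n + 1), mkPoint x 0 + R • extendIsometry L X ∈ halfBall (mkPoint x 0) R ↔
      X ∈ halfBall (0 : Rn (n + 1)) 1 := by
    intro X
    simp only [halfBall, mem_inter_iff, mem_ball_iff_norm, mem_ofPred_eq, add_sub_cancel_left,
      norm_smul, LinearIsometryEquiv.norm_map, Real.norm_of_nonneg hR.le, vert_add, vert_mkPoint,
      vert_smul, vert_extendIsometry, zero_add, sub_zero]
    rw [mul_lt_iff_lt_one_right hR, mul_pos_iff_of_pos_left hR]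
  rw [Phi, ← lintegral_indicator (measurableSet_halfBall _ _),
    lintegral_similarity (extendIsometry L) (mkPoint x 0) hR
      (hm.indicator (measurableSet_halfBall _ _)), energy,
    ← lintegral_indicator (measurableSet_halfBall _ _), mul_comm, mul_div_assoc,
    ← ENNReal.ofReal_div_of_pos (by positivity), ← lintegral_mul_const' _ _ ENNReal.ofReal_ne_top]
  refine lintegral_congr fun X => ?_
  by_cases hX : X ∈ halfBall (0 : Rn (n + 1)) 1
  · have hX0 : 0 < vert X := hX.2
    rw [indicator_of_mem ((hmem X).2 hX), indicator_of_mem hX, norm_gradient]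
    have h1 := norm_fderiv_poissonIntegral_similarity L x hR hs hs1 hd hB hX0
    have h2 : (fun z => signedChi E (x + R • L z)) = signedChi {z | x + R • L z ∈ E} := rfl
    rw [h2] at h1
    have h3 : extension s E = poissonIntegral s (signedChi E) := rfl
    have h5 : vert (mkPoint x 0 + R • extendIsometry L X) = R * vert X := by
      simp [vert_add, vert_smul]
    rw [h3, h5, ← ofReal_norm, h1, ← ENNReal.ofReal_pow (by positivity),
      ← ENNReal.ofReal_mul (by positivity), ← ENNReal.ofReal_mul (by positivity)]
    congr 1
    have h4 : R ^ (1 - s) * (R ^ (n + 1) / R ^ ((n : ℝ) - s)) = R ^ 2 := by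
      rw [← Real.rpow_natCast, ← Real.rpow_natCast, ← Real.rpow_sub hR, ← Real.rpow_add hR]
      congr 1; push_cast; ring
    rw [Real.mul_rpow hR.le hX0.le, mul_pow]
    linear_combination (vert X ^ (1 - s) *
      ‖fderiv ℝ (poissonIntegral s (signedChi E)) (mkPoint x 0 + R • extendIsometry L X)‖ ^ 2) * h4
  · rw [indicator_of_notMem (mt (hmem X).1 hX), indicator_of_notMem hX, zero_mul]

/-- Allows a null-measurable set to be replaced by a measurable one. -/
lemma Phi_congr_ae {n : ℕ} {E F : Set (Rn n)} (h : E =ᵐ[volume] F) (s : ℝ) (x : Rn n) (R : ℝ) :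
    Phi s E x R = Phi s F x R := by
  have h1 : extension s E = extension s F := by
    funext X
    refine integral_congr_ae ?_
    filter_upwards [h] with y hy
    have : y ∈ E ↔ y ∈ F := iff_of_eq hy
    by_cases hF : y ∈ F
    · simp [chi, hF, this.2 hF]
    · simp [chi, hF, mt this.1 hF]
  rw [Phi, Phi, h1]

lemma Phi_zero_one_eq_energy {n : ℕ} {s : ℝ} (hs : 0 < s) (hs1 : s < 1) {E : Set (Rn n)}
    (hE : MeasurableSet E) : Phi s E 0 1 = energy s (signedChi E) := by
  rw [Phi_eq_energy (LinearIsometryEquiv.refl ℝ (Rn n)) 0 one_pos hs hs1 hE]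
  simp

/-! ### Weak gradients of characteristic functions -/

lemma divergence_smul_const {n : ℕ} {ψ : Rn n → ℝ} {z : Rn n} (hψ : DifferentiableAt ℝ ψ z)
    (w : Rn n) : divergence (fun z => ψ z • w) z = fderiv ℝ ψ z w := by
  have h : HasFDerivAt (fun z => ψ z • w) ((fderiv ℝ ψ z).smulRight w) z :=
    hψ.hasFDerivAt.smul_const w
  have hw : ∑ i, w i • EuclideanSpace.single i (1 : ℝ) = w := by
    simpa using (EuclideanSpace.basisFun (Fin n) ℝ).sum_repr w
  unfold divergence
  rw [h.fderiv]
  conv_rhs => rw [← hw, map_sum]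
  simp [mul_comm]

/-- The distributional gradient of `χ_E` is `σ μ`, tested against scalar functions. -/
structure IsWeakGradient {n : ℕ} (E : Set (Rn n)) (μ : Measure (Rn n)) (σ : Rn n → Rn n) :
    Prop where
  measurableSet : MeasurableSet E
  locallyFinite : IsLocallyFiniteMeasure μ
  measurable : Measurable σ
  norm_eq_one : ∀ᵐ y ∂μ, ‖σ y‖ = 1
  integral_fderiv : ∀ ψ : Rn n → ℝ, ContDiff ℝ 1 ψ → HasCompactSupport ψ → ∀ w : Rn n,
    ∫ z in E, fderiv ℝ ψ z w = -∫ z, ψ z * inner ℝ w (σ z) ∂μ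

lemma IsGradientMeasure.isWeakGradient {n : ℕ} {E F : Set (Rn n)} {μ : Measure (Rn n)}
    {σ : Rn n → Rn n} (h : IsGradientMeasure (chi E) μ σ) (hF : MeasurableSet F)
    (hEF : E =ᵐ[volume] F) : IsWeakGradient F μ σ := by
  obtain ⟨h1, h2, h3, h4⟩ := h
  refine ⟨hF, h1, h2, h3, fun ψ hψ hc w => ?_⟩
  have h5 := h4 (fun z => ψ z • w) ⟨hψ.smul contDiff_const, hc.smul_right, subset_univ _⟩
  rw [← integral_indicator hF]
  have h6 : ∫ z, chi E z * divergence (fun z => ψ z • w) z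
      = ∫ z, F.indicator (fun z => fderiv ℝ ψ z w) z := by
    refine integral_congr_ae ?_
    filter_upwards [hEF] with z hz
    have hz' : z ∈ E ↔ z ∈ F := iff_of_eq hz
    rw [divergence_smul_const (hψ.differentiable one_ne_zero z)]
    by_cases hzF : z ∈ F
    · simp [chi, hzF, hz'.2 hzF]
    · simp [chi, hzF, mt hz'.1 hzF]
  rw [← h6, h5]
  simp [inner_smul_left]

lemma integrable_comp_sub {n : ℕ} {ψ : Rn n → ℝ} (hψ : Continuous ψ) (hc : HasCompactSupport ψ)
    (v : Rn n) : Integrable fun z => ψ (z - v) :=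
  (hψ.integrable_of_hasCompactSupport hc).comp_sub_right v

/-- The derivative falls on the smooth `ψ`, so nothing is asked of `E`; the weak gradient later
turns this derivative into an integral against `μ`. -/
lemma hasDerivAt_setIntegral_translate {n : ℕ} (E : Set (Rn n))
    {ψ : Rn n → ℝ} (hψ : ContDiff ℝ 1 ψ) (hc : HasCompactSupport ψ) (w : Rn n) (t₀ : ℝ) :
    HasDerivAt (fun t : ℝ => ∫ z in E, ψ (z - t • w))
      (-∫ z in E, fderiv ℝ ψ (z - t₀ • w) w) t₀ := by
  have hfc : Continuous (fderiv ℝ ψ) := hψ.continuous_fderiv one_ne_zero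
  obtain ⟨M, hM⟩ := hfc.bounded_above_of_compact_support (hc.fderiv ℝ)
  obtain ⟨r, hr⟩ := hc.isCompact.isBounded.subset_closedBall (0 : Rn n)
  have hM0 : 0 ≤ M := (norm_nonneg _).trans (hM 0)
  rw [← integral_neg]
  -- For `|t - t₀| < 1` all translated supports lie in one closed ball, whose indicator times `M *
  -- ‖w‖` dominates.
  refine (hasDerivAt_integral_of_dominated_loc_of_deriv_le
    (F' := fun t z => -(fderiv ℝ ψ (z - t • w) w))
    (bound := (Metric.closedBall (0 : Rn n) (r + (|t₀| + 1) * ‖w‖)).indicator fun _ => M * ‖w‖)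
    (Metric.ball_mem_nhds t₀ one_pos) ?_ ?_ ?_ ?_ ?_ ?_).2
  · exact Eventually.of_forall fun t =>
      (integrable_comp_sub hψ.continuous hc (t • w)).aestronglyMeasurable.restrict
  · exact (integrable_comp_sub hψ.continuous hc _).restrict
  · have : Continuous fun z => -(fderiv ℝ ψ (z - t₀ • w) w) := by fun_prop
    exact this.aestronglyMeasurable
  · refine ae_of_all _ fun z t ht => ?_
    by_cases hz : z - t • w ∈ tsupport ψ
    · rw [indicator_of_mem]
      · rw [norm_neg]
        exact (ContinuousLinearMap.le_opNorm _ _).trans (by gcongr; exact hM _)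
      · have h1 : ‖z - t • w‖ ≤ r := by simpa using hr hz
        have h2 : |t| ≤ |t₀| + 1 := by
          have : |t - t₀| < 1 := ht
          have := abs_sub_abs_le_abs_sub t t₀
          linarith
        rw [mem_closedBall_zero_iff]
        calc ‖z‖ = ‖z - t • w + t • w‖ := by simp
          _ ≤ ‖z - t • w‖ + ‖t • w‖ := norm_add_le _ _
          _ ≤ r + (|t₀| + 1) * ‖w‖ := by
            rw [norm_smul, Real.norm_eq_abs]; gcongr
    · have : fderiv ℝ ψ (z - t • w) = 0 := by
        by_contra h
        exact hz (support_fderiv_subset ℝ h)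
      rw [this]
      simp only [zero_apply, neg_zero, norm_zero]
      exact indicator_nonneg (fun _ _ => by positivity) _
  · refine Integrable.restrict ?_
    rw [integrable_indicator_iff Metric.isClosed_closedBall.measurableSet]
    exact integrableOn_const (measure_closedBall_lt_top.ne)
  · refine ae_of_all _ fun z t _ => ?_
    have h1 : HasDerivAt (fun t : ℝ => z - t • w) (-w) t := by
      simpa using ((hasDerivAt_id t).smul_const w).const_sub z
    have h2 := (hψ.differentiable one_ne_zero (z - t • w)).hasFDerivAt.comp_hasDerivAt t h1
    rw [map_neg] at h2
    exact h2

/-- Translation does not change the integral over the whole space, so its derivative along `w`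
vanishes. -/
lemma integral_fderiv_eq_zero {n : ℕ} {ψ : Rn n → ℝ} (hψ : ContDiff ℝ 1 ψ)
    (hc : HasCompactSupport ψ) (w : Rn n) : ∫ z, fderiv ℝ ψ z w = 0 := by
  have h := hasDerivAt_setIntegral_translate univ hψ hc w 0
  have h2 : (fun t : ℝ => ∫ z in univ, ψ (z - t • w)) = fun _ => ∫ z, ψ z := by
    funext t
    rw [setIntegral_univ, integral_sub_right_eq_self]
  rw [h2] at h
  simpa using h.unique (hasDerivAt_const _ _)

lemma IsWeakGradient.compl {n : ℕ} {E : Set (Rn n)} {μ : Measure (Rn n)} {σ : Rn n → Rn n}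
    (h : IsWeakGradient E μ σ) : IsWeakGradient Eᶜ μ (-σ) := by
  refine ⟨h.measurableSet.compl, h.locallyFinite, h.measurable.neg, by simpa using h.norm_eq_one,
    fun ψ hψ hc w => ?_⟩
  have hi : Integrable fun z => fderiv ℝ ψ z w := by
    have h1 : Continuous fun z => fderiv ℝ ψ z w := by
      have := hψ.continuous_fderiv one_ne_zero
      fun_prop
    exact h1.integrable_of_hasCompactSupport (hc.fderiv_apply ℝ w)
  have h2 := integral_add_compl h.measurableSet hi
  rw [integral_fderiv_eq_zero hψ hc, h.integral_fderiv ψ hψ hc] at h2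
  simp only [Pi.neg_apply, inner_neg_right, mul_neg, integral_neg, neg_neg]
  linarith

/-! ### Translations of sets of finite perimeter -/

lemma IsWeakGradient.integrableOn_ball {n : ℕ} {E : Set (Rn n)} {μ : Measure (Rn n)}
    {σ : Rn n → Rn n} (h : IsWeakGradient E μ σ) {f : Rn n → ℝ} (hf : Measurable f) {c : ℝ}
    (hc : ∀ᵐ y ∂μ, |f y| ≤ c) (x : Rn n) (r : ℝ) : IntegrableOn f (Metric.ball x r) μ := by
  have := h.locallyFinite
  exact Measure.integrableOn_of_bounded measure_ball_lt_top.ne hf.aestronglyMeasurable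
    (ae_restrict_of_ae hc)

lemma IsWeakGradient.abs_inner_le {n : ℕ} {E : Set (Rn n)} {μ : Measure (Rn n)} {σ : Rn n → Rn n}
    (h : IsWeakGradient E μ σ) (w : Rn n) : ∀ᵐ y ∂μ, |inner ℝ w (σ y)| ≤ ‖w‖ := by
  filter_upwards [h.norm_eq_one] with y hy
  simpa [hy] using abs_real_inner_le_norm w (σ y)

/-- The mean value theorem along `t ↦ ∫ z in E, ψ (z - t • w)` expresses the difference as minus the
integral of a translate of `ψ` times `w · σ`. As `0 ≤ ψ ≤ 1`, only the negative part of `w · σ` on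
the enlarged ball is needed. -/
lemma IsWeakGradient.setIntegral_sub_translate_le {n : ℕ} {E : Set (Rn n)} {μ : Measure (Rn n)}
    {σ : Rn n → Rn n} (h : IsWeakGradient E μ σ) {ψ : Rn n → ℝ} (hψ : ContDiff ℝ 1 ψ)
    (hc : HasCompactSupport ψ) (h0 : ∀ z, 0 ≤ ψ z) (h1 : ∀ z, ψ z ≤ 1) {x : Rn n} {ρ : ℝ}
    (hsupp : ∀ z, ψ z ≠ 0 → z ∈ Metric.ball x ρ) (w : Rn n) :
    (∫ z in E, ψ z) - ∫ z in E, ψ (z - w)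
      ≤ ∫ y in Metric.ball x (ρ + ‖w‖), max (-inner ℝ w (σ y)) 0 ∂μ := by
  obtain ⟨c, hc01, hcd⟩ := exists_hasDerivAt_eq_slope (fun t : ℝ => ∫ z in E, ψ (z - t • w))
    (fun t => -∫ z in E, fderiv ℝ ψ (z - t • w) w) zero_lt_one
    (fun t _ => (hasDerivAt_setIntegral_translate E hψ hc w t).continuousAt.continuousWithinAt)
    (fun t _ => hasDerivAt_setIntegral_translate E hψ hc w t)
  have hψc : ContDiff ℝ 1 fun z => ψ (z - c • w) := hψ.comp (contDiff_id.sub contDiff_const)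
  have hcc : HasCompactSupport fun z => ψ (z - c • w) :=
    hc.comp_homeomorph (Homeomorph.subRight (c • w))
  have h2 := h.integral_fderiv _ hψc hcc w
  simp only [fderiv_comp_sub] at h2
  have h3 : (∫ z in E, ψ z) - ∫ z in E, ψ (z - w)
      = -∫ z, ψ (z - c • w) * inner ℝ w (σ z) ∂μ := by
    rw [← h2]
    simp only [sub_zero, div_one, zero_smul, one_smul] at hcd
    linarith
  have hm : Measurable fun y => max (-inner ℝ w (σ y)) 0 := by
    have := h.measurable
    fun_prop
  rw [h3, ← integral_neg, ← integral_indicator Metric.isOpen_ball.measurableSet]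
  have := h.locallyFinite
  have hi : Integrable (fun z => ψ (z - c • w) * inner ℝ w (σ z)) μ := by
    refine (hψc.continuous.integrable_of_hasCompactSupport hcc).mul_bdd (c := ‖w‖) ?_
      (h.abs_inner_le w)
    have := h.measurable
    exact (by fun_prop : Measurable fun z => inner ℝ w (σ z)).aestronglyMeasurable
  have hi2 : IntegrableOn (fun y => max (-inner ℝ w (σ y)) 0) (Metric.ball x (ρ + ‖w‖)) μ := by
    refine h.integrableOn_ball hm (c := ‖w‖) ?_ x _
    filter_upwards [h.abs_inner_le w] with y hy
    rw [abs_of_nonneg (le_max_right _ _)]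
    exact max_le ((neg_le_abs _).trans hy) (norm_nonneg w)
  refine integral_mono hi.neg (hi2.integrable_indicator Metric.isOpen_ball.measurableSet)
    fun z => ?_
  by_cases hz : ψ (z - c • w) = 0
  · simp only [hz, zero_mul, neg_zero]
    exact indicator_nonneg (fun y _ => le_max_right _ _) _
  · have hzb : z ∈ Metric.ball x (ρ + ‖w‖) := by
      have h4 := hsupp _ hz
      rw [mem_ball_iff_norm] at h4 ⊢
      calc ‖z - x‖ = ‖(z - c • w - x) + c • w‖ := by congr 1; abel
        _ ≤ ‖z - c • w - x‖ + ‖c • w‖ := norm_add_le _ _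
        _ < ρ + ‖w‖ := by
          have : ‖c • w‖ ≤ ‖w‖ := by
            rw [norm_smul, Real.norm_of_nonneg hc01.1.le]
            exact mul_le_of_le_one_left (norm_nonneg w) hc01.2.le
          linarith
    simp only [indicator_of_mem hzb]
    calc -(ψ (z - c • w) * inner ℝ w (σ z)) = ψ (z - c • w) * -inner ℝ w (σ z) := by ring
      _ ≤ ψ (z - c • w) * max (-inner ℝ w (σ z)) 0 :=
          mul_le_mul_of_nonneg_left (le_max_left _ _) (h0 _)
      _ ≤ max (-inner ℝ w (σ z)) 0 := mul_le_of_le_one_left (le_max_right _ _) (h1 _)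

lemma setIntegral_sub_translate_eq {n : ℕ} {E : Set (Rn n)} (hE : MeasurableSet E) {ψ : Rn n → ℝ}
    (hψ : Continuous ψ) (hc : HasCompactSupport ψ) (w : Rn n) :
    Integrable (fun z => E.indicator ψ z - {z | z + w ∈ E}.indicator ψ z) ∧
    (∫ z in E, ψ z) - ∫ z in E, ψ (z - w)
      = ∫ z, (E.indicator ψ z - {z | z + w ∈ E}.indicator ψ z) := by
  have hi := hψ.integrable_of_hasCompactSupport (μ := (volume : Measure (Rn n))) hc
  have hEw : MeasurableSet {z | z + w ∈ E} := measurable_add_const w hE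
  refine ⟨(hi.indicator hE).sub (hi.indicator hEw), ?_⟩
  have h1 : ∫ z in E, ψ (z - w) = ∫ z, {z | z + w ∈ E}.indicator ψ z := by
    rw [← integral_indicator hE, ← integral_add_right_eq_self _ w]
    refine integral_congr_ae (ae_of_all _ fun z => ?_)
    by_cases hz : z + w ∈ E
    · simp [indicator_of_mem hz, indicator_of_mem (show z ∈ {z | z + w ∈ E} from hz)]
    · simp [indicator_of_notMem hz, indicator_of_notMem (show z ∉ {z | z + w ∈ E} from hz)]
  rw [integral_sub (hi.indicator hE) (hi.indicator hEw), integral_indicator hE, h1]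

/-- The mass lost by a set under a translation is bounded by the negative part of the
corresponding directional derivative. -/
lemma IsWeakGradient.volume_translate_diff_le {n : ℕ} {E : Set (Rn n)} {μ : Measure (Rn n)}
    {σ : Rn n → Rn n} (h : IsWeakGradient E μ σ) (x w : Rn n) (ρ : ℝ) :
    volume.real {z | z ∈ Metric.ball x ρ ∧ z ∈ E ∧ z + w ∉ E}
      ≤ ∫ y in Metric.ball x (ρ + ‖w‖), max (-inner ℝ w (σ y)) 0 ∂μ := by
  set S := {z | z ∈ Metric.ball x ρ ∧ z ∈ E ∧ z + w ∉ E} with hS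
  have hE := h.measurableSet
  have hSm : MeasurableSet S :=
    Metric.isOpen_ball.measurableSet.inter (hE.inter (measurable_add_const w hE.compl))
  have hSfin : volume S ≠ ∞ :=
    ((measure_mono fun z hz => hz.1).trans_lt (measure_ball_lt_top (x := x) (r := ρ))).ne
  refine le_of_forall_pos_le_add fun ε hε => ?_
  have hε3 : ENNReal.ofReal (ε / 3) ≠ 0 := by simpa using by linarith
  obtain ⟨U₀, hSU₀, hU₀, -, hU₀S⟩ := hSm.exists_isOpen_sdiff_lt hSfin hε3
  -- The cutoff `ψ` equals one on a compact `K ⊆ S` and vanishes off an open `U ⊇ S`. The total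
  -- error consists of the volume of `S \ K`, counted twice, and that of `U \ S`, hence the thirds
  -- of `ε`.
  obtain ⟨K, hKS, hK, hSK⟩ := hSm.exists_isCompact_sdiff_lt hSfin hε3
  set U := U₀ ∩ Metric.ball x ρ with hU
  have hUo : IsOpen U := hU₀.inter Metric.isOpen_ball
  have hSU : S ⊆ U := fun z hz => ⟨hSU₀ hz, hz.1⟩
  obtain ⟨f, hf0, hf1, hf01⟩ := exists_contMDiffMap_zero_one_of_isClosed (n := 1)
    (modelWithCornersSelf ℝ (Rn n)) (s := Uᶜ) (t := K) hUo.isClosed_compl hK.isClosed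
    (disjoint_compl_left_iff_subset.2 (hKS.trans hSU))
  set ψ : Rn n → ℝ := fun z => f z with hψdef
  have hψ : ContDiff ℝ 1 ψ := f.contMDiff.contDiff
  have hsupp : ∀ z, ψ z ≠ 0 → z ∈ U := fun z hz => by
    by_contra hzU
    exact hz (hf0 hzU)
  have hc : HasCompactSupport ψ := HasCompactSupport.intro (isCompact_closedBall x ρ) fun z hz => by
    by_contra hne
    exact hz (Metric.ball_subset_closedBall (hsupp z hne).2)
  have hle := h.setIntegral_sub_translate_le hψ hc (fun z => (hf01 z).1) (fun z => (hf01 z).2)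
    (fun z hz => (hsupp z hz).2) w
  obtain ⟨hint, heq⟩ := setIntegral_sub_translate_eq hE hψ.continuous hc w
  rw [heq] at hle
  have hUfin : volume U ≠ ∞ :=
    ((measure_mono inter_subset_right).trans_lt (measure_ball_lt_top (x := x) (r := ρ))).ne
  have hKfin : volume K ≠ ∞ := hK.measure_lt_top.ne
  have hUKfin : volume (U \ K) ≠ ∞ := ((measure_mono sdiff_subset).trans_lt hUfin.lt_top).ne
  have hUKm : MeasurableSet (U \ K) := hUo.measurableSet.diff hK.measurableSet
  have hKi : Integrable (K.indicator fun _ => (1 : ℝ)) :=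
    (integrable_indicator_iff hK.measurableSet).2 (integrableOn_const hKfin)
  have hUKi : Integrable ((U \ K).indicator fun _ => (1 : ℝ)) :=
    (integrable_indicator_iff hUKm).2 (integrableOn_const hUKfin)
  -- On `K` the integrand is one, since there `z ∈ E` and `z + w ∉ E`; on `U \ K` it is at least
  -- minus one; elsewhere it vanishes.
  have hlow : volume.real K - volume.real (U \ K)
      ≤ ∫ z, (E.indicator ψ z - {z | z + w ∈ E}.indicator ψ z) := by
    have h1 : ∫ z, (K.indicator (fun _ => (1 : ℝ)) z - (U \ K).indicator (fun _ => (1 : ℝ)) z)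
        = volume.real K - volume.real (U \ K) := by
      rw [integral_sub hKi hUKi, integral_indicator hK.measurableSet, integral_indicator hUKm]
      simp
    rw [← h1]
    refine integral_mono (hKi.sub hUKi) hint fun z => ?_
    have hz01 : ψ z ∈ Icc (0 : ℝ) 1 := hf01 z
    by_cases hzK : z ∈ K
    · have h2 : z ∉ U \ K := fun h => h.2 hzK
      have h3 : z ∈ E := (hKS hzK).2.1
      have h4 : z ∉ {z | z + w ∈ E} := (hKS hzK).2.2
      simp only [indicator_of_mem hzK, indicator_of_notMem h2, indicator_of_mem h3,
        indicator_of_notMem h4]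
      rw [show ψ z = 1 from hf1 hzK]
    · have h5 : 0 ≤ E.indicator ψ z := indicator_nonneg (fun z _ => (hf01 z).1) z
      by_cases hzU : z ∈ U
      · have h2 : z ∈ U \ K := ⟨hzU, hzK⟩
        have h6 : {z | z + w ∈ E}.indicator ψ z ≤ 1 :=
          indicator_apply_le' (fun _ => hz01.2) (fun _ => zero_le_one)
        simp only [indicator_of_mem h2, indicator_of_notMem hzK]
        linarith
      · have h2 : z ∉ U \ K := fun h => hzU h.1
        have h7 : ψ z = 0 := hf0 hzU
        have h8 : ∀ A : Set (Rn n), A.indicator ψ z = 0 := fun A =>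
          indicator_apply_eq_zero.2 fun _ => h7
        simp only [indicator_of_notMem h2, indicator_of_notMem hzK, h8, le_refl]
  have h8 : volume.real (S \ K) ≤ ε / 3 :=
    ENNReal.toReal_le_of_le_ofReal (by linarith) hSK.le
  have h9 : volume.real (U \ S) ≤ ε / 3 :=
    ENNReal.toReal_le_of_le_ofReal (by linarith)
      ((measure_mono (sdiff_subset_sdiff_left inter_subset_left)).trans hU₀S.le)
  have h10 : volume.real S ≤ volume.real K + volume.real (S \ K) := by
    refine (measureReal_mono (fun z hz => ?_) ?_).trans (measureReal_union_le K (S \ K))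
    · by_cases hzK : z ∈ K
      · exact Or.inl hzK
      · exact Or.inr ⟨hz, hzK⟩
    · exact ((measure_union_le _ _).trans_lt
        (ENNReal.add_lt_top.2 ⟨hKfin.lt_top, (measure_mono sdiff_subset).trans_lt
          hSfin.lt_top⟩)).ne
  have h11 : volume.real (U \ K) ≤ volume.real (U \ S) + volume.real (S \ K) := by
    refine (measureReal_mono (fun z hz => ?_) ?_).trans (measureReal_union_le (U \ S) (S \ K))
    · by_cases hzS : z ∈ S
      · exact Or.inr ⟨hzS, hz.2⟩
      · exact Or.inl ⟨hz.1, hzS⟩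
    · exact ((measure_union_le _ _).trans_lt
        (ENNReal.add_lt_top.2 ⟨(measure_mono sdiff_subset).trans_lt hUfin.lt_top,
          (measure_mono sdiff_subset).trans_lt hSfin.lt_top⟩)).ne
  linarith

/-! ### Radial cutoff functions -/

lemma exists_abs_deriv_smoothTransition_le :
    ∃ M : ℝ, 0 < M ∧ (∀ t, |deriv Real.smoothTransition t| ≤ M) ∧
      ∀ t < 0, deriv Real.smoothTransition t = 0 := by
  have hc : Continuous (deriv Real.smoothTransition) :=
    (Real.smoothTransition.contDiff (n := 1)).continuous_deriv le_rfl
  obtain ⟨M, hM⟩ := (isCompact_Icc (a := (0 : ℝ)) (b := 1)).exists_bound_of_continuousOn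
    hc.continuousOn
  have h0 : ∀ t < 0, deriv Real.smoothTransition t = 0 := fun t ht => by
    have : Real.smoothTransition =ᶠ[𝓝 t] fun _ => 0 := by
      filter_upwards [Iio_mem_nhds ht] with r hr
      exact Real.smoothTransition.zero_of_nonpos (le_of_lt hr)
    rw [this.deriv_eq, deriv_const]
  have h1 : ∀ t > 1, deriv Real.smoothTransition t = 0 := fun t ht => by
    have : Real.smoothTransition =ᶠ[𝓝 t] fun _ => 1 := by
      filter_upwards [Ioi_mem_nhds ht] with r hr
      exact Real.smoothTransition.one_of_one_le (le_of_lt hr)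
    rw [this.deriv_eq, deriv_const]
  refine ⟨max M 1, by positivity, fun t => ?_, h0⟩
  rcases lt_or_ge t 0 with ht | ht
  · rw [h0 t ht, abs_zero]; positivity
  rcases lt_or_ge 1 t with ht1 | ht1
  · rw [h1 t ht1, abs_zero]; positivity
  exact (hM t ⟨ht, ht1⟩).trans (le_max_left _ _)

/-- Radially decreasing `C¹` cutoffs between two concentric balls. -/
lemma exists_radial_cutoff (n : ℕ) : ∃ C : ℝ, 0 < C ∧ ∀ (x : Rn n) (ρ ρ' : ℝ), 0 < ρ → ρ < ρ' →
    ∃ h : ℝ → ℝ, Continuous h ∧ AntitoneOn h (Ici 0) ∧ (∀ r, 0 ≤ h r) ∧ (∀ r, h r ≤ 1) ∧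
      (∀ r, 0 ≤ r → r ≤ ρ → h r = 1) ∧ (∀ r, ρ' ≤ r → h r = 0) ∧
      ContDiff ℝ 1 (fun z : Rn n => h ‖z - x‖) ∧
      ∀ z, ‖fderiv ℝ (fun z : Rn n => h ‖z - x‖) z‖ ≤ C / (ρ' - ρ) := by
  obtain ⟨M, hM0, hM, hneg⟩ := exists_abs_deriv_smoothTransition_le
  refine ⟨2 * M, by positivity, fun x ρ ρ' hρ hρ' => ?_⟩
  -- The profile is taken in `r²` so that it is smooth at the centre. Its gradient is at most `2 M
  -- ρ' / D`, and `D = (ρ' - ρ)(ρ' + ρ)` gives the stated bound.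
  have hD : 0 < ρ' ^ 2 - ρ ^ 2 := by nlinarith
  set D := ρ' ^ 2 - ρ ^ 2 with hDdef
  have hcd : ContDiff ℝ 1 fun z : Rn n => (ρ' ^ 2 - ‖z - x‖ ^ 2) / D :=
    (contDiff_const.sub ((contDiff_id.sub contDiff_const).norm_sq ℝ)).div_const D
  refine ⟨fun r => Real.smoothTransition ((ρ' ^ 2 - r ^ 2) / D), ?_, ?_, fun r =>
    Real.smoothTransition.nonneg _, fun r => Real.smoothTransition.le_one _, ?_, ?_, ?_, ?_⟩
  · exact Real.smoothTransition.continuous.comp (by fun_prop)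
  · intro a ha b hb hab
    have ha : 0 ≤ a := ha
    refine Real.smoothTransition.monotone ?_
    gcongr
  · intro r hr hr'
    refine Real.smoothTransition.one_of_one_le ?_
    rw [le_div_iff₀ hD]
    nlinarith
  · intro r hr
    refine Real.smoothTransition.zero_of_nonpos ?_
    exact div_nonpos_of_nonpos_of_nonneg (by nlinarith) hD.le
  · exact (Real.smoothTransition.contDiff (n := 1)).comp hcd
  · intro z
    have h1 : HasFDerivAt (fun z : Rn n => (ρ' ^ 2 - ‖z - x‖ ^ 2) / D)
        ((-(2 / D)) • innerSL ℝ (z - x)) z := by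
      have h2 := (((hasFDerivAt_id z).sub_const x).norm_sq.const_sub (ρ' ^ 2)).mul_const D⁻¹
      simp only [id_eq, ContinuousLinearMap.comp_id, ← div_eq_mul_inv] at h2
      refine h2.congr_fderiv ?_
      ext v
      simp
      ring
    have h3 : HasDerivAt Real.smoothTransition (deriv Real.smoothTransition
        ((ρ' ^ 2 - ‖z - x‖ ^ 2) / D)) ((ρ' ^ 2 - ‖z - x‖ ^ 2) / D) :=
      ((Real.smoothTransition.contDiff (n := 1)).differentiable one_ne_zero _).hasDerivAt
    have h4 := h3.comp_hasFDerivAt z h1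
    have h5 : fderiv ℝ (fun z : Rn n => Real.smoothTransition ((ρ' ^ 2 - ‖z - x‖ ^ 2) / D)) z
        = deriv Real.smoothTransition ((ρ' ^ 2 - ‖z - x‖ ^ 2) / D) •
          (-(2 / D)) • innerSL ℝ (z - x) := h4.fderiv
    rw [h5, norm_smul, norm_smul, innerSL_apply_norm, norm_neg,
      Real.norm_of_nonneg (show (0 : ℝ) ≤ 2 / D by positivity)]
    have hgap : 0 < ρ' - ρ := by linarith
    rcases lt_or_ge ρ' ‖z - x‖ with hz | hz
    · rw [hneg _ (div_neg_of_neg_of_pos (by nlinarith) hD), norm_zero, zero_mul]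
      positivity
    · calc ‖deriv Real.smoothTransition ((ρ' ^ 2 - ‖z - x‖ ^ 2) / D)‖ * (2 / D * ‖z - x‖)
          ≤ M * (2 / D * ρ') := by gcongr; exact hM _
        _ = 2 * M * (ρ' / D) := by ring
        _ ≤ 2 * M * (1 / (ρ' - ρ)) := by
            refine mul_le_mul_of_nonneg_left ?_ (by positivity)
            rw [div_le_div_iff₀ hD hgap, hDdef]
            nlinarith
        _ = _ := by ring

lemma exists_superlevel_eq_ball {n : ℕ} (x : Rn n) {ρ' : ℝ} (hρ' : 0 < ρ') {h : ℝ → ℝ}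
    (hc : Continuous h) (ha : AntitoneOn h (Ici 0)) (h0 : h ρ' = 0) {t : ℝ} (ht : 0 ≤ t) :
    ∃ r ≤ ρ', {z : Rn n | t < h ‖z - x‖} = Metric.ball x r := by
  set A := {r : ℝ | 0 ≤ r ∧ h r ≤ t} with hA
  have hAc : IsClosed A := isClosed_Ici.inter (isClosed_le hc continuous_const)
  have hρA : ρ' ∈ A := ⟨hρ'.le, h0.le.trans ht⟩
  have hbdd : BddBelow A := ⟨0, fun r hr => hr.1⟩
  have hmem : sInf A ∈ A := hAc.csInf_mem ⟨ρ', hρA⟩ hbdd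
  refine ⟨sInf A, csInf_le hbdd hρA, ?_⟩
  ext z
  rw [mem_ball_iff_norm]
  constructor
  · intro hz
    by_contra hlt
    have h1 : h ‖z - x‖ ≤ h (sInf A) := ha hmem.1 (norm_nonneg _) (not_lt.1 hlt)
    exact absurd hz (not_lt.2 (h1.trans hmem.2))
  · intro hz
    by_contra hle
    exact absurd (csInf_le hbdd ⟨norm_nonneg _, not_lt.1 hle⟩) (not_le.2 hz)

/-- Comparing two measures on balls compares their integrals of radially decreasing functions. -/
lemma lintegral_radial_le {n : ℕ} {μ ν : Measure (Rn n)} {x : Rn n} {ρ' : ℝ} (hρ' : 0 < ρ')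
    {c : ℝ≥0∞} (hμν : ∀ r ≤ ρ', μ (Metric.ball x r) ≤ c * ν (Metric.ball x r)) {h : ℝ → ℝ}
    (hc : Continuous h) (ha : AntitoneOn h (Ici 0)) (h0 : h ρ' = 0) (hpos : ∀ r, 0 ≤ h r)
    (hcfin : c ≠ ∞) :
    ∫⁻ z, ENNReal.ofReal (h ‖z - x‖) ∂μ ≤ c * ∫⁻ z, ENNReal.ofReal (h ‖z - x‖) ∂ν := by
  have hm : Measurable fun z : Rn n => h ‖z - x‖ := by fun_prop
  -- Layer cake: each superlevel set of a radially decreasing function is a ball, of radius at most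
  -- `ρ'`, so the hypothesis applies level by level.
  rw [lintegral_eq_lintegral_meas_lt μ (ae_of_all _ fun z => hpos _) hm.aemeasurable,
    lintegral_eq_lintegral_meas_lt ν (ae_of_all _ fun z => hpos _) hm.aemeasurable,
    ← lintegral_const_mul' _ _ hcfin]
  refine setLIntegral_mono' measurableSet_Ioi fun t ht => ?_
  obtain ⟨r, hr, hrb⟩ := exists_superlevel_eq_ball x hρ' hc ha h0 (le_of_lt ht)
  rw [hrb]
  exact hμν r hr

/-! ### Perimeter and density estimates at a point with an approximate normal -/

/-- On balls of radius less than `r₀` around `x`, the weak gradient `σ μ` points essentially in the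
direction `ν`. -/
def IsNearlyAligned {n : ℕ} (μ : Measure (Rn n)) (σ : Rn n → Rn n) (x ν : Rn n) (r₀ : ℝ) : Prop :=
  ∀ r, 0 < r → r < r₀ →
    ∫ y in Metric.ball x r, (1 - inner ℝ ν (σ y)) ∂μ ≤ 1 / 2 * μ.real (Metric.ball x r)

lemma IsWeakGradient.one_sub_inner_nonneg {n : ℕ} {E : Set (Rn n)} {μ : Measure (Rn n)}
    {σ : Rn n → Rn n} (h : IsWeakGradient E μ σ) {ν : Rn n} (hν : ‖ν‖ = 1) :
    ∀ᵐ y ∂μ, 0 ≤ 1 - inner ℝ ν (σ y) ∧ 1 - inner ℝ ν (σ y) ≤ 2 := by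
  filter_upwards [h.abs_inner_le ν] with y hy
  rw [hν] at hy
  have := abs_le.1 hy
  constructor <;> linarith

/-- The perimeter in a ball is controlled by the volume in a larger ball. -/
lemma IsWeakGradient.exists_perimeter_le {n : ℕ} {E : Set (Rn n)} {μ : Measure (Rn n)}
    {σ : Rn n → Rn n} (h : IsWeakGradient E μ σ) {x ν : Rn n} (hν : ‖ν‖ = 1) {r₀ : ℝ}
    (hal : IsNearlyAligned μ σ x ν r₀) : ∃ C : ℝ, 0 < C ∧ ∀ ρ ρ', 0 < ρ → ρ < ρ' → ρ' < r₀ →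
      μ.real (Metric.ball x ρ) ≤ C / (ρ' - ρ) * volume.real (E ∩ Metric.ball x ρ') := by
  obtain ⟨C, hC, hcut⟩ := exists_radial_cutoff n
  refine ⟨2 * C, by positivity, fun ρ ρ' hρ hρρ' hρ' => ?_⟩
  have := h.locallyFinite
  obtain ⟨k, hkc, hka, hk0, hk1, hkin, hkout, hkd, hkg⟩ := hcut x ρ ρ' hρ hρρ'
  set η : Rn n → ℝ := fun z => k ‖z - x‖ with hη
  have hρ'0 : 0 < ρ' := hρ.trans hρρ'
  have hηc : Continuous η := hkd.continuous
  have hsupp : ∀ z, z ∉ Metric.ball x ρ' → η z = 0 := fun z hz => by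
    rw [mem_ball_iff_norm, not_lt] at hz
    exact hkout _ hz
  have hcs : HasCompactSupport η :=
    HasCompactSupport.intro (isCompact_closedBall x ρ') fun z hz =>
      hsupp z fun hz' => hz (Metric.ball_subset_closedBall hz')
  have hηi : Integrable η μ := hηc.integrable_of_hasCompactSupport hcs
  have hσm := h.measurable
  have hfm : Measurable fun y => 1 - inner ℝ ν (σ y) := by fun_prop
  have hf2 : ∀ᵐ y ∂μ, |1 - inner ℝ ν (σ y)| ≤ 2 := by
    filter_upwards [h.one_sub_inner_nonneg hν] with y hy
    rw [abs_of_nonneg hy.1]; exact hy.2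
  have hηfi : Integrable (fun y => η y * (1 - inner ℝ ν (σ y))) μ :=
    hηi.mul_bdd hfm.aestronglyMeasurable hf2
  -- Alignment is known only on balls; the radial comparison transfers it to the cutoff `η`. It
  -- yields `∫ η dμ ≤ 2 ∫ η (ν · σ) dμ`, and the right side is an integral of `-∂_ν η` over `E`.
  have hball : ∀ r ≤ ρ', (μ.withDensity fun y => ENNReal.ofReal (1 - inner ℝ ν (σ y)))
      (Metric.ball x r) ≤ ENNReal.ofReal (1 / 2) * μ (Metric.ball x r) := by
    intro r hr
    rcases le_or_gt r 0 with hr0 | hr0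
    · rw [Metric.ball_eq_empty.2 hr0]; simp
    rw [withDensity_apply _ Metric.isOpen_ball.measurableSet,
      ← ofReal_integral_eq_lintegral_ofReal (h.integrableOn_ball hfm hf2 x r)
        (ae_restrict_of_ae ((h.one_sub_inner_nonneg hν).mono fun y hy => hy.1)),
      ← ofReal_measureReal measure_ball_lt_top.ne, ← ENNReal.ofReal_mul (by norm_num)]
    exact ENNReal.ofReal_le_ofReal (hal r hr0 (hr.trans_lt hρ'))
  have h1 := lintegral_radial_le hρ'0 hball hkc hka (hkout ρ' le_rfl) hk0 ENNReal.ofReal_ne_top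
  rw [lintegral_withDensity_eq_lintegral_mul _ (by fun_prop) (by fun_prop)] at h1
  have h2 : ∫ y, η y * (1 - inner ℝ ν (σ y)) ∂μ ≤ 1 / 2 * ∫ y, η y ∂μ := by
    have e1 : ENNReal.ofReal (∫ y, η y * (1 - inner ℝ ν (σ y)) ∂μ)
        = ∫⁻ y, ((fun y => ENNReal.ofReal (1 - inner ℝ ν (σ y))) *
          fun z => ENNReal.ofReal (k ‖z - x‖)) y ∂μ := by
      rw [ofReal_integral_eq_lintegral_ofReal hηfi]
      · refine lintegral_congr fun y => ?_
        rw [Pi.mul_apply, mul_comm (ENNReal.ofReal _), ← ENNReal.ofReal_mul (hk0 _)]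
      · filter_upwards [h.one_sub_inner_nonneg hν] with y hy
        exact mul_nonneg (hk0 _) hy.1
    rw [← e1, ← ofReal_integral_eq_lintegral_ofReal hηi (ae_of_all _ fun z => hk0 _),
      ← ENNReal.ofReal_mul (by norm_num)] at h1
    exact (ENNReal.ofReal_le_ofReal_iff (mul_nonneg (by norm_num)
      (integral_nonneg fun z => hk0 _))).1 h1
  have h3 : ∫ y, η y * (1 - inner ℝ ν (σ y)) ∂μ
      = ∫ y, η y ∂μ - ∫ y, η y * inner ℝ ν (σ y) ∂μ := by
    have h4 : Integrable (fun y => η y * inner ℝ ν (σ y)) μ :=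
      hηi.mul_bdd (by fun_prop : Measurable _).aestronglyMeasurable (h.abs_inner_le ν)
    rw [← integral_sub hηi h4]
    congr 1; funext y; ring
  have h5 := h.integral_fderiv η hkd hcs ν
  have hgap : 0 < ρ' - ρ := by linarith
  have hfinV : volume (E ∩ Metric.ball x ρ') ≠ ∞ :=
    ((measure_mono inter_subset_right).trans_lt (measure_ball_lt_top (x := x) (r := ρ'))).ne
  -- Keeping the volume of `E` in the ball, rather than that of the whole ball, is what makes the
  -- density iteration possible.
  have h6 : -∫ z in E, fderiv ℝ η z ν ≤ C / (ρ' - ρ) * volume.real (E ∩ Metric.ball x ρ') := by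
    have hfz : ∀ z, z ∉ Metric.ball x ρ' → fderiv ℝ η z = 0 := fun z hz =>
      IsLocalMin.fderiv_eq_zero (Eventually.of_forall fun y => by
        rw [hsupp z hz]; exact hk0 _)
    have hfi : Integrable fun z => fderiv ℝ η z ν := by
      have h1 : Continuous fun z => fderiv ℝ η z ν := by
        have := hkd.continuous_fderiv one_ne_zero
        fun_prop
      exact h1.integrable_of_hasCompactSupport (hcs.fderiv_apply ℝ ν)
    have h7 : ∫ z in E, (Metric.ball x ρ').indicator (fun _ => C / (ρ' - ρ)) z
        = C / (ρ' - ρ) * volume.real (E ∩ Metric.ball x ρ') := by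
      rw [setIntegral_indicator Metric.isOpen_ball.measurableSet]
      simp [mul_comm]
    rw [← h7, ← integral_neg]
    refine integral_mono hfi.neg.restrict ((integrable_indicator_iff
      Metric.isOpen_ball.measurableSet).2 (integrableOn_const measure_ball_lt_top.ne)).restrict
      fun z => ?_
    by_cases hz : z ∈ Metric.ball x ρ'
    · rw [indicator_of_mem hz]
      calc -(fderiv ℝ η z ν) ≤ ‖fderiv ℝ η z ν‖ := neg_le_abs _
        _ ≤ ‖fderiv ℝ η z‖ * ‖ν‖ := ContinuousLinearMap.le_opNorm _ _
        _ ≤ C / (ρ' - ρ) := by rw [hν, mul_one]; exact hkg z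
    · rw [indicator_of_notMem hz, hfz z hz]; simp
  have h8 : μ.real (Metric.ball x ρ) ≤ ∫ y, η y ∂μ := by
    have h9 : ∫ y, (Metric.ball x ρ).indicator (fun _ => (1 : ℝ)) y ∂μ
        = μ.real (Metric.ball x ρ) := by
      rw [integral_indicator Metric.isOpen_ball.measurableSet]; simp
    rw [← h9]
    refine integral_mono ((integrable_indicator_iff Metric.isOpen_ball.measurableSet).2
      (integrableOn_const measure_ball_lt_top.ne)) hηi fun y => ?_
    refine indicator_apply_le' (fun hy => ?_) (fun _ => hk0 _)
    rw [mem_ball_iff_norm] at hy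
    exact (hkin _ (norm_nonneg _) hy.le).ge
  calc μ.real (Metric.ball x ρ) ≤ ∫ y, η y ∂μ := h8
    _ ≤ 2 * ∫ y, η y * inner ℝ ν (σ y) ∂μ := by linarith
    _ = 2 * -∫ z in E, fderiv ℝ η z ν := by rw [h5]; ring
    _ ≤ 2 * (C / (ρ' - ρ) * volume.real (E ∩ Metric.ball x ρ')) := by linarith
    _ = _ := by ring

/-- Both sides measure the pairs `(z, w)` in `S × W` with `z + w ∈ T`. -/
lemma lintegral_volume_translate {n : ℕ} {S W T : Set (Rn n)} (hT : MeasurableSet T) :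
    ∫⁻ z in S, volume (W ∩ {w | z + w ∈ T}) = ∫⁻ w in W, volume (S ∩ {z | z + w ∈ T}) := by
  have h1 : ∀ (A : Set (Rn n)) (v : Rn n), volume (A ∩ {w | v + w ∈ T})
      = ∫⁻ w in A, T.indicator 1 (v + w) := fun A v => by
    have : (fun w => T.indicator (1 : Rn n → ℝ≥0∞) (v + w)) = {w | v + w ∈ T}.indicator 1 := rfl
    have hm : MeasurableSet {w | v + w ∈ T} := measurable_const_add v hT
    rw [this, lintegral_indicator_one hm, Measure.restrict_apply hm, inter_comm]
  have h2 : ∀ w : Rn n, {z : Rn n | z + w ∈ T} = {z | w + z ∈ T} := fun w => by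
    ext z; simp [add_comm]
  simp_rw [h2, h1]
  rw [lintegral_lintegral_swap]
  · simp_rw [add_comm]
  · exact ((measurable_one.indicator hT).comp measurable_add).aemeasurable

lemma IsWeakGradient.volume_translate_diff_le_norm {n : ℕ} {E : Set (Rn n)} {μ : Measure (Rn n)}
    {σ : Rn n → Rn n} (h : IsWeakGradient E μ σ) (x w : Rn n) (ρ : ℝ) :
    volume.real {z | z ∈ Metric.ball x ρ ∧ z ∈ E ∧ z + w ∉ E}
      ≤ ‖w‖ * μ.real (Metric.ball x (ρ + ‖w‖)) := by
  have := h.locallyFinite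
  refine (h.volume_translate_diff_le x w ρ).trans ?_
  have h1 : ∀ᵐ y ∂μ.restrict (Metric.ball x (ρ + ‖w‖)), ‖max (-inner ℝ w (σ y)) 0‖ ≤ ‖w‖ := by
    refine ae_restrict_of_ae ?_
    filter_upwards [h.abs_inner_le w] with y hy
    rw [Real.norm_of_nonneg (le_max_right _ _)]
    exact max_le ((neg_le_abs _).trans hy) (norm_nonneg w)
  have h2 := norm_setIntegral_le_of_norm_le_const_ae measure_ball_lt_top h1
  exact (le_abs_self _).trans h2

lemma volume_ball_real {n : ℕ} (x : Rn n) {r : ℝ} (hr : 0 < r) :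
    volume.real (Metric.ball x r) = r ^ n * volume.real (Metric.ball (0 : Rn n) 1) := by
  rw [Measure.real, Measure.addHaar_ball_of_pos _ _ hr, finrank_euclideanSpace_fin,
    ENNReal.toReal_mul, ENNReal.toReal_ofReal (by positivity), Measure.real]

lemma volume_unitBall_pos (n : ℕ) : 0 < volume.real (Metric.ball (0 : Rn n) 1) :=
  ENNReal.toReal_pos (Metric.measure_ball_pos _ _ one_pos).ne' measure_ball_lt_top.ne

/-- A relative isoperimetric inequality in the regime of small density. -/
lemma IsWeakGradient.volume_le_of_small_density {n : ℕ} {E : Set (Rn n)} {μ : Measure (Rn n)}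
    {σ : Rn n → Rn n} (hw : IsWeakGradient E μ σ) (x : Rn n) {ρ h : ℝ} (hh : 0 < h)
    (hV : volume.real (E ∩ Metric.ball x (ρ + h)) ≤ volume.real (Metric.ball (0 : Rn n) h) / 2) :
    volume.real (E ∩ Metric.ball x ρ) ≤ 2 * h * μ.real (Metric.ball x (ρ + h)) := by
  have := hw.locallyFinite
  have hE := hw.measurableSet
  have hfin : ∀ r, volume (E ∩ Metric.ball x r) ≠ ∞ := fun r =>
    ((measure_mono inter_subset_right).trans_lt (measure_ball_lt_top (x := x) (r := r))).ne
  set b := volume.real (Metric.ball (0 : Rn n) h) with hb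
  have hb0 : 0 < b := ENNReal.toReal_pos (Metric.measure_ball_pos _ _ hh).ne' measure_ball_lt_top.ne
  set V := volume.real (E ∩ Metric.ball x ρ) with hVdef
  set V' := volume.real (E ∩ Metric.ball x (ρ + h)) with hV'def
  set m := μ.real (Metric.ball x (ρ + h)) with hm
  -- From a point `z` of `E`, the shifts `w` in the ball of radius `h` that stay in `E` have total
  -- volume at most `V' ≤ b / 2`; the others leave `E`. Averaging over `w` and bounding each loss by
  -- the perimeter gives `b V ≤ V' V + h m b`.
  have h1 : ∀ z ∈ E ∩ Metric.ball x ρ, ENNReal.ofReal b ≤ ENNReal.ofReal V' +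
      volume (Metric.ball (0 : Rn n) h ∩ {w | z + w ∈ Eᶜ}) := by
    intro z hz
    rw [hb, hV'def, ofReal_measureReal measure_ball_lt_top.ne, ofReal_measureReal (hfin _)]
    have h2 : Metric.ball (0 : Rn n) h ⊆ {w | z + w ∈ E ∩ Metric.ball x (ρ + h)} ∪
        (Metric.ball (0 : Rn n) h ∩ {w | z + w ∈ Eᶜ}) := by
      intro w hw
      by_cases hzw : z + w ∈ E
      · refine Or.inl ⟨hzw, ?_⟩
        have h3 := hz.2
        rw [mem_ball_iff_norm] at h3 ⊢
        rw [mem_ball_zero_iff] at hw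
        calc ‖z + w - x‖ = ‖(z - x) + w‖ := by congr 1; abel
          _ ≤ ‖z - x‖ + ‖w‖ := norm_add_le _ _
          _ < ρ + h := by linarith
      · exact Or.inr ⟨hw, hzw⟩
    refine (measure_mono h2).trans ((measure_union_le _ _).trans ?_)
    exact add_le_add_left (measure_preimage_add volume z _).le _
  have h4 : ∀ w ∈ Metric.ball (0 : Rn n) h, volume ((E ∩ Metric.ball x ρ) ∩ {z | z + w ∈ Eᶜ})
      ≤ ENNReal.ofReal (h * m) := by
    intro w hwh
    rw [mem_ball_zero_iff] at hwh
    have h5 := hw.volume_translate_diff_le_norm x w ρ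
    have h6 : (E ∩ Metric.ball x ρ) ∩ {z | z + w ∈ Eᶜ}
        = {z | z ∈ Metric.ball x ρ ∧ z ∈ E ∧ z + w ∉ E} := by
      ext z; simp only [mem_inter_iff, mem_ofPred_eq, mem_compl_iff]; tauto
    rw [← h6] at h5
    rw [← ofReal_measureReal (ne_top_of_le_ne_top (hfin ρ) (measure_mono inter_subset_left))]
    refine ENNReal.ofReal_le_ofReal (h5.trans ?_)
    gcongr
    exact measureReal_mono (Metric.ball_subset_ball (by linarith)) measure_ball_lt_top.ne
  have h7 : ENNReal.ofReal b * ENNReal.ofReal V ≤ ENNReal.ofReal V' * ENNReal.ofReal V +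
      ENNReal.ofReal (h * m) * ENNReal.ofReal b := by
    have e1 : ENNReal.ofReal V = volume (E ∩ Metric.ball x ρ) := ofReal_measureReal (hfin ρ)
    have e2 : ENNReal.ofReal b = volume (Metric.ball (0 : Rn n) h) :=
      ofReal_measureReal measure_ball_lt_top.ne
    have hS : MeasurableSet (E ∩ Metric.ball x ρ) := hE.inter Metric.isOpen_ball.measurableSet
    calc ENNReal.ofReal b * ENNReal.ofReal V
        = ∫⁻ z in E ∩ Metric.ball x ρ, ENNReal.ofReal b := by rw [setLIntegral_const, e1]
      _ ≤ ∫⁻ z in E ∩ Metric.ball x ρ, (ENNReal.ofReal V' +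
          volume (Metric.ball (0 : Rn n) h ∩ {w | z + w ∈ Eᶜ})) := setLIntegral_mono' hS h1
      _ = ENNReal.ofReal V' * ENNReal.ofReal V + ∫⁻ z in E ∩ Metric.ball x ρ,
          volume (Metric.ball (0 : Rn n) h ∩ {w | z + w ∈ Eᶜ}) := by
          rw [lintegral_add_left measurable_const, setLIntegral_const, e1]
      _ = ENNReal.ofReal V' * ENNReal.ofReal V + ∫⁻ w in Metric.ball (0 : Rn n) h,
          volume ((E ∩ Metric.ball x ρ) ∩ {z | z + w ∈ Eᶜ}) := by
          rw [lintegral_volume_translate hE.compl]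
      _ ≤ ENNReal.ofReal V' * ENNReal.ofReal V + ∫⁻ w in Metric.ball (0 : Rn n) h,
          ENNReal.ofReal (h * m) := by
          gcongr 1
          exact setLIntegral_mono' Metric.isOpen_ball.measurableSet h4
      _ = _ := by rw [setLIntegral_const, e2]
  have hV0 : 0 ≤ V := measureReal_nonneg
  have hV'0 : 0 ≤ V' := measureReal_nonneg
  have hm0 : 0 ≤ m := measureReal_nonneg
  rw [← ENNReal.ofReal_mul hb0.le, ← ENNReal.ofReal_mul hV'0, ← ENNReal.ofReal_mul (by positivity),
    ← ENNReal.ofReal_add (by positivity) (by positivity),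
    ENNReal.ofReal_le_ofReal_iff (by positivity)] at h7
  have h8 : V' * V ≤ b / 2 * V := by gcongr
  have h9 : b * V ≤ b * (2 * h * m) := by nlinarith
  exact le_of_mul_le_mul_left h9 hb0

/-- A lower bound for the volume density at a point of the support of the perimeter measure with an
approximate normal. -/
lemma IsWeakGradient.exists_density_le {n : ℕ} (hn : 1 ≤ n) {E : Set (Rn n)} {μ : Measure (Rn n)}
    {σ : Rn n → Rn n} (h : IsWeakGradient E μ σ) {x ν : Rn n} (hν : ‖ν‖ = 1) {r₀ : ℝ}
    (hal : IsNearlyAligned μ σ x ν r₀) (hμ : ∀ r, 0 < r → 0 < μ (Metric.ball x r)) :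
    ∃ δ : ℝ, 0 < δ ∧ ∀ r, 0 < r → r < r₀ → δ * r ^ n ≤ volume.real (E ∩ Metric.ball x r) := by
  have := h.locallyFinite
  obtain ⟨C, hC, hper⟩ := h.exists_perimeter_le hν hal
  set ω := volume.real (Metric.ball (0 : Rn n) 1) with hω
  have hω0 : 0 < ω := volume_unitBall_pos n
  set V : ℝ → ℝ := fun r => volume.real (E ∩ Metric.ball x r) with hV
  have hVmono : ∀ a b, a ≤ b → V a ≤ V b := fun a b hab =>
    measureReal_mono (inter_subset_inter_right _ (Metric.ball_subset_ball hab))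
      ((measure_mono inter_subset_right).trans_lt (measure_ball_lt_top (x := x) (r := b))).ne
  have hV0 : ∀ a, 0 ≤ V a := fun a => measureReal_nonneg
  -- The isoperimetric step uses width `θ d` and the perimeter estimate then has a gap of at least
  -- `d`; together they contract by `2 C θ`, which this choice keeps below `(1 / 2) ^ n`.
  set θ : ℝ := min 1 ((1 / 2) ^ n / (2 * C)) with hθ
  have hθ0 : 0 < θ := by positivity
  have hθ1 : θ ≤ 1 := min_le_left _ _
  have hθ2 : 2 * C * θ ≤ (1 / 2) ^ n := by
    have h1 : θ ≤ (1 / 2) ^ n / (2 * C) := min_le_right _ _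
    rw [le_div_iff₀ (by positivity)] at h1
    linarith
  have step : ∀ ρ d, 0 < ρ → 0 < d → ρ + 2 * d < r₀ → V (ρ + 2 * d) ≤ ω / 2 * (θ * d) ^ n →
      V ρ ≤ (1 / 2) ^ n * V (ρ + 2 * d) := by
    intro ρ d hρ hd hr hsmall
    have hθd : 0 < θ * d := by positivity
    have hθd' : θ * d ≤ d := mul_le_of_le_one_left hd.le hθ1
    have h1 : V ρ ≤ 2 * (θ * d) * μ.real (Metric.ball x (ρ + θ * d)) := by
      refine h.volume_le_of_small_density x hθd ?_
      rw [volume_ball_real 0 hθd]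
      calc V (ρ + θ * d) ≤ V (ρ + 2 * d) := hVmono _ _ (by linarith)
        _ ≤ _ := hsmall.trans (by rw [hω]; linarith)
    have h2 := hper (ρ + θ * d) (ρ + 2 * d) (by linarith) (by linarith) hr
    have h3 : C / (ρ + 2 * d - (ρ + θ * d)) ≤ C / d := by
      gcongr
      linarith
    have h4 : μ.real (Metric.ball x (ρ + θ * d)) ≤ C / d * V (ρ + 2 * d) :=
      h2.trans (mul_le_mul_of_nonneg_right h3 (hV0 _))
    calc V ρ ≤ 2 * (θ * d) * μ.real (Metric.ball x (ρ + θ * d)) := h1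
      _ ≤ 2 * (θ * d) * (C / d * V (ρ + 2 * d)) := by gcongr
      _ = 2 * C * θ * V (ρ + 2 * d) := by field_simp
      _ ≤ (1 / 2) ^ n * V (ρ + 2 * d) := mul_le_mul_of_nonneg_right hθ2 (hV0 _)
  -- The radii are `r / 2 * (1 + 2⁻ᵏ)`, with gaps `2 d` for `d = r 2⁻ᵏ / 8`. The smallness threshold
  -- `ω / 2 * (θ d) ^ n` then decreases by `2⁻ⁿ` at each step, exactly as the volume bound does, so
  -- smallness propagates.
  refine ⟨ω / 2 * (θ / 8) ^ n, by positivity, fun r hr hr₀ => ?_⟩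
  by_contra hlt
  have hlt : V r ≤ ω / 2 * (θ / 8) ^ n * r ^ n := (not_le.1 hlt).le
  have hiter : ∀ k : ℕ, V (r / 2 * (1 + (1 / 2) ^ k)) ≤ ((1 / 2) ^ n) ^ k * V r := by
    intro k
    induction k with
    | zero => norm_num
    | succ k ih =>
      have hp : (0 : ℝ) < (1 / 2) ^ k := by positivity
      have hp1 : ((1 : ℝ) / 2) ^ k ≤ 1 := pow_le_one₀ (by norm_num) (by norm_num)
      have e1 : r / 2 * (1 + (1 / 2) ^ k)
          = r / 2 * (1 + (1 / 2) ^ (k + 1)) + 2 * (r * (1 / 2) ^ k / 8) := by ring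
      have h1 := step (r / 2 * (1 + (1 / 2) ^ (k + 1))) (r * (1 / 2) ^ k / 8) (by positivity)
        (by positivity) (by rw [← e1]; nlinarith) (by
          rw [← e1]
          calc _ ≤ ((1 / 2) ^ n) ^ k * V r := ih
            _ ≤ ((1 / 2) ^ n) ^ k * (ω / 2 * (θ / 8) ^ n * r ^ n) := by gcongr
            _ = _ := by rw [← pow_mul, mul_comm n k, pow_mul]; simp only [← mul_pow, mul_assoc]
                        ring)
      rw [← e1] at h1
      calc _ ≤ (1 / 2) ^ n * V (r / 2 * (1 + (1 / 2) ^ k)) := h1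
        _ ≤ (1 / 2) ^ n * (((1 / 2) ^ n) ^ k * V r) := by gcongr
        _ = _ := by ring
  have hlim : Tendsto (fun k : ℕ => (((1 : ℝ) / 2) ^ n) ^ k * V r) atTop (𝓝 0) := by
    have h1 : ((1 : ℝ) / 2) ^ n < 1 := pow_lt_one₀ (by norm_num) (by norm_num) (by omega)
    simpa using (tendsto_pow_atTop_nhds_zero_of_lt_one (by positivity) h1).mul_const (V r)
  -- All these radii exceed `r / 2`, so `E` has no volume in that ball; the perimeter estimate then
  -- annihilates `μ` on the ball of radius `r / 4`, which is impossible.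
  have hzero : V (r / 2) ≤ 0 := by
    refine ge_of_tendsto' hlim fun k => (hVmono _ _ ?_).trans (hiter k)
    have : (0 : ℝ) < (1 / 2) ^ k := by positivity
    nlinarith
  have h1 := hper (r / 4) (r / 2) (by positivity) (by linarith) (by linarith)
  have h2 : V (r / 2) = 0 := le_antisymm hzero (hV0 _)
  have h3 : volume.real (E ∩ Metric.ball x (r / 2)) = 0 := h2
  rw [h3, mul_zero] at h1
  have h4 : 0 < μ.real (Metric.ball x (r / 4)) :=
    ENNReal.toReal_pos (hμ _ (by positivity)).ne' measure_ball_lt_top.ne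
  linarith

/-! ### Blow-up at a point with a measure-theoretic normal -/

/-- `σ μ` is the weak gradient of `χ_E`, and `ν` is the measure-theoretic (inner) normal at `x`. -/
structure HasNormalAt {n : ℕ} (E : Set (Rn n)) (μ : Measure (Rn n)) (σ : Rn n → Rn n)
    (x ν : Rn n) : Prop where
  isWeakGradient : IsWeakGradient E μ σ
  measure_ball_pos : ∀ r : ℝ, 0 < r → 0 < μ (Metric.ball x r)
  norm_eq_one : ‖ν‖ = 1
  tendsto : Tendsto (fun r : ℝ => (μ.real (Metric.ball x r))⁻¹ • ∫ y in Metric.ball x r, σ y ∂μ)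
    (𝓝[>] 0) (𝓝 ν)

namespace HasNormalAt

variable {n : ℕ} {E : Set (Rn n)} {μ : Measure (Rn n)} {σ : Rn n → Rn n} {x ν : Rn n}

lemma compl (h : HasNormalAt E μ σ x ν) : HasNormalAt Eᶜ μ (-σ) x (-ν) := by
  refine ⟨h.isWeakGradient.compl, h.measure_ball_pos, by simpa using h.norm_eq_one, ?_⟩
  simpa [integral_neg] using h.tendsto.neg

lemma measureReal_ball_pos (h : HasNormalAt E μ σ x ν) {r : ℝ} (hr : 0 < r) :
    0 < μ.real (Metric.ball x r) := by
  have := h.isWeakGradient.locallyFinite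
  exact ENNReal.toReal_pos (h.measure_ball_pos r hr).ne' measure_ball_lt_top.ne

lemma tendsto_average_one_sub_inner (h : HasNormalAt E μ σ x ν) :
    Tendsto (fun r : ℝ => (μ.real (Metric.ball x r))⁻¹ *
      ∫ y in Metric.ball x r, (1 - inner ℝ ν (σ y)) ∂μ) (𝓝[>] 0) (𝓝 0) := by
  have hw := h.isWeakGradient
  have := hw.locallyFinite
  have hσ := hw.measurable
  have h1 : Tendsto (fun r : ℝ => 1 - inner ℝ ν ((μ.real (Metric.ball x r))⁻¹ •
      ∫ y in Metric.ball x r, σ y ∂μ)) (𝓝[>] 0) (𝓝 (1 - inner ℝ ν ν)) :=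
    tendsto_const_nhds.sub (tendsto_const_nhds.inner h.tendsto)
  rw [real_inner_self_eq_norm_sq, h.norm_eq_one, one_pow, sub_self] at h1
  refine h1.congr' ?_
  filter_upwards [self_mem_nhdsWithin] with r hr
  have hm := h.measureReal_ball_pos hr
  have hσi : IntegrableOn σ (Metric.ball x r) μ :=
    Measure.integrableOn_of_bounded (M := 1) measure_ball_lt_top.ne hσ.aestronglyMeasurable
      (ae_restrict_of_ae (hw.norm_eq_one.mono fun y hy => hy.le))
  have h2 : ∫ y in Metric.ball x r, (1 - inner ℝ ν (σ y)) ∂μ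
      = μ.real (Metric.ball x r) - inner ℝ ν (∫ y in Metric.ball x r, σ y ∂μ) := by
    have hci : IntegrableOn (fun _ : Rn n => (1 : ℝ)) (Metric.ball x r) μ :=
      integrableOn_const measure_ball_lt_top.ne
    have hii : IntegrableOn (fun y => inner ℝ ν (σ y)) (Metric.ball x r) μ := hσi.const_inner ν
    rw [integral_sub hci hii, integral_inner hσi]
    simp
  rw [h2, inner_smul_right, mul_sub, inv_mul_cancel₀ hm.ne']

lemma exists_isNearlyAligned (h : HasNormalAt E μ σ x ν) :
    ∃ r₀ : ℝ, 0 < r₀ ∧ IsNearlyAligned μ σ x ν r₀ := by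
  have h1 := h.tendsto_average_one_sub_inner.eventually 
    (gt_mem_nhds (show (0 : ℝ) < 1 / 2 by norm_num))
  obtain ⟨r₀, hr₀, hr⟩ := mem_nhdsGT_iff_exists_Ioo_subset.1 h1
  refine ⟨r₀, hr₀, fun r hr0 hrr₀ => ?_⟩
  have h2 : (μ.real (Metric.ball x r))⁻¹ *
      ∫ y in Metric.ball x r, (1 - inner ℝ ν (σ y)) ∂μ < 1 / 2 := hr ⟨hr0, hrr₀⟩
  rw [inv_mul_lt_iff₀ (h.measureReal_ball_pos hr0)] at h2
  linarith

/-- For unit vectors `‖σ - ν‖² = 2 (1 - ν · σ)`, and Young's inequality with parameter `ε` reduces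
the first power to the square: the average is at most `ε / 2 + ε / 4` once that of `1 - ν · σ` is
below `ε² / 4`. -/
lemma tendsto_average_norm_sub (h : HasNormalAt E μ σ x ν) :
    Tendsto (fun r : ℝ => (μ.real (Metric.ball x r))⁻¹ *
      ∫ y in Metric.ball x r, ‖σ y - ν‖ ∂μ) (𝓝[>] 0) (𝓝 0) := by
  have hw := h.isWeakGradient
  have := hw.locallyFinite
  have hσ := hw.measurable
  rw [Metric.tendsto_nhds]
  intro ε hε
  filter_upwards [self_mem_nhdsWithin,
    h.tendsto_average_one_sub_inner.eventually 
      (gt_mem_nhds (show (0 : ℝ) < ε ^ 2 / 4 by positivity))]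
    with r hr hlt
  have hm := h.measureReal_ball_pos hr
  have h1 : ∀ᵐ y ∂μ, ‖σ y - ν‖ ≤ ε / 2 + ε⁻¹ * (1 - inner ℝ ν (σ y)) := by
    filter_upwards [hw.norm_eq_one] with y hy
    have h2 : ‖σ y - ν‖ ^ 2 = 2 * (1 - inner ℝ ν (σ y)) := by
      rw [norm_sub_sq_real, hy, h.norm_eq_one, real_inner_comm]; ring
    have h3 : 1 - inner ℝ ν (σ y) = ‖σ y - ν‖ ^ 2 / 2 := by linarith
    rw [h3]
    have h4 : 0 ≤ (‖σ y - ν‖ - ε) ^ 2 / (2 * ε) := by positivity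
    have h5 : (‖σ y - ν‖ - ε) ^ 2 / (2 * ε)
        = ε / 2 + ε⁻¹ * (‖σ y - ν‖ ^ 2 / 2) - ‖σ y - ν‖ := by field_simp; ring
    linarith
  have hfi : IntegrableOn (fun y => 1 - inner ℝ ν (σ y)) (Metric.ball x r) μ := by
    refine hw.integrableOn_ball (by fun_prop) (c := 2) ?_ x r
    filter_upwards [hw.one_sub_inner_nonneg h.norm_eq_one] with y hy
    rw [abs_of_nonneg hy.1]; exact hy.2
  have hni : IntegrableOn (fun y => ‖σ y - ν‖) (Metric.ball x r) μ := by
    refine hw.integrableOn_ball (by fun_prop) (c := 2) ?_ x r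
    filter_upwards [hw.norm_eq_one] with y hy
    rw [abs_of_nonneg (norm_nonneg _)]
    calc ‖σ y - ν‖ ≤ ‖σ y‖ + ‖ν‖ := norm_sub_le _ _
      _ = 2 := by rw [hy, h.norm_eq_one]; norm_num
  have hci : IntegrableOn (fun _ : Rn n => ε / 2) (Metric.ball x r) μ :=
    integrableOn_const measure_ball_lt_top.ne
  have h6 : ∫ y in Metric.ball x r, ‖σ y - ν‖ ∂μ ≤ ε / 2 * μ.real (Metric.ball x r) +
      ε⁻¹ * ∫ y in Metric.ball x r, (1 - inner ℝ ν (σ y)) ∂μ := by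
    calc _ ≤ ∫ y in Metric.ball x r, (ε / 2 + ε⁻¹ * (1 - inner ℝ ν (σ y))) ∂μ :=
          integral_mono_ae hni (hci.add (hfi.const_mul _)) (ae_restrict_of_ae h1)
      _ = _ := by
          rw [integral_add hci (hfi.const_mul _), integral_const_mul]
          simp [mul_comm]
  rw [inv_mul_lt_iff₀ hm] at hlt
  rw [Real.dist_eq, sub_zero, abs_of_nonneg
    (mul_nonneg (inv_nonneg.2 hm.le) (integral_nonneg fun y => norm_nonneg _)), inv_mul_lt_iff₀ hm]
  calc _ ≤ _ := h6
    _ < ε / 2 * μ.real (Metric.ball x r) + ε⁻¹ * (μ.real (Metric.ball x r) * (ε ^ 2 / 4)) := by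
        gcongr
    _ = μ.real (Metric.ball x r) * (3 / 4 * ε) := by field_simp; ring
    _ ≤ μ.real (Metric.ball x r) * ε := by gcongr; linarith

/-- The perimeter measure of small balls grows at most like `r ^ (n - 1)`. -/
lemma exists_perimeter_ball_le (h : HasNormalAt E μ σ x ν) : ∃ C r₁ : ℝ, 0 < C ∧ 0 < r₁ ∧
    ∀ r, 0 < r → r < r₁ → r * μ.real (Metric.ball x r) ≤ C * r ^ n := by
  obtain ⟨r₀, hr₀, hal⟩ := h.exists_isNearlyAligned
  obtain ⟨C, hC, hper⟩ := h.isWeakGradient.exists_perimeter_le h.norm_eq_one hal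
  have hω := volume_unitBall_pos n
  refine ⟨C * (2 ^ n * volume.real (Metric.ball (0 : Rn n) 1)), r₀ / 2, by positivity,
    by positivity, fun r hr hrr => ?_⟩
  -- Doubling the radius makes the gap equal to `r`; moving it to the left side avoids the exponent
  -- `n - 1`.
  have h1 := hper r (2 * r) hr (by linarith) (by linarith)
  have h2 : volume.real (E ∩ Metric.ball x (2 * r)) ≤ volume.real (Metric.ball x (2 * r)) :=
    measureReal_mono inter_subset_right measure_ball_lt_top.ne
  rw [volume_ball_real x (by positivity)] at h2
  rw [show 2 * r - r = r by ring] at h1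
  calc r * μ.real (Metric.ball x r)
      ≤ r * (C / r * ((2 * r) ^ n * volume.real (Metric.ball (0 : Rn n) 1))) := by
        gcongr
        exact h1.trans (by gcongr)
    _ = _ := by rw [mul_pow]; field_simp

/-- If `ν · w ≥ 0` then `-w · σ ≤ -w · (σ - ν) ≤ ‖w‖ ‖σ - ν‖`: translations towards the inner side
of the tangent plane hardly leave `E`. -/
lemma volume_translate_diff_le_of_inner_nonneg (h : HasNormalAt E μ σ x ν) {w : Rn n}
    (hw : 0 ≤ inner ℝ ν w) {ρ r : ℝ} (hr : ρ + ‖w‖ ≤ r) :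
    volume.real {z | z ∈ Metric.ball x ρ ∧ z ∈ E ∧ z + w ∉ E}
      ≤ ‖w‖ * ∫ y in Metric.ball x r, ‖σ y - ν‖ ∂μ := by
  have hg := h.isWeakGradient
  have := hg.locallyFinite
  have hσ := hg.measurable
  refine (hg.volume_translate_diff_le x w ρ).trans ?_
  have hni : IntegrableOn (fun y => ‖σ y - ν‖) (Metric.ball x r) μ := by
    refine hg.integrableOn_ball (by fun_prop) (c := 2) ?_ x r
    filter_upwards [hg.norm_eq_one] with y hy
    rw [abs_of_nonneg (norm_nonneg _)]
    calc ‖σ y - ν‖ ≤ ‖σ y‖ + ‖ν‖ := norm_sub_le _ _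
      _ = 2 := by rw [hy, h.norm_eq_one]; norm_num
  have hsub : Metric.ball x (ρ + ‖w‖) ⊆ Metric.ball x r := Metric.ball_subset_ball hr
  calc _ ≤ ∫ y in Metric.ball x (ρ + ‖w‖), ‖w‖ * ‖σ y - ν‖ ∂μ := by
        refine integral_mono ?_ ((hni.mono_set hsub).const_mul _) fun y => ?_
        · refine hg.integrableOn_ball (by fun_prop) (c := ‖w‖) ?_ x _
          filter_upwards [hg.abs_inner_le w] with y hy
          rw [abs_of_nonneg (le_max_right _ _)]
          exact max_le ((neg_le_abs _).trans hy) (norm_nonneg w)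
        · refine max_le ?_ (by positivity)
          have h1 : inner ℝ w (σ y - ν) = inner ℝ w (σ y) - inner ℝ ν w := by
            rw [inner_sub_right, real_inner_comm ν w]
          have h2 := (abs_le.1 (abs_real_inner_le_norm w (σ y - ν))).1
          simp only
          linarith
    _ ≤ ∫ y in Metric.ball x r, ‖w‖ * ‖σ y - ν‖ ∂μ :=
        setIntegral_mono_set (hni.const_mul _) (ae_of_all _ fun y => by positivity)
          (ae_of_all _ hsub)
    _ = _ := integral_const_mul _ _

/-- The part of the complement of `E` above the tangent plane, at scale `R`. -/
lemma volume_upper_mul_le (h : HasNormalAt E μ σ x ν) {M ρ R : ℝ} (hM : 0 < M)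
    (hρ1 : ρ ≤ 1) (hR : 0 < R) :
    volume.real {y | y ∈ Metric.ball x (M * R) ∧ ρ * R < inner ℝ ν (y - x) ∧ y ∉ E} *
      volume.real (E ∩ Metric.ball x (ρ * R))
      ≤ volume.real (Metric.ball (0 : Rn n) ((M + 1) * R)) *
        ((M + 1) * R * ∫ y in Metric.ball x ((M + 2) * R), ‖σ y - ν‖ ∂μ) := by
  have hE := h.isWeakGradient.measurableSet
  set T := {y | y ∈ Metric.ball x (M * R) ∧ ρ * R < inner ℝ ν (y - x) ∧ y ∉ E} with hT
  set S := E ∩ Metric.ball x (ρ * R) with hS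
  set W := Metric.ball (0 : Rn n) ((M + 1) * R) ∩ {w | 0 ≤ inner ℝ ν w} with hW
  set I := ∫ y in Metric.ball x ((M + 2) * R), ‖σ y - ν‖ ∂μ with hI
  have hI0 : 0 ≤ I := integral_nonneg fun y => norm_nonneg _
  have hm1 : MeasurableSet {y : Rn n | ρ * R < inner ℝ ν (y - x)} :=
    measurableSet_lt measurable_const (by fun_prop)
  have hm2 : MeasurableSet {w : Rn n | 0 ≤ inner ℝ ν w} :=
    measurableSet_le measurable_const (by fun_prop)
  have hTm : MeasurableSet T := Metric.isOpen_ball.measurableSet.inter (hm1.inter hE.compl)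
  have hSm : MeasurableSet S := hE.inter Metric.isOpen_ball.measurableSet
  have hWm : MeasurableSet W := Metric.isOpen_ball.measurableSet.inter hm2
  have hTfin : volume T ≠ ∞ := ((measure_mono fun y hy => hy.1).trans_lt
    (measure_ball_lt_top (x := x) (r := M * R))).ne
  have hSfin : volume S ≠ ∞ := ((measure_mono inter_subset_right).trans_lt
    (measure_ball_lt_top (x := x) (r := ρ * R))).ne
  -- A shift `w` from `z ∈ S` to a point of `T` satisfies `ν · w ≥ 0`, since `T` lies above height
  -- `ρ R` and `S` lies within distance `ρ R` of `x`. Its length is below `(M + 1) R` because `ρ ≤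
  -- 1`.
  have h1 : ∀ z ∈ S, volume T ≤ volume (W ∩ {w | z + w ∈ T}) := by
    intro z hz
    rw [← measure_preimage_add volume z T]
    refine measure_mono fun w hw => ⟨?_, hw⟩
    have hz2 : ‖z - x‖ < ρ * R := by rw [← mem_ball_iff_norm]; exact hz.2
    have hw1 : ‖z + w - x‖ < M * R := by rw [← mem_ball_iff_norm]; exact hw.1
    have hw2 : ρ * R < inner ℝ ν (z + w - x) := hw.2.1
    refine ⟨mem_ball_zero_iff.2 ?_, ?_⟩
    · calc ‖w‖ = ‖(z + w - x) - (z - x)‖ := by congr 1; abel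
        _ ≤ ‖z + w - x‖ + ‖z - x‖ := norm_sub_le _ _
        _ < (M + 1) * R := by nlinarith
    · have h2 : inner ℝ ν w = inner ℝ ν (z + w - x) - inner ℝ ν (z - x) := by
        rw [← inner_sub_right]; congr 1; abel
      have h3 := (abs_le.1 (abs_real_inner_le_norm ν (z - x))).2
      rw [h.norm_eq_one, one_mul] at h3
      change 0 ≤ inner ℝ ν w
      linarith
  have h4 : ∀ w ∈ W, volume (S ∩ {z | z + w ∈ T}) ≤ ENNReal.ofReal ((M + 1) * R * I) := by
    intro w hw
    have hw1 : ‖w‖ < (M + 1) * R := mem_ball_zero_iff.1 hw.1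
    have h5 := h.volume_translate_diff_le_of_inner_nonneg (w := w) hw.2 (ρ := ρ * R)
      (r := (M + 2) * R) (by nlinarith)
    have h6 : S ∩ {z | z + w ∈ T} ⊆ {z | z ∈ Metric.ball x (ρ * R) ∧ z ∈ E ∧ z + w ∉ E} :=
      fun z hz => ⟨hz.1.2, hz.1.1, hz.2.2.2⟩
    have hfin : volume {z | z ∈ Metric.ball x (ρ * R) ∧ z ∈ E ∧ z + w ∉ E} ≠ ∞ :=
      ((measure_mono fun y hy => hy.1).trans_lt (measure_ball_lt_top (x := x) (r := ρ * R))).ne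
    refine (measure_mono h6).trans ?_
    rw [← ofReal_measureReal hfin]
    refine ENNReal.ofReal_le_ofReal (h5.trans ?_)
    gcongr
  have h7 : volume T * volume S ≤ ENNReal.ofReal ((M + 1) * R * I) *
      volume (Metric.ball (0 : Rn n) ((M + 1) * R)) := by
    calc volume T * volume S = ∫⁻ z in S, volume T := by rw [setLIntegral_const]
      _ ≤ ∫⁻ z in S, volume (W ∩ {w | z + w ∈ T}) := setLIntegral_mono' hSm h1
      _ = ∫⁻ w in W, volume (S ∩ {z | z + w ∈ T}) := lintegral_volume_translate hTm
      _ ≤ ∫⁻ w in W, ENNReal.ofReal ((M + 1) * R * I) := setLIntegral_mono' hWm h4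
      _ = ENNReal.ofReal ((M + 1) * R * I) * volume W := setLIntegral_const _ _
      _ ≤ _ := by gcongr; exact inter_subset_left
  have h8 := ENNReal.toReal_mono (ENNReal.mul_ne_top ENNReal.ofReal_ne_top
    measure_ball_lt_top.ne) h7
  rw [ENNReal.toReal_mul, ENNReal.toReal_mul, ENNReal.toReal_ofReal (by positivity)] at h8
  rw [mul_comm (volume.real (Metric.ball _ _))]
  exact h8

/-- The product estimate is divided by the lower density bound `δ (ρ R)^n`. The perimeter growth
turns `R ∫ ‖σ - ν‖ dμ` into at most a constant times `R^n` times the average of `‖σ - ν‖`, which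
tends to zero. -/
lemma tendsto_volume_upper (h : HasNormalAt E μ σ x ν) (hn : 1 ≤ n) {M ρ : ℝ} (hM : 0 < M)
    (hρ : 0 < ρ) (hρ1 : ρ ≤ 1) :
    Tendsto (fun R : ℝ => volume.real
      {y | y ∈ Metric.ball x (M * R) ∧ ρ * R < inner ℝ ν (y - x) ∧ y ∉ E} / R ^ n)
      (𝓝[>] 0) (𝓝 0) := by
  obtain ⟨C, r₁, hC, hr₁, hper⟩ := h.exists_perimeter_ball_le
  obtain ⟨r₀, hr₀, hal⟩ := h.exists_isNearlyAligned
  obtain ⟨δ, hδ, hdens⟩ := h.isWeakGradient.exists_density_le hn h.norm_eq_one hal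
    h.measure_ball_pos
  set ω := volume.real (Metric.ball (0 : Rn n) 1) with hω
  have hω0 : 0 < ω := volume_unitBall_pos n
  set e : ℝ → ℝ := fun r => (μ.real (Metric.ball x r))⁻¹ *
      ∫ y in Metric.ball x r, ‖σ y - ν‖ ∂μ with he
  have hscale : Tendsto (fun R : ℝ => (M + 2) * R) (𝓝[>] 0) (𝓝[>] 0) := by
    refine tendsto_nhdsWithin_iff.2 ⟨?_, ?_⟩
    · have : Tendsto (fun R : ℝ => (M + 2) * R) (𝓝 0) (𝓝 ((M + 2) * 0)) :=
        (continuous_const.mul continuous_id).tendsto 0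
      rw [mul_zero] at this
      exact this.mono_left nhdsWithin_le_nhds
    · filter_upwards [self_mem_nhdsWithin] with R hR
      have hR : (0 : ℝ) < R := hR
      change 0 < (M + 2) * R
      positivity
  set K := ω * (M + 1) ^ n * (M + 1) * (C * (M + 2) ^ n / (M + 2)) / (δ * ρ ^ n) with hK
  have hlim : Tendsto (fun R : ℝ => K * e ((M + 2) * R)) (𝓝[>] 0) (𝓝 0) := by
    simpa using (h.tendsto_average_norm_sub.comp hscale).const_mul K
  refine squeeze_zero' ?_ ?_ hlim
  · filter_upwards [self_mem_nhdsWithin] with R hR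
    have : (0 : ℝ) < R := hR
    positivity
  · have hev : ∀ᶠ R : ℝ in 𝓝[>] 0, (M + 2) * R < min r₀ r₁ :=
      (tendsto_nhdsWithin_iff.1 hscale).1.eventually (gt_mem_nhds (lt_min hr₀ hr₁))
    filter_upwards [self_mem_nhdsWithin, hev] with R hR hRs
    have hR : 0 < R := hR
    have h1 := h.volume_upper_mul_le hM hρ1 hR
    have hN : 0 < (M + 2) * R := by positivity
    have hm := h.measureReal_ball_pos hN
    have h2 : ∫ y in Metric.ball x ((M + 2) * R), ‖σ y - ν‖ ∂μ
        = e ((M + 2) * R) * μ.real (Metric.ball x ((M + 2) * R)) := by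
      simp only [he]; field_simp
    have he0 : 0 ≤ e ((M + 2) * R) :=
      mul_nonneg (inv_nonneg.2 hm.le) (integral_nonneg fun y => norm_nonneg _)
    have h3 := hper ((M + 2) * R) hN (hRs.trans_le (min_le_right _ _))
    have h4 := hdens (ρ * R) (by positivity) (by
      have := hRs.trans_le (min_le_left _ _)
      nlinarith)
    set v := volume.real {y | y ∈ Metric.ball x (M * R) ∧ ρ * R < inner ℝ ν (y - x) ∧ y ∉ E}
    have hv : 0 ≤ v := measureReal_nonneg
    rw [h2, volume_ball_real 0 (by positivity)] at h1
    have h5 : v * (δ * (ρ * R) ^ n) ≤ (ω * ((M + 1) * R) ^ n) * (M + 1) / (M + 2) *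
        e ((M + 2) * R) * (C * ((M + 2) * R) ^ n) := by
      calc v * (δ * (ρ * R) ^ n) ≤ v * volume.real (E ∩ Metric.ball x (ρ * R)) := by gcongr
        _ ≤ _ := h1
        _ = (ω * ((M + 1) * R) ^ n) * (M + 1) / (M + 2) * e ((M + 2) * R) *
            ((M + 2) * R * μ.real (Metric.ball x ((M + 2) * R))) := by
            rw [hω]; field_simp
        _ ≤ _ := by gcongr
    rw [div_le_iff₀ (by positivity)]
    have h6 : 0 < δ * (ρ * R) ^ n := by positivity
    rw [← le_div_iff₀ h6] at h5
    refine h5.trans (le_of_eq ?_)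
    rw [hK, mul_pow, mul_pow, mul_pow]
    field_simp

end HasNormalAt

/-! ### Continuity of the energy under local convergence with a translation bound -/

lemma poissonIntegral_neg {n : ℕ} (s : ℝ) (d : Rn n → ℝ) :
    poissonIntegral s (-d) = -poissonIntegral s d := by
  funext X
  simp [poissonIntegral, integral_neg]

lemma energy_neg {n : ℕ} (s : ℝ) (d : Rn n → ℝ) : energy s (-d) = energy s d := by
  simp [energy, poissonIntegral_neg, fderiv_neg]

/-- The square root of the energy is a weighted `L²` norm of a gradient depending linearly on the
data, so Minkowski's inequality applies. -/
lemma energy_add_rpow_le {n : ℕ} {s : ℝ} (hs : 0 < s) (hs1 : s < 1) {f g : Rn n → ℝ}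
    (hf : Measurable f) (hg : Measurable g) {A B : ℝ} (hA : ∀ y, |f y| ≤ A) (hB : ∀ y, |g y| ≤ B) :
    energy s (f + g) ^ (1 / 2 : ℝ) ≤ energy s f ^ (1 / 2 : ℝ) + energy s g ^ (1 / 2 : ℝ) := by
  have hwm : Measurable fun X : Rn (n + 1) => ENNReal.ofReal (vert X ^ (1 - s)) := by fun_prop
  have key : ∀ d : Rn n → ℝ, energy s d = ∫⁻ X in halfBall (0 : Rn (n + 1)) 1,
      (ENNReal.ofReal (vert X ^ (1 - s)) ^ (1 / 2 : ℝ) *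
        ‖fderiv ℝ (poissonIntegral s d) X‖ₑ) ^ (2 : ℝ) := by
    intro d
    refine lintegral_congr fun X => ?_
    rw [ENNReal.mul_rpow_of_nonneg _ _ (by norm_num), ← ENNReal.rpow_mul]
    norm_num
  have hm : ∀ d : Rn n → ℝ, Measurable fun X : Rn (n + 1) =>
      ENNReal.ofReal (vert X ^ (1 - s)) ^ (1 / 2 : ℝ) * ‖fderiv ℝ (poissonIntegral s d) X‖ₑ :=
    fun d => (hwm.pow_const _).mul (measurable_fderiv ℝ _).enorm
  refine le_trans ?_ ((ENNReal.lintegral_Lp_add_le (hm f).aemeasurable (hm g).aemeasurable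
    (p := 2) (by norm_num)).trans_eq (by rw [← key, ← key]))
  rw [key]
  refine ENNReal.rpow_le_rpow ?_ (by norm_num)
  refine setLIntegral_mono' (measurableSet_halfBall _ _) fun X hX => ?_
  refine ENNReal.rpow_le_rpow ?_ (by norm_num)
  have hfd := hasFDerivAt_poissonIntegral hs hs1 hX.2 hf hA
  have hgd := hasFDerivAt_poissonIntegral hs hs1 hX.2 hg hB
  have hfg : fderiv ℝ (poissonIntegral s (f + g)) X
      = fderiv ℝ (poissonIntegral s f) X + fderiv ℝ (poissonIntegral s g) X := by
    have h1 : poissonIntegral s (f + g) =ᶠ[𝓝 X] poissonIntegral s f + poissonIntegral s g := by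
      filter_upwards [(isOpen_lt continuous_const continuous_vert).mem_nhds hX.2] with Y hY
      rw [Pi.add_apply, poissonIntegral, poissonIntegral, poissonIntegral,
        ← integral_add (integrable_poissonKernel_mul hs hY hf hA)
          (integrable_poissonKernel_mul hs hY hg hB)]
      simp [mul_add]
    rw [h1.fderiv_eq, fderiv_add hfd.differentiableAt hgd.differentiableAt]
  rw [hfg]
  exact (mul_le_mul' le_rfl (enorm_add_le (fderiv ℝ (poissonIntegral s f) X)
    (fderiv ℝ (poissonIntegral s g) X))).trans_eq (mul_add _ _ _)

lemma tendsto_energy_of_tendsto_sub {n : ℕ} {s : ℝ} (hs : 0 < s) (hs1 : s < 1) {ι : Type*}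
    {l : Filter ι} {u : ι → Rn n → ℝ} {v : Rn n → ℝ} (hu : ∀ i, Measurable (u i))
    (hv : Measurable v) {A : ℝ} (hA : ∀ i y, |u i y| ≤ A) (hB : ∀ y, |v y| ≤ A)
    (h : Tendsto (fun i => energy s (u i - v)) l (𝓝 0)) (hfin : energy s v ≠ ∞) :
    Tendsto (fun i => energy s (u i)) l (𝓝 (energy s v)) := by
  have hd : ∀ i y, |(u i - v) y| ≤ A + A := fun i y =>
    (abs_sub _ _).trans (add_le_add (hA i y) (hB y))
  have hd' : ∀ i y, |(-(u i - v)) y| ≤ A + A := fun i y => by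
    rw [Pi.neg_apply, abs_neg]; exact hd i y
  have h0 : Tendsto (fun i => energy s (u i - v) ^ (1 / 2 : ℝ)) l (𝓝 0) := by
    have := (ENNReal.continuous_rpow_const (y := 1 / 2)).tendsto 0 |>.comp h
    simpa [Function.comp_def] using this
  have hvf : energy s v ^ (1 / 2 : ℝ) ≠ ∞ := ENNReal.rpow_ne_top_of_nonneg (by norm_num) hfin
  have h1 : Tendsto (fun i => energy s (u i) ^ (1 / 2 : ℝ)) l (𝓝 (energy s v ^ (1 / 2 : ℝ))) := by
    refine tendsto_of_tendsto_of_tendsto_of_le_of_le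
      (g := fun i => energy s v ^ (1 / 2 : ℝ) - energy s (u i - v) ^ (1 / 2 : ℝ))
      (h := fun i => energy s v ^ (1 / 2 : ℝ) + energy s (u i - v) ^ (1 / 2 : ℝ)) ?_ ?_ ?_ ?_
    · simpa using ENNReal.Tendsto.sub tendsto_const_nhds h0 (Or.inl hvf)
    · simpa using tendsto_const_nhds.add h0
    · intro i
      rw [tsub_le_iff_right, ← energy_neg s (u i - v)]
      have := energy_add_rpow_le hs hs1 (hu i) ((hu i).sub hv).neg (hA i) (hd' i)
      rwa [show u i + -(u i - v) = v by abel] at this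
    · intro i
      have := energy_add_rpow_le hs hs1 hv ((hu i).sub hv) hB (hd i)
      rwa [show v + (u i - v) = u i by abel] at this
  have h2 := (ENNReal.continuous_rpow_const (y := 2)).tendsto _ |>.comp h1
  have h3 : ∀ e : ℝ≥0∞, (e ^ (1 / 2 : ℝ)) ^ (2 : ℝ) = e := fun e => by
    rw [← ENNReal.rpow_mul]; norm_num
  simpa only [Function.comp_def, h3] using h2

/-- In polar coordinates the integrand is a multiple of `r^(-b)` near zero, which needs `b < 1`, and
of `r^(-1-b)` at infinity, which needs `b > 0`. -/
lemma lintegral_norm_rpow_mul_min_lt_top {n : ℕ} (hn : 1 ≤ n) {b : ℝ} (hb : 0 < b) (hb1 : b < 1)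
    (K : ℝ) : ∫⁻ w : Rn n, ENNReal.ofReal (‖w‖ ^ (-(n + b))) *
      ENNReal.ofReal (K * min ‖w‖ 1) < ∞ := by
  have : Nonempty (Fin n) := ⟨⟨0, hn⟩⟩
  set f : ℝ → ℝ := fun r => r ^ (-(n + b)) * (K * min r 1) with hf
  have hpow : ∀ r : ℝ, 0 < r → ∀ c : ℝ, r ^ (n - 1) * r ^ c = r ^ ((n : ℝ) - 1 + c) := by
    intro r hr c
    rw [← Real.rpow_natCast, ← Real.rpow_add hr, Nat.cast_sub hn, Nat.cast_one]
  have h1 : IntegrableOn (fun r : ℝ => r ^ (n - 1) • f r) (Ioc 0 1) := by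
    have h2 : IntegrableOn (fun r : ℝ => K * r ^ (-b)) (Ioc 0 1) := by
      have := intervalIntegral.intervalIntegrable_rpow' (a := 0) (b := 1) (r := -b) (by linarith)
      rw [intervalIntegrable_iff_integrableOn_Ioc_of_le zero_le_one] at this
      exact this.const_mul K
    refine h2.congr_fun (fun r hr => ?_) measurableSet_Ioc
    have e1 : r ^ (-b) = r ^ (n - 1) * r ^ (-(n + b)) * r := by
      rw [hpow r hr.1, ← Real.rpow_add_one hr.1.ne']; congr 1; ring
    simp only [hf, smul_eq_mul, min_eq_left hr.2]
    rw [e1]; ring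
  have h2 : IntegrableOn (fun r : ℝ => r ^ (n - 1) • f r) (Ioi 1) := by
    have h2 : IntegrableOn (fun r : ℝ => K * r ^ (-1 - b)) (Ioi 1) :=
      (integrableOn_Ioi_rpow_of_lt (by linarith) one_pos).const_mul K
    refine h2.congr_fun (fun r hr => ?_) measurableSet_Ioi
    have hr1 : (1 : ℝ) < r := hr
    have e1 : r ^ (-1 - b) = r ^ (n - 1) * r ^ (-(n + b)) := by
      rw [hpow r (by linarith)]; congr 1; ring
    simp only [hf, smul_eq_mul, min_eq_right hr1.le]
    rw [e1]; ring
  have h3 : IntegrableOn (fun r : ℝ => r ^ (Module.finrank ℝ (Rn n) - 1) • f r) (Ioi 0) := by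
    rw [finrank_euclideanSpace_fin, ← Ioc_union_Ioi_eq_Ioi zero_le_one]
    exact h1.union h2
  have h4 := ((integrable_fun_norm_addHaar (volume : Measure (Rn n))).2 h3).lintegral_lt_top
  refine lt_of_eq_of_lt (lintegral_congr fun w => ?_) h4
  rw [← ENNReal.ofReal_mul (by positivity)]

/-- The points of the unit ball whose membership in `F` is changed by the translation by `w`. -/
def translateDiff {n : ℕ} (F : Set (Rn n)) (w : Rn n) : Set (Rn n) :=
  {z | z ∈ Metric.ball 0 1 ∧ ¬(z + w ∈ F ↔ z ∈ F)}

/-- The part in the ball of radius `M` of the symmetric difference of `F` and `H`. -/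
def ballDiff {n : ℕ} (F H : Set (Rn n)) (M : ℝ) : Set (Rn n) :=
  {z | z ∈ Metric.ball 0 M ∧ ¬(z ∈ F ↔ z ∈ H)}

/-- The set `t` need not be measurable: its measurable hull has the same measure. -/
lemma setLIntegral_le_mul_measure {α : Type*} [MeasurableSpace α] {μ : Measure α} {s t : Set α}
    (hs : MeasurableSet s) {f : α → ℝ≥0∞} {c : ℝ≥0∞} (hc : ∀ x, f x ≤ c)
    (h : ∀ x ∈ s, x ∉ t → f x = 0) : ∫⁻ x in s, f x ∂μ ≤ c * μ t := by
  calc ∫⁻ x in s, f x ∂μ ≤ ∫⁻ x in s, (toMeasurable μ t).indicator (fun _ => c) x ∂μ := by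
        refine setLIntegral_mono' hs fun x hx => ?_
        by_cases hxt : x ∈ t
        · rw [indicator_of_mem (subset_toMeasurable μ t hxt)]; exact hc x
        · rw [h x hx hxt]; exact zero_le
    _ ≤ ∫⁻ x, (toMeasurable μ t).indicator (fun _ => c) x ∂μ := setLIntegral_le_lintegral _ _
    _ = c * μ t := by
        rw [lintegral_indicator_const (measurableSet_toMeasurable μ t), measure_toMeasurable]

lemma signedChi_eq_of_iff {n : ℕ} {E F : Set (Rn n)} {x y : Rn n} (h : x ∈ E ↔ y ∈ F) :
    signedChi E x = signedChi F y := by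
  by_cases hx : x ∈ E
  · rw [signedChi_of_mem hx, signedChi_of_mem (h.1 hx)]
  · rw [signedChi_of_notMem hx, signedChi_of_notMem fun hy => hx (h.2 hy)]

section

variable {n : ℕ} (F H : Set (Rn n)) (w : Rn n)

lemma enorm_signedChi_sub_sq_le (x : Rn n) :
    ‖(signedChi F - signedChi H) (x + w) - (signedChi F - signedChi H) x‖ₑ ^ 2 ≤ 16 := by
  have h1 : ‖(signedChi F - signedChi H) (x + w) - (signedChi F - signedChi H) x‖ ≤ 4 := by
    rw [Real.norm_eq_abs, abs_le, Pi.sub_apply, Pi.sub_apply]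
    have a1 := abs_le.1 (abs_signedChi_le F (x + w))
    have a2 := abs_le.1 (abs_signedChi_le F x)
    have a3 := abs_le.1 (abs_signedChi_le H (x + w))
    have a4 := abs_le.1 (abs_signedChi_le H x)
    constructor <;> linarith [a1.1, a1.2, a2.1, a2.2, a3.1, a3.2, a4.1, a4.2]
  rw [← ofReal_norm]
  calc _ ≤ ENNReal.ofReal 4 ^ 2 := by gcongr
    _ = 16 := by rw [← ENNReal.ofReal_pow (by norm_num)]; norm_num

/-- Provides the majorant: its bound can be made uniform along the family and linear in `‖w‖`. -/
lemma lintegral_signedChi_sub_le_translateDiff :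
    ∫⁻ x in Metric.ball 0 1,
      ‖(signedChi F - signedChi H) (x + w) - (signedChi F - signedChi H) x‖ₑ ^ 2
      ≤ 16 * (volume (translateDiff F w) + volume (translateDiff H w)) := by
  refine (setLIntegral_le_mul_measure Metric.isOpen_ball.measurableSet
    (enorm_signedChi_sub_sq_le F H w) (t := translateDiff F w ∪ translateDiff H w) ?_).trans ?_
  · intro x hx hxt
    have h1 : x + w ∈ F ↔ x ∈ F := not_not.1 fun hc => hxt (Or.inl ⟨hx, hc⟩)
    have h2 : x + w ∈ H ↔ x ∈ H := not_not.1 fun hc => hxt (Or.inr ⟨hx, hc⟩)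
    simp [signedChi_eq_of_iff h1, signedChi_eq_of_iff h2]
  · gcongr
    exact measure_union_le _ _

/-- Provides the pointwise limit for fixed `w`: only the symmetric difference in a fixed ball
enters. -/
lemma lintegral_signedChi_sub_le_ballDiff :
    ∫⁻ x in Metric.ball 0 1,
      ‖(signedChi F - signedChi H) (x + w) - (signedChi F - signedChi H) x‖ₑ ^ 2
      ≤ 32 * volume (ballDiff F H (1 + ‖w‖)) := by
  refine (setLIntegral_le_mul_measure Metric.isOpen_ball.measurableSet
    (enorm_signedChi_sub_sq_le F H w) (t := (· + w) ⁻¹' ballDiff F H (1 + ‖w‖) ∪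
      ballDiff F H (1 + ‖w‖)) ?_).trans ?_
  · intro x hx hxt
    have hx1 : ‖x‖ < 1 := mem_ball_zero_iff.1 hx
    have h1 : x + w ∈ F ↔ x + w ∈ H := not_not.1 fun hc => hxt (Or.inl ⟨mem_ball_zero_iff.2
      ((norm_add_le _ _).trans_lt (by linarith)), hc⟩)
    have h2 : x ∈ F ↔ x ∈ H := not_not.1 fun hc => hxt (Or.inr ⟨mem_ball_zero_iff.2
      (by linarith [norm_nonneg w]), hc⟩)
    simp [signedChi_eq_of_iff h1, signedChi_eq_of_iff h2]
  · calc _ ≤ 16 * (volume ((· + w) ⁻¹' ballDiff F H (1 + ‖w‖)) +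
          volume (ballDiff F H (1 + ‖w‖))) := by gcongr; exact measure_union_le _ _
      _ = _ := by rw [measure_preimage_add_right, ← two_mul, ← mul_assoc]; norm_num

end

/-- Local convergence in measure, together with a uniform Lipschitz bound on translations,
implies convergence of the extension energy. -/
lemma tendsto_energy_signedChi {n : ℕ} (hn : 1 ≤ n) {s : ℝ} (hs : 0 < s) (hs1 : s < 1)
    {ι : Type*} {l : Filter ι} [l.IsCountablyGenerated] {F : ι → Set (Rn n)} {H : Set (Rn n)}
    (hF : ∀ i, MeasurableSet (F i)) (hH : MeasurableSet H)
    (hconv : ∀ M : ℝ, 0 < M → Tendsto (fun i => volume (ballDiff (F i) H M)) l (𝓝 0))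
    {K : ℝ} (hK : 0 ≤ K)
    (hFK : ∀ᶠ i in l, ∀ w : Rn n, ‖w‖ ≤ 1 → volume (translateDiff (F i) w)
      ≤ ENNReal.ofReal (K * ‖w‖))
    (hHK : ∀ w : Rn n, ‖w‖ ≤ 1 → volume (translateDiff H w) ≤ ENNReal.ofReal (K * ‖w‖))
    (hfin : energy s (signedChi H) ≠ ∞) :
    Tendsto (fun i => energy s (signedChi (F i))) l (𝓝 (energy s (signedChi H))) := by
  refine tendsto_energy_of_tendsto_sub hs hs1 (fun i => measurable_signedChi (hF i))
    (measurable_signedChi hH) (fun i => abs_signedChi_le _) (abs_signedChi_le H) ?_ hfin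
  -- This choice satisfies both `a < s`, for the energy bound, and `s + a < 1`, for integrability of
  -- the majorant at `w = 0`.
  set a := s * (1 - s) / 2 with ha
  have hs2 : 0 < 1 - s := by linarith
  have ha0 : 0 < a := by positivity
  have has : a < s := by nlinarith
  have hsa : s + a < 1 := by nlinarith
  obtain ⟨C, hC, hCle⟩ := exists_energy_poissonIntegral_le n hs hs1 ha0 has
  set D : ι → Rn n → ℝ≥0∞ := fun i w => ∫⁻ x in Metric.ball 0 1,
    ‖(signedChi (F i) - signedChi H) (x + w) - (signedChi (F i) - signedChi H) x‖ₑ ^ 2 with hD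
  set k : Rn n → ℝ≥0∞ := fun w => ENNReal.ofReal (‖w‖ ^ (-(n + s + a))) with hk
  have hdm : ∀ i, Measurable (signedChi (F i) - signedChi H) := fun i =>
    (measurable_signedChi (hF i)).sub (measurable_signedChi hH)
  have hDm : ∀ i, Measurable (D i) := by
    intro i
    have := hdm i
    refine Measurable.lintegral_prod_right' (f := fun p : Rn n × Rn n =>
      ‖(signedChi (F i) - signedChi H) (p.2 + p.1) - (signedChi (F i) - signedChi H) p.2‖ₑ ^ 2) ?_
    fun_prop
  have hkm : Measurable k := by fun_prop
  set V := volume (Metric.ball (0 : Rn n) 1) with hV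
  have hVfin : V ≠ ∞ := measure_ball_lt_top.ne
  set K' := 32 * (K + V.toReal) with hK'
  -- Dominated convergence in `w`: the translation bounds serve for `‖w‖ ≤ 1` and the volume of the
  -- unit ball for larger `w`.
  have hlim : Tendsto (fun i => ∫⁻ w, k w * D i w) l (𝓝 (∫⁻ _ : Rn n, 0)) := by
    refine tendsto_lintegral_filter_of_dominated_convergence
      (fun w => k w * ENNReal.ofReal (K' * min ‖w‖ 1)) ?_ ?_ ?_ ?_
    · exact Eventually.of_forall fun i => hkm.mul (hDm i)
    · filter_upwards [hFK] with i hi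
      refine ae_of_all _ fun w => ?_
      gcongr
      have hle := lintegral_signedChi_sub_le_translateDiff (F i) H w
      refine hle.trans ?_
      have htr : ∀ G : Set (Rn n), volume (translateDiff G w) ≤ V := fun G =>
        measure_mono fun z hz => hz.1
      rcases le_total ‖w‖ 1 with hw | hw
      · calc _ ≤ 16 * (ENNReal.ofReal (K * ‖w‖) + ENNReal.ofReal (K * ‖w‖)) := by
              gcongr
              exacts [hi w hw, hHK w hw]
          _ = ENNReal.ofReal (32 * (K * ‖w‖)) := by
              rw [← two_mul, ← mul_assoc, ENNReal.ofReal_mul (p := 32) (by norm_num)]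
              congr 1
              norm_num
          _ ≤ _ := by
              refine ENNReal.ofReal_le_ofReal ?_
              rw [min_eq_left hw, hK']
              have : 0 ≤ V.toReal * ‖w‖ := by positivity
              linarith
      · calc _ ≤ 16 * (V + V) := by
              gcongr
              exacts [htr _, htr _]
          _ = ENNReal.ofReal (32 * V.toReal) := by
              rw [← two_mul, ← mul_assoc, ENNReal.ofReal_mul (by norm_num),
                ENNReal.ofReal_toReal hVfin]
              congr 1
              norm_num
          _ ≤ _ := by
              refine ENNReal.ofReal_le_ofReal ?_
              rw [min_eq_right hw, hK']
              linarith
    · have := lintegral_norm_rpow_mul_min_lt_top hn (b := s + a) (by linarith) hsa K'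
      simp only [← add_assoc] at this
      exact this.ne
    · refine ae_of_all _ fun w => ?_
      have h1 : Tendsto (fun i => 32 * volume (ballDiff (F i) H (1 + ‖w‖))) l (𝓝 0) := by
        simpa using ENNReal.Tendsto.const_mul (hconv (1 + ‖w‖) (by positivity))
          (Or.inr (by norm_num : (32 : ℝ≥0∞) ≠ ∞))
      have h2 : Tendsto (fun i => D i w) l (𝓝 0) :=
        tendsto_of_tendsto_of_tendsto_of_le_of_le tendsto_const_nhds h1 (fun i => zero_le)
          fun i => lintegral_signedChi_sub_le_ballDiff (F i) H w
      simpa using ENNReal.Tendsto.const_mul h2 (Or.inr ENNReal.ofReal_ne_top)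
  rw [lintegral_zero] at hlim
  have hlim' : Tendsto (fun i => C * ∫⁻ w, k w * D i w) l (𝓝 0) := by
    simpa using ENNReal.Tendsto.const_mul hlim (Or.inr hC)
  refine tendsto_of_tendsto_of_tendsto_of_le_of_le tendsto_const_nhds hlim' (fun i => zero_le)
    fun i => ?_
  exact hCle _ (1 + 1) (hdm i) fun y =>
    (abs_sub _ _).trans (add_le_add (abs_signedChi_le _ y) (abs_signedChi_le _ y))

/-! ### Convergence of the blow-ups to the half-space -/

lemma volume_similarity {n : ℕ} (L : Rn n ≃ₗᵢ[ℝ] Rn n) (x : Rn n) {R : ℝ} (hR : 0 < R)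
    {T : Set (Rn n)} (hT : MeasurableSet T) :
    volume T = ENNReal.ofReal (R ^ n) * volume {z | x + R • L z ∈ T} := by
  have hm : Measurable fun z : Rn n => x + R • L z := by fun_prop
  have h1 := lintegral_similarity L x hR (measurable_one.indicator hT (f := (1 : Rn n → ℝ≥0∞)))
  rw [lintegral_indicator_one hT] at h1
  have h2 : MeasurableSet {z : Rn n | x + R • L z ∈ T} := hm hT
  rw [h1, ← lintegral_indicator_one h2]
  rfl

lemma volumeReal_similarity {n : ℕ} (L : Rn n ≃ₗᵢ[ℝ] Rn n) (x : Rn n) {R : ℝ} (hR : 0 < R)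
    {T : Set (Rn n)} (hT : MeasurableSet T) :
    volume.real {z | x + R • L z ∈ T} = volume.real T / R ^ n := by
  rw [measureReal_def, measureReal_def, volume_similarity L x hR hT, ENNReal.toReal_mul,
    ENNReal.toReal_ofReal (by positivity)]
  field_simp

lemma norm_similarity_sub {n : ℕ} (L : Rn n ≃ₗᵢ[ℝ] Rn n) (x : Rn n) {R : ℝ} (hR : 0 < R)
    (z : Rn n) : ‖x + R • L z - x‖ = R * ‖z‖ := by
  rw [add_sub_cancel_left, norm_smul, LinearIsometryEquiv.norm_map, Real.norm_of_nonneg hR.le]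

lemma similarity_mem_ball_iff {n : ℕ} (L : Rn n ≃ₗᵢ[ℝ] Rn n) (x : Rn n) {R : ℝ} (hR : 0 < R)
    {M : ℝ} {z : Rn n} : x + R • L z ∈ Metric.ball x (M * R) ↔ z ∈ Metric.ball 0 M := by
  rw [mem_ball_iff_norm, norm_similarity_sub L x hR, mem_ball_zero_iff, mul_comm,
    mul_lt_mul_iff_left₀ hR]

/-- The part of a ball that is close to the hyperplane `{vert = 0}`. -/
lemma volumeReal_slab_le (m : ℕ) (M : ℝ) {ρ : ℝ} (hρ : 0 ≤ ρ) :
    volume.real {z : Rn (m + 1) | z ∈ Metric.ball 0 M ∧ |vert z| ≤ ρ}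
      ≤ 2 * volume.real (Metric.ball (0 : Rn m) M) * ρ := by
  have hS : MeasurableSet (Metric.ball (0 : Rn m) M ×ˢ Icc (-ρ) ρ) :=
    Metric.isOpen_ball.measurableSet.prod measurableSet_Icc
  have hv : volume ((fun X : Rn (m + 1) => (horiz X, vert X)) ⁻¹'
      (Metric.ball (0 : Rn m) M ×ˢ Icc (-ρ) ρ))
      = volume (Metric.ball (0 : Rn m) M) * ENNReal.ofReal (2 * ρ) := by
    rw [(measurePreserving_horiz_vert m).measure_preimage hS.nullMeasurableSet,
      Measure.volume_eq_prod, Measure.prod_prod, Real.volume_Icc]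
    congr 2; ring
  have hsub : {z : Rn (m + 1) | z ∈ Metric.ball 0 M ∧ |vert z| ≤ ρ} ⊆
      (fun X : Rn (m + 1) => (horiz X, vert X)) ⁻¹' (Metric.ball (0 : Rn m) M ×ˢ Icc (-ρ) ρ) := by
    rintro z ⟨hz, hzρ⟩
    exact ⟨mem_ball_zero_iff.2 ((norm_horiz_le z).trans_lt (mem_ball_zero_iff.1 hz)),
      abs_le.1 hzρ⟩
  refine (measureReal_mono hsub ?_).trans_eq ?_
  · rw [hv]
    exact ENNReal.mul_ne_top measure_ball_lt_top.ne ENNReal.ofReal_ne_top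
  · rw [measureReal_def, hv, ENNReal.toReal_mul, ENNReal.toReal_ofReal (by positivity),
      measureReal_def]
    ring

/-- A shift by `w` can change the sign of the last coordinate only in the slab where that coordinate
is at most `‖w‖` in absolute value. -/
lemma volume_translateDiff_upperHalf_le (m : ℕ) (w : Rn (m + 1)) :
    volume (translateDiff (upperHalf (m + 1)) w)
      ≤ ENNReal.ofReal (2 * volume.real (Metric.ball (0 : Rn m) 1) * ‖w‖) := by
  have hsub : translateDiff (upperHalf (m + 1)) w ⊆
      {z : Rn (m + 1) | z ∈ Metric.ball 0 1 ∧ |vert z| ≤ ‖w‖} := by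
    rintro z ⟨hz, hne⟩
    refine ⟨hz, ?_⟩
    have h1 := abs_le.1 (abs_vert_le w)
    simp only [upperHalf_succ, mem_ofPred_eq, vert_add] at hne
    by_contra hlt
    rw [not_le, lt_abs] at hlt
    apply hne
    rcases hlt with hlt | hlt
    · exact ⟨fun _ => by linarith [norm_nonneg w], fun _ => by linarith⟩
    · exact ⟨fun _ => by linarith, fun _ => by linarith [norm_nonneg w]⟩
  have hfin : volume {z : Rn (m + 1) | z ∈ Metric.ball 0 1 ∧ |vert z| ≤ ‖w‖} ≠ ∞ :=
    ((measure_mono fun z hz => hz.1).trans_lt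
      (measure_ball_lt_top (x := (0 : Rn (m + 1))) (r := 1))).ne
  refine (measure_mono hsub).trans ?_
  rw [← ofReal_measureReal hfin]
  exact ENNReal.ofReal_le_ofReal (volumeReal_slab_le m 1 (norm_nonneg w))

namespace HasNormalAt

lemma tendsto_rescaled_upper {n : ℕ} {E : Set (Rn n)} {μ : Measure (Rn n)} {σ : Rn n → Rn n}
    {x ν : Rn n} (h : HasNormalAt E μ σ x ν) (hn : 1 ≤ n) (L : Rn n ≃ₗᵢ[ℝ] Rn n) {M ρ : ℝ}
    (hM : 0 < M) (hρ : 0 < ρ) (hρ1 : ρ ≤ 1) :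
    Tendsto (fun R : ℝ => volume.real
      {z | z ∈ Metric.ball 0 M ∧ ρ < inner ℝ ν (L z) ∧ x + R • L z ∉ E}) (𝓝[>] 0) (𝓝 0) := by
  refine (h.tendsto_volume_upper hn hM hρ hρ1).congr' ?_
  filter_upwards [self_mem_nhdsWithin] with R hR
  have hR : 0 < R := hR
  have hm1 : MeasurableSet {y : Rn n | ρ * R < inner ℝ ν (y - x)} :=
    measurableSet_lt measurable_const (by fun_prop)
  have hTm : MeasurableSet
      {y | y ∈ Metric.ball x (M * R) ∧ ρ * R < inner ℝ ν (y - x) ∧ y ∉ E} :=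
    Metric.isOpen_ball.measurableSet.inter (hm1.inter h.isWeakGradient.measurableSet.compl)
  rw [← volumeReal_similarity L x hR hTm]
  congr 1
  ext z
  simp only [mem_ofPred_eq, similarity_mem_ball_iff L x hR, add_sub_cancel_left,
    inner_smul_right, mul_comm R, mul_lt_mul_iff_left₀ hR]

/-- Points that leave `E` and points that enter it are handled by `E` and its complement, which
share the perimeter measure. Its growth like `R^(n-1)` makes the rescaled bound independent of `R`.
-/
lemma exists_volume_translateDiff_rescaled_le {n : ℕ} {E : Set (Rn n)} {μ : Measure (Rn n)}
    {σ : Rn n → Rn n} {x ν : Rn n} (h : HasNormalAt E μ σ x ν) (L : Rn n ≃ₗᵢ[ℝ] Rn n) :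
    ∃ K : ℝ, 0 ≤ K ∧ ∀ᶠ R : ℝ in 𝓝[>] 0, ∀ w : Rn n, ‖w‖ ≤ 1 →
      volume (translateDiff {z | x + R • L z ∈ E} w) ≤ ENNReal.ofReal (K * ‖w‖) := by
  obtain ⟨C, r₁, hC, hr₁, hper⟩ := h.exists_perimeter_ball_le
  have hg := h.isWeakGradient
  have hμ := hg.locallyFinite
  refine ⟨C * 2 ^ n, by positivity, ?_⟩
  filter_upwards [Ioo_mem_nhdsGT (show (0 : ℝ) < r₁ / 2 by positivity)] with R hR w hw
  obtain ⟨hR, hRr⟩ := hR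
  have key : ∀ {G : Set (Rn n)} {τ : Rn n → Rn n}, IsWeakGradient G μ τ →
      volume {z | z ∈ Metric.ball 0 1 ∧ x + R • L z ∈ G ∧ x + R • L (z + w) ∉ G}
        ≤ ENNReal.ofReal (C * 2 ^ n / 2 * ‖w‖) := by
    intro G τ hG
    have hTm : MeasurableSet {y | y ∈ Metric.ball x R ∧ y ∈ G ∧ y + R • L w ∉ G} := by
      have hm : Measurable fun y : Rn n => y + R • L w := by fun_prop
      exact Metric.isOpen_ball.measurableSet.inter
        (hG.measurableSet.inter (hm hG.measurableSet.compl))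
    have hset : {z | z ∈ Metric.ball 0 1 ∧ x + R • L z ∈ G ∧ x + R • L (z + w) ∉ G}
        = {z | x + R • L z ∈ {y | y ∈ Metric.ball x R ∧ y ∈ G ∧ y + R • L w ∉ G}} := by
      ext z
      have := similarity_mem_ball_iff L x hR (M := 1) (z := z)
      rw [one_mul] at this
      simp only [mem_ofPred_eq, this, map_add, smul_add, add_assoc]
    have hfin : volume {z | z ∈ Metric.ball 0 1 ∧ x + R • L z ∈ G ∧ x + R • L (z + w) ∉ G} ≠ ∞ :=
      ((measure_mono fun z hz => hz.1).trans_lt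
        (measure_ball_lt_top (x := (0 : Rn n)) (r := 1))).ne
    rw [← ofReal_measureReal hfin]
    refine ENNReal.ofReal_le_ofReal ?_
    rw [hset, volumeReal_similarity L x hR hTm, div_le_iff₀ (by positivity)]
    have hnw : ‖R • L w‖ = R * ‖w‖ := by
      rw [norm_smul, LinearIsometryEquiv.norm_map, Real.norm_of_nonneg hR.le]
    have h1 := hG.volume_translate_diff_le_norm x (R • L w) R
    rw [hnw] at h1
    have h2 : μ.real (Metric.ball x (R + R * ‖w‖)) ≤ μ.real (Metric.ball x (2 * R)) :=
      measureReal_mono (Metric.ball_subset_ball (by nlinarith)) measure_ball_lt_top.ne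
    have h3 := hper (2 * R) (by positivity) (by linarith)
    calc _ ≤ R * ‖w‖ * μ.real (Metric.ball x (R + R * ‖w‖)) := h1
      _ ≤ R * ‖w‖ * μ.real (Metric.ball x (2 * R)) := by gcongr
      _ = ‖w‖ / 2 * (2 * R * μ.real (Metric.ball x (2 * R))) := by ring
      _ ≤ ‖w‖ / 2 * (C * (2 * R) ^ n) := by gcongr
      _ = _ := by rw [mul_pow]; ring
  have hsub : translateDiff {z | x + R • L z ∈ E} w ⊆
      {z | z ∈ Metric.ball 0 1 ∧ x + R • L z ∈ E ∧ x + R • L (z + w) ∉ E} ∪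
      {z | z ∈ Metric.ball 0 1 ∧ x + R • L z ∈ Eᶜ ∧ x + R • L (z + w) ∉ Eᶜ} := by
    rintro z ⟨hz, hne⟩
    simp only [mem_ofPred_eq] at hne
    simp only [mem_union, mem_ofPred_eq, mem_compl_iff]
    tauto
  calc _ ≤ _ := measure_mono hsub
    _ ≤ _ := measure_union_le _ _
    _ ≤ _ := add_le_add (key hg) (key hg.compl)
    _ = _ := by
        rw [← ENNReal.ofReal_add (by positivity) (by positivity)]
        congr 1; ring

lemma tendsto_volume_ballDiff_rescaled {m : ℕ} {E : Set (Rn (m + 1))} {μ : Measure (Rn (m + 1))}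
    {σ : Rn (m + 1) → Rn (m + 1)} {x ν : Rn (m + 1)} (h : HasNormalAt E μ σ x ν)
    {L : Rn (m + 1) ≃ₗᵢ[ℝ] Rn (m + 1)} (hL : ∀ z, inner ℝ ν (L z) = vert z) {M : ℝ} (hM : 0 < M) :
    Tendsto (fun R : ℝ => volume (ballDiff {z | x + R • L z ∈ E} (upperHalf (m + 1)) M))
      (𝓝[>] 0) (𝓝 0) := by
  have hball : ∀ p : Rn (m + 1) → Prop, volume {z | z ∈ Metric.ball 0 M ∧ p z} ≠ ∞ := fun p =>
    ((measure_mono fun z hz => hz.1).trans_lt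
      (measure_ball_lt_top (x := (0 : Rn (m + 1))) (r := M))).ne
  have hfin : ∀ R : ℝ, volume (ballDiff {z | x + R • L z ∈ E} (upperHalf (m + 1)) M) ≠ ∞ :=
    fun R => hball _
  rw [← ENNReal.tendsto_toReal_iff hfin ENNReal.zero_ne_top, ENNReal.toReal_zero,
    Metric.tendsto_nhds]
  intro ε hε
  set c := 2 * volume.real (Metric.ball (0 : Rn m) M) with hc
  have hc0 : 0 ≤ c := by positivity
  -- The slab of half-width `ρ` about the hyperplane takes less than `ε / 2`, leaving `ε / 4` for
  -- each of the regions above and below it; `c + 1` avoids dividing by zero.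
  set ρ := min 1 (ε / (3 * (c + 1))) with hρ
  have hρ0 : 0 < ρ := by positivity
  have hρ1 : ρ ≤ 1 := min_le_left _ _
  have hcρ : c * ρ < ε / 2 := by
    have h1 : (c + 1) * ρ ≤ ε / 3 := by
      calc (c + 1) * ρ ≤ (c + 1) * (ε / (3 * (c + 1))) := by gcongr; exact min_le_right _ _
        _ = ε / 3 := by field_simp
    nlinarith
  have hA := h.tendsto_rescaled_upper (Nat.le_add_left 1 m) L hM hρ0 hρ1
  have hB := h.compl.tendsto_rescaled_upper (Nat.le_add_left 1 m) L hM hρ0 hρ1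
  have hε4 : (0 : ℝ) < ε / 4 := by positivity
  filter_upwards [hA.eventually (gt_mem_nhds hε4), hB.eventually (gt_mem_nhds hε4)] with R hRA hRB
  have hsub : ballDiff {z | x + R • L z ∈ E} (upperHalf (m + 1)) M ⊆
      {z | z ∈ Metric.ball 0 M ∧ |vert z| ≤ ρ} ∪
      ({z | z ∈ Metric.ball 0 M ∧ ρ < inner ℝ ν (L z) ∧ x + R • L z ∉ E} ∪
        {z | z ∈ Metric.ball 0 M ∧ ρ < inner ℝ (-ν) (L z) ∧ x + R • L z ∉ Eᶜ}) := by
    rintro z ⟨hz, hne⟩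
    simp only [upperHalf_succ, mem_ofPred_eq] at hne
    simp only [mem_union, mem_ofPred_eq, inner_neg_left, hL, mem_compl_iff, not_not]
    by_cases hzρ : |vert z| ≤ ρ
    · exact Or.inl ⟨hz, hzρ⟩
    · rw [not_le, lt_abs] at hzρ
      refine Or.inr ?_
      rcases hzρ with hlt | hlt
      · exact Or.inl ⟨hz, hlt, fun hE => hne ⟨fun _ => hρ0.trans hlt, fun _ => hE⟩⟩
      · refine Or.inr ⟨hz, hlt, ?_⟩
        by_contra hE
        exact hne ⟨fun hE' => absurd hE' hE, fun hp => by linarith⟩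
  have hle : volume.real (ballDiff {z | x + R • L z ∈ E} (upperHalf (m + 1)) M) ≤
      volume.real {z : Rn (m + 1) | z ∈ Metric.ball 0 M ∧ |vert z| ≤ ρ} +
      (volume.real {z | z ∈ Metric.ball 0 M ∧ ρ < inner ℝ ν (L z) ∧ x + R • L z ∉ E} +
        volume.real {z | z ∈ Metric.ball 0 M ∧ ρ < inner ℝ (-ν) (L z) ∧ x + R • L z ∉ Eᶜ}) :=
    (measureReal_mono hsub (measure_union_ne_top (hball _)
      (measure_union_ne_top (hball _) (hball _)))).trans
      ((measureReal_union_le _ _).trans (add_le_add le_rfl (measureReal_union_le _ _)))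
  have hslab := volumeReal_slab_le m M hρ0.le
  rw [Real.dist_eq, sub_zero, abs_of_nonneg ENNReal.toReal_nonneg]
  change volume.real _ < ε
  linarith

theorem tendsto_Phi {m : ℕ} {E : Set (Rn (m + 1))} {μ : Measure (Rn (m + 1))}
    {σ : Rn (m + 1) → Rn (m + 1)} {x ν : Rn (m + 1)} (h : HasNormalAt E μ σ x ν)
    {s : ℝ} (hs : 0 < s) (hs1 : s < 1) :
    Tendsto (fun R : ℝ => Phi s E x R) (𝓝[>] 0) (𝓝 (Phi s (upperHalf (m + 1)) 0 1)) := by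
  have hE := h.isWeakGradient.measurableSet
  have hH : MeasurableSet (upperHalf (m + 1)) := by
    rw [upperHalf_succ]; exact measurableSet_vert_pos m
  obtain ⟨L, hL⟩ : ∃ L : Rn (m + 1) ≃ₗᵢ[ℝ] Rn (m + 1), ∀ z, inner ℝ ν (L z) = vert z := by
    -- The reflection in the hyperplane orthogonal to `e - ν` sends the last basis vector to `ν`; it
    -- is the identity if they coincide.
    set e : Rn (m + 1) := EuclideanSpace.single (Fin.last m) 1 with he
    have he1 : ‖e‖ = 1 := by simp [he]
    refine ⟨(ℝ ∙ (e - ν))ᗮ.reflection, fun z => ?_⟩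
    have h1 : (ℝ ∙ (e - ν))ᗮ.reflection e = ν :=
      Submodule.reflection_sub (he1.trans h.norm_eq_one.symm)
    nth_rewrite 1 [← h1]
    rw [LinearIsometryEquiv.inner_map_map, he, EuclideanSpace.inner_single_left]
    simp [vert]
  obtain ⟨K, hK, hFK⟩ := h.exists_volume_translateDiff_rescaled_le L
  set K' := max K (2 * volume.real (Metric.ball (0 : Rn m) 1)) with hK'
  have hfin : energy s (signedChi (upperHalf (m + 1))) ≠ ∞ := by
    rw [← Phi_zero_one_eq_energy hs hs1 hH, Phi_upperHalf (m + 1) (Nat.le_add_left 1 m) hs hs1]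
    exact ENNReal.ofReal_ne_top
  have hlim := tendsto_energy_signedChi (Nat.le_add_left 1 m) hs hs1 (l := 𝓝[>] (0 : ℝ))
    (F := fun R => {z | x + R • L z ∈ E}) (H := upperHalf (m + 1)) (K := K')
    (fun R => by
      have hm : Measurable fun z : Rn (m + 1) => x + R • L z := by fun_prop
      exact hm hE)
    hH (fun M hM => h.tendsto_volume_ballDiff_rescaled hL hM) (hK.trans (le_max_left _ _))
    (hFK.mono fun R hR w hw => (hR w hw).trans (ENNReal.ofReal_le_ofReal
      (by gcongr; exact le_max_left _ _)))
    (fun w _ => (volume_translateDiff_upperHalf_le m w).trans (ENNReal.ofReal_le_ofReal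
      (by gcongr; exact le_max_right _ _))) hfin
  rw [Phi_zero_one_eq_energy hs hs1 hH]
  refine hlim.congr' ?_
  filter_upwards [self_mem_nhdsWithin] with R hR
  exact (Phi_eq_energy L x hR hs hs1 hE).symm

end HasNormalAt

end FracPerimeter

end

theorem mainTheorem4 (n : ℕ) (hn : 1 ≤ n) :
    ∃ C : ℝ, 0 < C ∧ ∀ s : ℝ, 0 < s → s < 1 →
      Phi s (upperHalf n) 0 1 = ENNReal.ofReal (halfSpaceValue n s) ∧
      0 < halfSpaceValue n s ∧
      ∀ E : Set (Rn n), NullMeasurableSet E volume → HasLocallyFinitePerimeter E →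
        ∀ x ∈ reducedBoundary E, ∃ L : ℝ≥0∞,
          Tendsto (fun R : ℝ => Phi s E x R) (𝓝[>] 0) (𝓝 L) ∧
          L = Phi s (upperHalf n) 0 1 ∧
          ENNReal.ofReal (C * s / (1 - s)) ≤ L := by
  obtain ⟨C, hC, hCle⟩ := exists_le_halfSpaceValue n hn
  refine ⟨C, hC, fun s hs hs1 => ⟨Phi_upperHalf n hn hs hs1, halfSpaceValue_pos n hn hs hs1,
    fun E hE _ x hx => ⟨_, ?_, rfl, ?_⟩⟩⟩
  · obtain ⟨-, μ, σ, hgrad, hpos, ν, hν, hlim⟩ := hx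
    -- A measurable representative of `E` has the same weak gradient and the same energies, so the
    -- frontier of the original set plays no role from here on.
    obtain ⟨F, -, hF, hFE⟩ := hE.exists_measurable_superset_ae_eq
    have h : HasNormalAt F μ σ x ν := ⟨hgrad.isWeakGradient hF hFE.symm, hpos, hν, hlim⟩
    simp_rw [Phi_congr_ae hFE.symm s x]
    obtain ⟨m, rfl⟩ : ∃ m, n = m + 1 := ⟨n - 1, by omega⟩
    exact h.tendsto_Phi hs hs1
  · rw [Phi_upperHalf n hn hs hs1]
    exact ENNReal.ofReal_le_ofReal (hCle s hs hs1)
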